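/- **Setting.** Let $(\Omega,\mathcal A,\mathbb Q)$ be a probability space with a filtration $\mathbb G=(\mathcal G_t)_{t\ge 0}$ satisfying the usual conditions, and write $\mathbb E_t=\mathbb E[\,\cdot\mid\mathcal G_t]$. A bank with default time $\tau$ trades with counterparties $i=1,\dots,n$ with default times $\tau_i$; these are $\mathbb G$-stopping times with values in $[0,\infty]$. Let $J^i=\mathbf 1_{[0,\tau_i)}$, let $T\ge 0$ be a constant and let $b=\tau\wedge T$. The recovery rates $R_i$ are random variables. The exposures at default $Q^i$, the initial margins $\mathrm{IM}^i$ (received) and $\overline{\mathrm{IM}}{}^i$ (posted), the net spot exposures $P^i$, the interest rate $r$ and the funding spreads $\lambda$ and $\bar\lambda$ are real-valued $\mathbb G$-progressive processes. Almost surely $\int_0^t|r_s|\,ds<\infty$ for all $t\ge0$, and $\beta_t=e^{-\int_0^t r_s\,ds}$. The variables $\mathbf 1_{\{\tau_i<\infty\}}\beta_{\tau_i}(1-R_i)(Q^i_{\tau_i}-\mathrm{IM}^i_{\tau_i})^+$ are integrable and $\mathbb E\int_0^b\beta_s\big|\bar\lambda_s\sum_i J^i_s\overline{\mathrm{IM}}{}^i_s\big|ds<\infty$,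 and $\mathrm{UCVA}$ and $\mathrm{MVA}$ are progressive processes with, for each $t\ge0$, a.s. on $\{t\le b\}$, $$\beta_t\,\mathrm{UCVA}_t=\mathbb E_t\sum_{i:\,t<\tau_i<\infty}\beta_{\tau_i}(1-R_i)(Q^i_{\tau_i}-\mathrm{IM}^i_{\tau_i})^+,\qquad \beta_t\,\mathrm{MVA}_t=\mathbb E_t\int_t^b\beta_s\bar\lambda_s\sum_iJ^i_s\overline{\mathrm{IM}}{}^i_s\,ds .$$ Let $\mathcal H^2$ be the space of progressive processes $Z$ with $\mathbb E\int_0^bZ_s^2\,ds<\infty$. The *counterparty risk replication BSDE* for a progressive process $\mathrm{TRC}^\star$ is: for each $t\ge 0$, a.s. on $\{t\le b\}$, $$\beta_t\,\mathrm{TRC}^\star_t=\beta_t\,\mathrm{UCVA}_t+\beta_t\,\mathrm{MVA}_t+\mathbb E_t\int_t^b\beta_s\lambda_s\Big(\sum_iJ^i_sP^i_s-\mathrm{TRC}^\star_s\Big)^+ds .\tag{1}$$ The *FVA equation* for a progressive process $\mathrm{FVA}^\star$ is: for each $t\ge 0$, a.s. on $\{t\le b\}$, $$\beta_t\,\mathrm{FVA}^\star_t=\mathbb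 E_t\int_t^b\beta_s\lambda_s\Big(\sum_iJ^i_sP^i_s-\mathrm{UCVA}_s-\mathrm{MVA}_s-\mathrm{FVA}^\star_s\Big)^+ds .\tag{2}$$ Being a solution of (1) or (2) includes the integrability over $\Omega\times[0,b]$ (with respect to $d\mathbb Q\,ds$) of the integrand on the right. **Theorem.** Assume that $r$ and $\lambda$ are bounded from below on $[0,b]$, that $\int_0^b|\lambda_s|\,ds<\infty$ almost surely, and that $r$ and $\lambda\big(\sum_iJ^iP^i-\mathrm{UCVA}-\mathrm{MVA}\big)$ are in $\mathcal H^2$. Then: 1. Equation (2) has a solution $\mathrm{FVA}^\star$ in $\mathcal H^2$, and it is unique in $\mathcal H^2$. 2. A process $Y$ solves (1) if and only if $Y-\mathrm{UCVA}-\mathrm{MVA}$ solves (2). In particular $\mathrm{TRC}^\star=\mathrm{UCVA}+\mathrm{MVA}+\mathrm{FVA}^\star$ solves (1), and it is the only solution of (1) with $\mathrm{TRC}^\star-\mathrm{UCVA}-\mathrm{MVA}\in\mathcal H^2$. 3. If in addition $\mathrm{UCVA}+\mathrm{MVA}\in\mathcal H^2$, then (1) has a solution $\mathrm{TRC}^\star$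 in $\mathcal H^2$, and it is unique in $\mathcal H^2$. Uniqueness means that two solutions agree a.s. on $\{t\le b\}$ for each $t\ge 0$. -/

import Mathlib

open MeasureTheory
open scoped NNReal ENNReal

noncomputable section

namespace XVA

/-- Lebesgue measure on the time axis `[0, ∞)`. -/
def lebesgue : Measure ℝ≥0 :=
  Measure.comap (fun t : ℝ≥0 => (t : ℝ)) volume

/-- The data of the model: a bank (default time `bankDefault`) trading with `n` counterparties.
Time is `ℝ≥0`; a random time takes values in `[0, ∞]`. -/
structure Model (Ω : Type*) (n : ℕ) where
  /-- final maturity `T` of the portfolio -/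
  T : ℝ≥0
  /-- default time `τ` of the bank -/
  bankDefault : Ω → WithTop ℝ≥0
  /-- default times `τ_i` of the counterparties -/
  default : Fin n → Ω → WithTop ℝ≥0
  /-- recovery rates `R_i` -/
  recovery : Fin n → Ω → ℝ
  /-- exposures at default `Q^i` -/
  Q : Fin n → ℝ≥0 → Ω → ℝ
  /-- initial margins `IM^i` received from the counterparties -/
  imReceived : Fin n → ℝ≥0 → Ω → ℝ
  /-- initial margins posted by the bank -/
  imPosted : Fin n → ℝ≥0 → Ω → ℝ
  /-- net spot exposures `P^i` (mark-to-market minus variation margin) -/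
  spotExposure : Fin n → ℝ≥0 → Ω → ℝ
  /-- OIS rate `r` -/
  r : ℝ≥0 → Ω → ℝ
  /-- unsecured funding spread `λ` -/
  lam : ℝ≥0 → Ω → ℝ
  /-- initial margin funding spread `λ̄` -/
  lamBar : ℝ≥0 → Ω → ℝ

variable {Ω : Type*} {n : ℕ}

namespace Model

/-- The time horizon `b = τ ∧ T`. -/
def horizon (M : Model Ω n) (ω : Ω) : ℝ≥0 :=
  (min (M.bankDefault ω) (M.T : WithTop ℝ≥0)).untopD M.T

/-- The discount factor `β_t = exp (-∫₀ᵗ r_s ds)`. -/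
def disc (M : Model Ω n) (t : ℝ≥0) (ω : Ω) : ℝ :=
  Real.exp (-∫ s in Set.Iic t, M.r s ω ∂lebesgue)

open Classical in
/-- The survival indicator `J^i = 1_{[0, τ_i)}`. -/
def survival (M : Model Ω n) (i : Fin n) (t : ℝ≥0) (ω : Ω) : ℝ :=
  if (t : WithTop ℝ≥0) < M.default i ω then 1 else 0

/-- The total spot exposure `∑ i, J^i P^i`. -/
def exposure (M : Model Ω n) (t : ℝ≥0) (ω : Ω) : ℝ :=
  ∑ i, M.survival i t ω * M.spotExposure i t ω

open Classical in
/-- The discounted default loss `β_{τ_i} (1 - R_i) (Q^i_{τ_i} - IM^i_{τ_i})⁺`, and `0` if the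
counterparty `i` never defaults. -/
def discLoss (M : Model Ω n) (i : Fin n) (ω : Ω) : ℝ :=
  if M.default i ω = ⊤ then 0
  else
    M.disc ((M.default i ω).untopD 0) ω * ((1 - M.recovery i ω) *
      max (M.Q i ((M.default i ω).untopD 0) ω - M.imReceived i ((M.default i ω).untopD 0) ω) 0)

open Classical in
/-- `∑_{i : t < τ_i} β_{τ_i} (1 - R_i) (Q^i_{τ_i} - IM^i_{τ_i})⁺`. -/
def ucvaFlow (M : Model Ω n) (t : ℝ≥0) (ω : Ω) : ℝ :=
  ∑ i, if (t : WithTop ℝ≥0) < M.default i ω then M.discLoss i ω else 0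

/-- `β_s λ̄_s ∑ i, J^i_s IM̄^i_s`. -/
def mvaRate (M : Model Ω n) (s : ℝ≥0) (ω : Ω) : ℝ :=
  M.disc s ω * (M.lamBar s ω * ∑ i, M.survival i s ω * M.imPosted i s ω)

/-- `∫_t^b β_s λ̄_s (∑ i, J^i_s IM̄^i_s) ds`. -/
def mvaFlow (M : Model Ω n) (t : ℝ≥0) (ω : Ω) : ℝ :=
  ∫ s in Set.Ioc t (M.horizon ω), M.mvaRate s ω ∂lebesgue

/-- `β_s λ_s (X_s - Y_s)⁺`. -/
def fvaRate (M : Model Ω n) (X Y : ℝ≥0 → Ω → ℝ) (s : ℝ≥0) (ω : Ω) : ℝ :=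
  M.disc s ω * (M.lam s ω * max (X s ω - Y s ω) 0)

/-- `∫_t^b β_s λ_s (X_s - Y_s)⁺ ds`. -/
def fvaFlow (M : Model Ω n) (X Y : ℝ≥0 → Ω → ℝ) (t : ℝ≥0) (ω : Ω) : ℝ :=
  ∫ s in Set.Ioc t (M.horizon ω), M.fvaRate X Y s ω ∂lebesgue

end Model

variable {m : MeasurableSpace Ω}

/-- The usual conditions: the filtration is right-continuous and contains all null sets. -/
structure UsualConditions (𝓖 : Filtration ℝ≥0 m) (P : Measure Ω) : Prop where
  rightContinuous : 𝓖.IsRightContinuous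
  complete : ∀ s : Set Ω, P s = 0 → MeasurableSet[𝓖 0] s

/-- `E ∫_0^b |Z_s| ds < ∞`. -/
def FiniteL1 (P : Measure Ω) (b : Ω → ℝ≥0) (Z : ℝ≥0 → Ω → ℝ) : Prop :=
  ∫⁻ ω, ∫⁻ s in Set.Iic (b ω), ‖Z s ω‖ₑ ∂lebesgue ∂P < ⊤

/-- Membership in `H²`: progressive processes with `E ∫_0^b Z_s² ds < ∞`. -/
structure MemH2 (𝓖 : Filtration ℝ≥0 m) (P : Measure Ω) (b : Ω → ℝ≥0) (Z : ℝ≥0 → Ω → ℝ) :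
    Prop where
  progressive : IsStronglyProgressive 𝓖 Z
  finite : ∫⁻ ω, ∫⁻ s in Set.Iic (b ω), ‖Z s ω‖ₑ ^ 2 ∂lebesgue ∂P < ⊤

/-- The standing assumptions: random times are stopping times, processes are progressive, and the
discount factor and the conditional expectations defining `UCVA` and `MVA` make sense. -/
structure Model.Standing (M : Model Ω n) (𝓖 : Filtration ℝ≥0 m) (P : Measure Ω) : Prop where
  bankDefault : IsStoppingTime 𝓖 M.bankDefault
  default : ∀ i, IsStoppingTime 𝓖 (M.default i)
  recovery : ∀ i, Measurable (M.recovery i)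
  Q : ∀ i, IsStronglyProgressive 𝓖 (M.Q i)
  imReceived : ∀ i, IsStronglyProgressive 𝓖 (M.imReceived i)
  imPosted : ∀ i, IsStronglyProgressive 𝓖 (M.imPosted i)
  spotExposure : ∀ i, IsStronglyProgressive 𝓖 (M.spotExposure i)
  r : IsStronglyProgressive 𝓖 M.r
  lam : IsStronglyProgressive 𝓖 M.lam
  lamBar : IsStronglyProgressive 𝓖 M.lamBar
  r_integrable : ∀ᵐ ω ∂P, ∀ t : ℝ≥0, IntegrableOn (fun s => M.r s ω) (Set.Iic t) lebesgue
  discLoss_integrable : ∀ i, Integrable (M.discLoss i) P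
  mva_integrable : FiniteL1 P M.horizon M.mvaRate

/-- `V` is the process `V_t = E_t [β_t⁻¹ F_t]`, `0 ≤ t ≤ b`, in a progressive version. As `β_t` is
positive and `𝓖_t`-measurable, it is moved to the left-hand side. -/
structure Model.IsValueOf (M : Model Ω n) (𝓖 : Filtration ℝ≥0 m) (P : Measure Ω)
    (F V : ℝ≥0 → Ω → ℝ) : Prop where
  progressive : IsStronglyProgressive 𝓖 V
  eq : ∀ t : ℝ≥0, ∀ᵐ ω ∂P, t ≤ M.horizon ω → M.disc t ω * V t ω = condExp (𝓖 t) P (F t) ω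

/-- `Y = FVA⋆` solves
`β_t Y_t = E_t ∫_t^b β_s λ_s (∑ i, J^i_s P^i_s - UCVA_s - MVA_s - Y_s)⁺ ds`, `0 ≤ t ≤ b`. -/
structure Model.SolvesFVA (M : Model Ω n) (𝓖 : Filtration ℝ≥0 m) (P : Measure Ω)
    (UCVA MVA Y : ℝ≥0 → Ω → ℝ) : Prop where
  progressive : IsStronglyProgressive 𝓖 Y
  integrable : FiniteL1 P M.horizon
    (M.fvaRate (fun s ω => M.exposure s ω - UCVA s ω - MVA s ω) Y)
  eq : ∀ t : ℝ≥0, ∀ᵐ ω ∂P, t ≤ M.horizon ω →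
    M.disc t ω * Y t ω =
      condExp (𝓖 t) P (M.fvaFlow (fun s ω => M.exposure s ω - UCVA s ω - MVA s ω) Y t) ω

/-- `Y = TRC⋆` solves the counterparty risk replication BSDE on `0 ≤ t ≤ b`, written with
`β_t` on the left-hand side. The three terms on the right-hand side are `β_t UCVA_t`, `β_t MVA_t`
and `β_t FVA⋆_t`. -/
structure Model.SolvesTRC (M : Model Ω n) (𝓖 : Filtration ℝ≥0 m) (P : Measure Ω)
    (Y : ℝ≥0 → Ω → ℝ) : Prop where
  progressive : IsStronglyProgressive 𝓖 Y
  integrable : FiniteL1 P M.horizon (M.fvaRate M.exposure Y)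
  eq : ∀ t : ℝ≥0, ∀ᵐ ω ∂P, t ≤ M.horizon ω →
    M.disc t ω * Y t ω =
      condExp (𝓖 t) P (M.ucvaFlow t) ω + condExp (𝓖 t) P (M.mvaFlow t) ω
        + condExp (𝓖 t) P (M.fvaFlow M.exposure Y t) ω

/-- The equation `Eqn` has a solution in `H²`, unique up to modification on `[0, b]`. -/
def HasUniqueH2Solution (𝓖 : Filtration ℝ≥0 m) (P : Measure Ω) (b : Ω → ℝ≥0)
    (Eqn : (ℝ≥0 → Ω → ℝ) → Prop) : Prop :=
  ∃ Y, MemH2 𝓖 P b Y ∧ Eqn Y ∧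
    ∀ Y', MemH2 𝓖 P b Y' → Eqn Y' → ∀ t : ℝ≥0, ∀ᵐ ω ∂P, t ≤ b ω → Y' t ω = Y t ω

end XVA

end

noncomputable section

/-! ### Lebesgue measure on the half-line and the discount factor of a single path. -/

namespace XVA

open Filter Set
open scoped Topology

/-! Multiplying by `β` removes the interest rate from (2). With `y = 1_{[0,b]} β FVA⋆`, the equation
becomes `y_t = E_t ∫_t^∞ l_s (x_s - y_s)⁺ ds` (`SolvesReduced`), where `l` is `λ` cut off at the
horizon and `x` is the discounted `∑ J^i P^i - UCVA - MVA`. The rate `l` may change sign and has no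
upper bound, so a Lipschitz contraction is not at hand; what is at hand is the one-sided bound `l ≥
-κ` with `κ` deterministic and integrable in time.

The tool is the linear equation. If `D` is the discount factor of a rate `k ≥ -κ`, then `Y` is the
value of a cash flow `h` exactly when `D Y` is the value of `D (h + k Y)`, under suitable
integrability: `IsRate.discounted_of_value` and `IsRate.value_of_discounted`. On each path this is
Fubini on a triangle plus `∫_t^u k D = D_t - D_u`; `condExp_tail_mul` then replaces the future cash
flow by its conditional expectation. Integrability rests on `|k| ≤ k + 2κ`, which bounds `∫ |k| D`
by a constant depending on `κ` alone. Positivity of `D` gives the comparison principle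
`IsRate.value_nonneg`. Solutions are built from progressive versions of martingales
(`exists_progressive_condExp`).

Uniqueness: the difference of two solutions of the reduced equation solves a homogeneous linear
equation with rate `l θ`, where `θ ∈ [0,1]` is a difference quotient of the positive part;
comparison makes it zero (`SolvesReduced.le`).

Existence is a monotone iteration. Starting from a subsolution (`IsRate.exists_subsolution`), the
part with `l⁺`, convex in `y`, is replaced by its tangent at the current iterate, as in Newton's
method, and the part with `l⁻` is evaluated at the current iterate. Each step is a linear equation,
and comparison shows that the new iterate is larger and again a subsolution
(`IsSubsolution.exists_step`). All iterates are dominated by a multiple of `E_t ∫_t^∞ |l x| ds`, so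
the discounted linear equations pass to the limit (`IsRate.exists_solvesReduced`). The same bound,
Cauchy-Schwarz in time and the `L²` contraction of conditional expectation put the solution in `H²`
(`Model.IsReduction.memH2_div`).

Equations (1) and (2) differ by the translation by `UCVA + MVA` (`Model.solvesTRC_iff`). -/

lemma measurableEmbedding_coe : MeasurableEmbedding (fun t : ℝ≥0 => (t : ℝ)) :=
  MeasurableEmbedding.subtype_coe measurableSet_Ici

lemma lebesgue_apply (s : Set ℝ≥0) : lebesgue s = volume ((fun t : ℝ≥0 => (t : ℝ)) '' s) :=
  measurableEmbedding_coe.comap_apply _ _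

instance : NullSingletonClass lebesgue := ⟨fun t => by simp [lebesgue_apply]⟩

lemma lebesgue_Iic_lt_top (t : ℝ≥0) : lebesgue (Iic t) < ⊤ := by
  rw [lebesgue_apply]
  refine (measure_mono (t := Icc (0 : ℝ) t) ?_).trans_lt measure_Icc_lt_top
  rintro _ ⟨s, hs, rfl⟩
  exact ⟨s.2, hs⟩

instance : SigmaFinite lebesgue := by
  refine ⟨⟨⟨fun n => Iic (n : ℝ≥0), fun _ => trivial, fun n => lebesgue_Iic_lt_top _, ?_⟩⟩⟩
  ext t
  simp only [mem_iUnion, mem_Iic, mem_univ, iff_true]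
  exact exists_nat_ge t

lemma coe_preimage_Ioc (t u : ℝ≥0) : (fun x : ℝ≥0 => (x : ℝ)) ⁻¹' Ioc (t : ℝ) u = Ioc t u := by
  ext x; simp

lemma map_restrict_lebesgue_Ioc (t u : ℝ≥0) :
    (lebesgue.restrict (Ioc t u)).map (fun x : ℝ≥0 => (x : ℝ)) =
      volume.restrict (Ioc (t : ℝ) u) := by
  rw [← coe_preimage_Ioc, ← measurableEmbedding_coe.restrict_map, lebesgue,
    measurableEmbedding_coe.map_comap, Measure.restrict_restrict measurableSet_Ioc]
  congr 1
  refine inter_eq_left.2 fun x hx => ⟨⟨x, t.2.trans hx.1.le⟩, rfl⟩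

lemma setIntegral_lebesgue_Ioc (f : ℝ≥0 → ℝ) (t u : ℝ≥0) :
    ∫ s in Ioc t u, f s ∂lebesgue = ∫ x in Ioc (t : ℝ) u, f x.toNNReal := by
  rw [← map_restrict_lebesgue_Ioc, measurableEmbedding_coe.integral_map]
  simp

lemma integrableOn_toNNReal_iff {f : ℝ≥0 → ℝ} {t u : ℝ≥0} :
    IntegrableOn (fun x : ℝ => f x.toNNReal) (Ioc t u) volume ↔
      IntegrableOn f (Ioc t u) lebesgue := by
  rw [IntegrableOn, ← map_restrict_lebesgue_Ioc, measurableEmbedding_coe.integrable_map_iff]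
  simp [Function.comp_def, IntegrableOn]

/-- The exponential of an absolutely continuous function is absolutely continuous. -/
lemma _root_.AbsolutelyContinuousOnInterval.real_exp {f : ℝ → ℝ} {a b : ℝ}
    (hf : AbsolutelyContinuousOnInterval f a b) :
    AbsolutelyContinuousOnInterval (fun x => Real.exp (f x)) a b := by
  obtain ⟨C, hC⟩ := hf.exists_bound
  have hlip : ∀ x ∈ uIcc a b, ∀ y ∈ uIcc a b,
      dist (Real.exp (f x)) (Real.exp (f y)) ≤ Real.exp C * dist (f x) (f y) := by
    intro x hx y hy
    -- On `(-∞, C]` the exponential is Lipschitz with constant `exp C`, and `C` bounds `f` on the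
    -- interval.
    have key : ∀ u v : ℝ, u ≤ C → v ≤ u →
        |Real.exp u - Real.exp v| ≤ Real.exp C * |u - v| := by
      intro u v hu hvu
      rw [abs_of_nonneg (by linarith [Real.exp_le_exp.2 hvu]), abs_of_nonneg (by linarith)]
      have h1 : Real.exp v = Real.exp u * Real.exp (v - u) := by
        rw [← Real.exp_add]; congr 1; ring
      have h2 := Real.add_one_le_exp (v - u)
      have h3 := Real.exp_le_exp.2 hu
      have h4 := Real.exp_pos u
      calc Real.exp u - Real.exp v = Real.exp u * (1 - Real.exp (v - u)) := by rw [h1]; ring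
        _ ≤ Real.exp u * (u - v) := mul_le_mul_of_nonneg_left (by linarith) h4.le
        _ ≤ Real.exp C * (u - v) := mul_le_mul_of_nonneg_right h3 (by linarith)
    have hx' := (abs_le.1 (hC x hx)).2
    have hy' := (abs_le.1 (hC y hy)).2
    rw [Real.dist_eq, Real.dist_eq]
    rcases le_total (f x) (f y) with h | h
    · rw [abs_sub_comm, abs_sub_comm (f x)]; exact key _ _ hy' h
    · exact key _ _ hx' h
  rw [absolutelyContinuousOnInterval_iff] at hf ⊢
  intro ε hε
  obtain ⟨δ, hδ, h⟩ := hf (ε / Real.exp C) (by positivity)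
  refine ⟨δ, hδ, fun E hE hEδ => ?_⟩
  calc ∑ i ∈ Finset.range E.1, dist (Real.exp (f (E.2 i).1)) (Real.exp (f (E.2 i).2))
      ≤ ∑ i ∈ Finset.range E.1, Real.exp C * dist (f (E.2 i).1) (f (E.2 i).2) :=
        Finset.sum_le_sum fun i hi => hlip _ (hE.1 i hi).1 _ (hE.1 i hi).2
    _ = Real.exp C * ∑ i ∈ Finset.range E.1, dist (f (E.2 i).1) (f (E.2 i).2) :=
        (Finset.mul_sum _ _ _).symm
    _ < Real.exp C * (ε / Real.exp C) := by gcongr; exact h E hE hEδ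
    _ = ε := by field_simp

/-- The rate is only integrable, so its primitive is differentiable only almost everywhere. Absolute
continuity of the exponential of the primitive is what still permits the fundamental theorem of
calculus. -/
lemma intervalIntegral_mul_exp_neg {k : ℝ → ℝ} {a b : ℝ} (hk : IntervalIntegrable k volume a b) :
    ∫ x in a..b, k x * Real.exp (-∫ s in a..x, k s) = 1 - Real.exp (-∫ s in a..b, k s) := by
  have hac := (hk.absolutelyContinuousOnInterval_intervalIntegral (c := a) (by simp)).neg.real_exp
  have h := hac.integral_deriv_eq_sub
  have h2 : ∫ x in a..b, deriv (fun x => Real.exp ((-fun x => ∫ s in a..x, k s) x)) x =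
      ∫ x in a..b, -(k x * Real.exp (-∫ s in a..x, k s)) := by
    apply intervalIntegral.integral_congr_ae
    filter_upwards [hk.ae_hasDerivAt_integral] with x hx hxab
    have h3 := ((hx (uIoc_subset_uIcc hxab) a (by simp)).neg.exp).deriv
    rw [mul_comm] at h3
    simpa [mul_comm] using h3
  rw [h2, intervalIntegral.integral_neg] at h
  simp at h
  linarith

/-- The discount factor `exp (-∫₀ᵗ k_s ds)` of a single path `k`. -/
def pathDisc (k : ℝ≥0 → ℝ) (t : ℝ≥0) : ℝ := Real.exp (-∫ s in Iic t, k s ∂lebesgue)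

lemma pathDisc_pos (k : ℝ≥0 → ℝ) (t : ℝ≥0) : 0 < pathDisc k t := Real.exp_pos _

lemma setIntegral_Iic_add_Ioc {k : ℝ≥0 → ℝ} {t u : ℝ≥0} (htu : t ≤ u)
    (hk : IntegrableOn k (Iic u) lebesgue) :
    ∫ s in Iic u, k s ∂lebesgue =
      ∫ s in Iic t, k s ∂lebesgue + ∫ s in Ioc t u, k s ∂lebesgue := by
  rw [← Iic_union_Ioc_eq_Iic htu, setIntegral_union (by
    rw [Set.disjoint_left]; intro x hx hx'; exact absurd hx'.1 (not_lt.2 hx)) measurableSet_Ioc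
    (hk.mono_set (Iic_subset_Iic.2 htu)) (hk.mono_set Ioc_subset_Iic_self)]

lemma pathDisc_eq_mul {k : ℝ≥0 → ℝ} {t u : ℝ≥0} (htu : t ≤ u)
    (hk : IntegrableOn k (Iic u) lebesgue) :
    pathDisc k u = pathDisc k t * Real.exp (-∫ s in Ioc t u, k s ∂lebesgue) := by
  rw [pathDisc, pathDisc, ← Real.exp_add, setIntegral_Iic_add_Ioc htu hk]
  congr 1; ring

/-- The fundamental theorem of calculus for the discount factor of an integrable rate. -/
lemma setIntegral_mul_pathDisc {k : ℝ≥0 → ℝ} {t u : ℝ≥0} (htu : t ≤ u)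
    (hk : IntegrableOn k (Iic u) lebesgue) :
    ∫ s in Ioc t u, k s * pathDisc k s ∂lebesgue = pathDisc k t - pathDisc k u := by
  have h1 : ∫ s in Ioc t u, k s * pathDisc k s ∂lebesgue = ∫ s in Ioc t u,
      pathDisc k t * (k s * Real.exp (-∫ s in Ioc t s, k s ∂lebesgue)) ∂lebesgue := by
    refine setIntegral_congr_fun measurableSet_Ioc fun s hs => ?_
    simp only [pathDisc_eq_mul hs.1.le (hk.mono_set (Iic_subset_Iic.2 hs.2))]
    ring
  have htu' : (t : ℝ) ≤ u := htu
  have h2 : ∫ x in Ioc (t : ℝ) u, k x.toNNReal *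
      Real.exp (-∫ s in Ioc t x.toNNReal, k s ∂lebesgue) =
      1 - Real.exp (-∫ s in Ioc t u, k s ∂lebesgue) := by
    rw [setIntegral_lebesgue_Ioc, ← intervalIntegral.integral_of_le htu',
      ← intervalIntegral.integral_of_le htu', ← intervalIntegral_mul_exp_neg]
    · refine intervalIntegral.integral_congr fun x hx => ?_
      rw [uIcc_of_le htu'] at hx
      rw [setIntegral_lebesgue_Ioc, intervalIntegral.integral_of_le hx.1,
        Real.coe_toNNReal _ (t.2.trans hx.1)]
    · rw [intervalIntegrable_iff_integrableOn_Ioc_of_le htu', integrableOn_toNNReal_iff]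
      exact hk.mono_set Ioc_subset_Iic_self
  rw [h1, integral_const_mul, setIntegral_lebesgue_Ioc, h2, pathDisc_eq_mul htu hk]
  ring

/-! ### Fubini on the triangle `s < u`. -/

section Swap

lemma integral_triangle_snd (c h : ℝ≥0 → ℝ) (s : ℝ≥0) :
    ∫ u, {p : ℝ≥0 × ℝ≥0 | p.1 < p.2}.indicator (fun p => c p.1 * h p.2) (s, u) ∂lebesgue =
      c s * ∫ u in Ioi s, h u ∂lebesgue := by
  have : (fun u => {p : ℝ≥0 × ℝ≥0 | p.1 < p.2}.indicator (fun p => c p.1 * h p.2) (s, u)) =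
      (Ioi s).indicator fun u => c s * h u := by
    ext u; simp [indicator]
  rw [this, integral_indicator measurableSet_Ioi, integral_const_mul]

variable {c h : ℝ≥0 → ℝ} (hc : Measurable c) (hh : Measurable h)
  (hci : ∀ u, IntegrableOn c (Iic u) lebesgue)
  (hS : Integrable (fun u => |h u| * ∫ s in Iic u, |c s| ∂lebesgue) lebesgue)

include hc hh hci hS

/-- By Tonelli it suffices to integrate the absolute value in `s` first, which produces exactly the
function assumed integrable in `hS`. -/
lemma integrable_triangle :
    Integrable ({p : ℝ≥0 × ℝ≥0 | p.1 < p.2}.indicator fun p => c p.1 * h p.2)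
      (lebesgue.prod lebesgue) := by
  have hm : MeasurableSet {p : ℝ≥0 × ℝ≥0 | p.1 < p.2} :=
    measurableSet_lt measurable_fst measurable_snd
  rw [integrable_prod_iff' (by
    exact (((hc.comp measurable_fst).mul (hh.comp measurable_snd)).indicator
      hm).aestronglyMeasurable)]
  constructor
  · refine ae_of_all _ fun u => ?_
    have : (fun s => {p : ℝ≥0 × ℝ≥0 | p.1 < p.2}.indicator (fun p => c p.1 * h p.2) (s, u)) =
        (Iio u).indicator fun s => c s * h u := by
      ext s; simp [indicator]
    rw [this, integrable_indicator_iff measurableSet_Iio]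
    exact ((hci u).mono_set Iio_subset_Iic_self).mul_const _
  · refine hS.congr (ae_of_all _ fun u => ?_)
    have : (fun s => ‖{p : ℝ≥0 × ℝ≥0 | p.1 < p.2}.indicator (fun p => c p.1 * h p.2) (s, u)‖) =
        (Iio u).indicator fun s => |h u| * |c s| := by
      ext s
      by_cases hs : s < u <;> simp [indicator, hs, mul_comm]
    simp only [this]
    rw [integral_indicator measurableSet_Iio, integral_const_mul, integral_Iic_eq_integral_Iio]

lemma integrable_mul_tail :
    Integrable (fun s => c s * ∫ u in Ioi s, h u ∂lebesgue) lebesgue := by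
  refine (integrable_triangle hc hh hci hS).integral_prod_left.congr (ae_of_all _ fun s => ?_)
  exact integral_triangle_snd c h s

lemma integral_abs_mul_tail_le :
    ∫ s, |c s * ∫ u in Ioi s, h u ∂lebesgue| ∂lebesgue ≤
      ∫ u, |h u| * ∫ s in Iic u, |c s| ∂lebesgue ∂lebesgue := by
  have hF := integrable_triangle hc hh hci hS
  have hFn := hF.norm
  calc ∫ s, |c s * ∫ u in Ioi s, h u ∂lebesgue| ∂lebesgue
      ≤ ∫ s, ∫ u, ‖({p : ℝ≥0 × ℝ≥0 | p.1 < p.2}.indicator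
          (fun p => c p.1 * h p.2) (s, u) : ℝ)‖
          ∂lebesgue ∂lebesgue := by
        refine integral_mono (integrable_mul_tail hc hh hci hS).abs hFn.integral_prod_left
         
          fun s => ?_
        have h1 := integral_triangle_snd c h s
        refine (congrArg abs h1).symm.le.trans ?_
        exact norm_integral_le_integral_norm (μ := lebesgue) (G := ℝ) _
    _ = ∫ u, ∫ s, ‖{p : ℝ≥0 × ℝ≥0 | p.1 < p.2}.indicator (fun p => c p.1 * h p.2) (s, u)‖
          ∂lebesgue ∂lebesgue := integral_integral_swap hFn
    _ = _ := by
        refine integral_congr_ae (ae_of_all _ fun u => ?_)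
        have : (fun s => ‖{p : ℝ≥0 × ℝ≥0 | p.1 < p.2}.indicator
            (fun p => c p.1 * h p.2) (s, u)‖) = (Iio u).indicator fun s => |h u| * |c s| := by
          ext s
          by_cases hs : s < u <;> simp [indicator, hs, mul_comm]
        simp only [this]
        rw [integral_indicator measurableSet_Iio, integral_const_mul,
          integral_Iic_eq_integral_Iio]

lemma setIntegral_mul_tail (t : ℝ≥0) :
    ∫ s in Ioi t, c s * (∫ u in Ioi s, h u ∂lebesgue) ∂lebesgue =
      ∫ u in Ioi t, h u * (∫ s in Ioc t u, c s ∂lebesgue) ∂lebesgue := by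
  have hF : Integrable ({p : ℝ≥0 × ℝ≥0 | p.1 < p.2}.indicator fun p => c p.1 * h p.2)
      ((lebesgue.restrict (Ioi t)).prod lebesgue) := by
    refine (integrable_triangle hc hh hci hS).mono_measure ?_
    exact Measure.prod_mono Measure.restrict_le_self le_rfl
  calc ∫ s in Ioi t, c s * (∫ u in Ioi s, h u ∂lebesgue) ∂lebesgue
      = ∫ s in Ioi t, ∫ u, {p : ℝ≥0 × ℝ≥0 | p.1 < p.2}.indicator
          (fun p => c p.1 * h p.2) (s, u) ∂lebesgue ∂lebesgue := by
        refine integral_congr_ae (ae_of_all _ fun s => ?_)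
        exact (integral_triangle_snd c h s).symm
    _ = ∫ u, ∫ s in Ioi t, {p : ℝ≥0 × ℝ≥0 | p.1 < p.2}.indicator
          (fun p => c p.1 * h p.2) (s, u) ∂lebesgue ∂lebesgue := integral_integral_swap hF
    _ = ∫ u, (Ioi t).indicator (fun u => h u * ∫ s in Ioc t u, c s ∂lebesgue) u ∂lebesgue := by
        refine integral_congr_ae (ae_of_all _ fun u => ?_)
        have : (fun s => {p : ℝ≥0 × ℝ≥0 | p.1 < p.2}.indicator
            (fun p => c p.1 * h p.2) (s, u)) = (Iio u).indicator fun s => h u * c s := by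
          ext s
          by_cases hs : s < u <;> simp [indicator, hs, mul_comm]
        simp only [this]
        rw [setIntegral_indicator measurableSet_Iio, integral_const_mul, Ioi_inter_Iio,
          ← integral_Ioc_eq_integral_Ioo]
        by_cases hu : t < u
        · simp [indicator, hu]
        · simp [indicator, hu]
    _ = _ := integral_indicator measurableSet_Ioi

end Swap

/-! ### Measurability of integrals in their endpoint and parameter. -/

lemma measurable_integral_Iic {α : Type*} [MeasurableSpace α] {f : ℝ≥0 → α → ℝ}
    (hf : Measurable (Function.uncurry f)) :
    Measurable fun p : ℝ≥0 × α => ∫ s in Iic p.1, f s p.2 ∂lebesgue := by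
  have hm : MeasurableSet {q : (ℝ≥0 × α) × ℝ≥0 | q.2 ≤ q.1.1} :=
    measurableSet_le measurable_snd (measurable_fst.comp measurable_fst)
  have h1 : StronglyMeasurable fun q : (ℝ≥0 × α) × ℝ≥0 =>
      {q : (ℝ≥0 × α) × ℝ≥0 | q.2 ≤ q.1.1}.indicator (fun q => f q.2 q.1.2) q :=
    ((hf.comp (measurable_snd.prodMk (measurable_snd.comp measurable_fst))).indicator
      hm).stronglyMeasurable
  convert (h1.integral_prod_right' (ν := lebesgue)).measurable using 2 with p
  rw [← integral_indicator measurableSet_Iic]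
  rfl

lemma measurable_integral_Ioi {α : Type*} [MeasurableSpace α] {f : ℝ≥0 → α → ℝ}
    (hf : Measurable (Function.uncurry f)) :
    Measurable fun p : ℝ≥0 × α => ∫ s in Ioi p.1, f s p.2 ∂lebesgue := by
  have hm : MeasurableSet {q : (ℝ≥0 × α) × ℝ≥0 | q.1.1 < q.2} :=
    measurableSet_lt (measurable_fst.comp measurable_fst) measurable_snd
  have h1 : StronglyMeasurable fun q : (ℝ≥0 × α) × ℝ≥0 =>
      {q : (ℝ≥0 × α) × ℝ≥0 | q.1.1 < q.2}.indicator (fun q => f q.2 q.1.2) q :=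
    ((hf.comp (measurable_snd.prodMk (measurable_snd.comp measurable_fst))).indicator
      hm).stronglyMeasurable
  convert (h1.integral_prod_right' (ν := lebesgue)).measurable using 2 with p
  rw [← integral_indicator measurableSet_Ioi]
  rfl

lemma measurable_setIntegral_Iic {k : ℝ≥0 → ℝ} (hk : Measurable k) :
    Measurable fun t : ℝ≥0 => ∫ s in Iic t, k s ∂lebesgue :=
  (measurable_integral_Iic (α := Unit) (f := fun s _ => k s) (hk.comp measurable_fst)).comp
    (measurable_id.prodMk (measurable_const (a := ())))

lemma measurable_pathDisc {k : ℝ≥0 → ℝ} (hk : Measurable k) : Measurable (pathDisc k) :=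
  (measurable_setIntegral_Iic hk).neg.exp

lemma pathDisc_neg (k : ℝ≥0 → ℝ) (t : ℝ≥0) : pathDisc (fun s => -k s) t = (pathDisc k t)⁻¹ := by
  rw [pathDisc, pathDisc, integral_neg, ← Real.exp_neg, neg_neg]

/-- The inverse of a discount factor is the discount factor of the opposite rate. -/
lemma setIntegral_div_pathDisc {k : ℝ≥0 → ℝ} {t u : ℝ≥0} (htu : t ≤ u)
    (hk : IntegrableOn k (Iic u) lebesgue) :
    ∫ s in Ioc t u, k s * (pathDisc k s)⁻¹ ∂lebesgue = (pathDisc k u)⁻¹ - (pathDisc k t)⁻¹ := by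
  have h := setIntegral_mul_pathDisc htu (k := fun s => -k s) hk.neg
  simp only [pathDisc_neg, neg_mul] at h
  rw [integral_neg] at h
  linarith

/-! ### Path estimates for a rate with an integrable lower bound. -/

section Rate

variable {κ k h : ℝ≥0 → ℝ} (hκ0 : ∀ s, 0 ≤ κ s) (hκ : Integrable κ lebesgue)
  (hkκ : ∀ s, -κ s ≤ k s)

include hκ0 hκ hkκ

lemma neg_setIntegral_le (S : Set ℝ≥0) : -∫ s in S, k s ∂lebesgue ≤ ∫ s, κ s ∂lebesgue := by
  have h0 : 0 ≤ ∫ s, κ s ∂lebesgue := integral_nonneg hκ0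
  by_cases hk : IntegrableOn k S lebesgue
  · rw [← integral_neg]
    calc ∫ s in S, -k s ∂lebesgue ≤ ∫ s in S, κ s ∂lebesgue :=
          integral_mono hk.neg hκ.integrableOn fun s => by have := hkκ s; simp; linarith
      _ ≤ _ := setIntegral_le_integral hκ (ae_of_all _ hκ0)
  · rw [integral_undef hk]; simpa using h0

lemma pathDisc_le (t : ℝ≥0) : pathDisc k t ≤ Real.exp (∫ s, κ s ∂lebesgue) :=
  Real.exp_le_exp.2 (neg_setIntegral_le hκ0 hκ hkκ _)

lemma pathDisc_le_mul {t u : ℝ≥0} (htu : t ≤ u) (hk : IntegrableOn k (Iic u) lebesgue) :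
    pathDisc k u ≤ Real.exp (∫ s, κ s ∂lebesgue) * pathDisc k t := by
  rw [pathDisc_eq_mul htu hk, mul_comm]
  exact mul_le_mul_of_nonneg_right (Real.exp_le_exp.2 (neg_setIntegral_le hκ0 hκ hkκ _))
    (pathDisc_pos _ _).le

omit hκ0 hκ hkκ in
lemma integrableOn_mul_pathDisc (hkm : Measurable k) (hk : Integrable k lebesgue) (u : ℝ≥0) :
    IntegrableOn (fun s => k s * pathDisc k s) (Iic u) lebesgue := by
  refine Integrable.mul_bdd (c := Real.exp (∫ s, |k s| ∂lebesgue)) hk.integrableOn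
    (measurable_pathDisc hkm).aestronglyMeasurable (ae_of_all _ fun s => ?_)
  rw [Real.norm_of_nonneg (pathDisc_pos _ _).le]
  exact pathDisc_le (κ := fun s => |k s|) (fun s => abs_nonneg _) hk.abs
    (fun s => neg_abs_le _) s

/-- Since `|k| ≤ k + 2κ`, only the signed integral `∫ k D = 1 - D_u ≤ 1` and the bounded term `2 ∫ κ
D` remain. The bound does not depend on the size of `k`; this is essential because the rates are
integrable only path by path, with no moments. -/
lemma setIntegral_abs_mul_pathDisc_le (hkm : Measurable k) (hk : Integrable k lebesgue)
    (u : ℝ≥0) :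
    ∫ s in Iic u, |k s * pathDisc k s| ∂lebesgue ≤
      1 + 2 * (∫ s, κ s ∂lebesgue) * Real.exp (∫ s, κ s ∂lebesgue) := by
  have hi := integrableOn_mul_pathDisc hkm hk u
  have h1 : ∫ s in Iic u, k s * pathDisc k s ∂lebesgue ≤ 1 := by
    rw [← Icc_bot, integral_Icc_eq_integral_Ioc,
      setIntegral_mul_pathDisc bot_le hk.integrableOn]
    have h2 : pathDisc k ⊥ = 1 := by
      rw [pathDisc, Iic_bot]; simp
    linarith [pathDisc_pos k u]
  have h3 : ∫ s in Iic u, κ s ∂lebesgue ≤ ∫ s, κ s ∂lebesgue :=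
    setIntegral_le_integral hκ (ae_of_all _ hκ0)
  set E := Real.exp (∫ s, κ s ∂lebesgue) with hE
  have hE0 : 0 < E := Real.exp_pos _
  calc ∫ s in Iic u, |k s * pathDisc k s| ∂lebesgue
      ≤ ∫ s in Iic u, (k s * pathDisc k s + 2 * E * κ s) ∂lebesgue := by
        refine integral_mono hi.abs (hi.add (hκ.integrableOn.const_mul _)) fun s => ?_
        have h4 := pathDisc_le hκ0 hκ hkκ s
        have h5 := pathDisc_pos k s
        have h6 : |k s| ≤ k s + 2 * κ s := abs_le.2 ⟨by linarith [hkκ s], by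
          linarith [hκ0 s]⟩
        rw [abs_mul, abs_of_pos h5]
        calc |k s| * pathDisc k s ≤ (k s + 2 * κ s) * pathDisc k s :=
              mul_le_mul_of_nonneg_right h6 h5.le
          _ = k s * pathDisc k s + 2 * κ s * pathDisc k s := by ring
          _ ≤ k s * pathDisc k s + 2 * κ s * E := by
              have := mul_le_mul_of_nonneg_left h4 (hκ0 s); linarith
          _ = _ := by ring
    _ = (∫ s in Iic u, k s * pathDisc k s ∂lebesgue) + 2 * E * ∫ s in Iic u, κ s ∂lebesgue := by
        rw [integral_add hi (hκ.integrableOn.const_mul _), integral_const_mul]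
    _ ≤ 1 + 2 * E * ∫ s, κ s ∂lebesgue := by gcongr
    _ = _ := by ring

/-- Again `|k| ≤ k + 2κ`. The signed part is `D_u ∫ k / D = 1 - D_u / D_0 ≤ 1`, and in the remainder
`D_u / D_s` is at most `exp ∫ κ` for `s ≤ u`. -/
lemma setIntegral_abs_div_pathDisc_le (hkm : Measurable k) (hk : Integrable k lebesgue)
    (u : ℝ≥0) :
    pathDisc k u * ∫ s in Iic u, |k s * (pathDisc k s)⁻¹| ∂lebesgue ≤
      1 + 2 * (∫ s, κ s ∂lebesgue) * Real.exp (∫ s, κ s ∂lebesgue) := by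
  have hi : IntegrableOn (fun s => k s * (pathDisc k s)⁻¹) (Iic u) lebesgue := by
    have := (integrableOn_mul_pathDisc hkm.neg hk.neg u).neg
    refine this.congr (ae_of_all _ fun s => ?_)
    have h := pathDisc_neg k s
    simp only [Pi.neg_apply, neg_mul, neg_neg]
    rw [← h]; rfl
  have h1 : pathDisc k u * ∫ s in Iic u, k s * (pathDisc k s)⁻¹ ∂lebesgue ≤ 1 := by
    rw [← Icc_bot, integral_Icc_eq_integral_Ioc,
      setIntegral_div_pathDisc bot_le hk.integrableOn, mul_sub,
      mul_inv_cancel₀ (pathDisc_pos k u).ne']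
    have := mul_pos (pathDisc_pos k u) (inv_pos.2 (pathDisc_pos k ⊥))
    linarith
  have h3 : ∫ s in Iic u, κ s ∂lebesgue ≤ ∫ s, κ s ∂lebesgue :=
    setIntegral_le_integral hκ (ae_of_all _ hκ0)
  set E := Real.exp (∫ s, κ s ∂lebesgue) with hE
  have hE0 : 0 < E := Real.exp_pos _
  rw [← integral_const_mul] at h1 ⊢
  calc ∫ s in Iic u, pathDisc k u * |k s * (pathDisc k s)⁻¹| ∂lebesgue
      ≤ ∫ s in Iic u, (pathDisc k u * (k s * (pathDisc k s)⁻¹) + 2 * E * κ s) ∂lebesgue := by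
        refine setIntegral_mono_on (hi.abs.const_mul _)
          ((hi.const_mul _).add (hκ.integrableOn.const_mul _)) measurableSet_Iic fun s hs => ?_
        have h4 := pathDisc_le_mul hκ0 hκ hkκ hs hk.integrableOn
        have h5 := pathDisc_pos k s
        have h6 : |k s| ≤ k s + 2 * κ s := abs_le.2 ⟨by linarith [hkκ s], by
          linarith [hκ0 s]⟩
        have h7 : pathDisc k u * (pathDisc k s)⁻¹ ≤ E := by
          rw [← div_eq_mul_inv, div_le_iff₀ h5]; exact h4
        have h8 : 0 ≤ pathDisc k u * (pathDisc k s)⁻¹ :=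
          mul_nonneg (pathDisc_pos k u).le (inv_pos.2 h5).le
        rw [abs_mul, abs_of_pos (inv_pos.2 h5)]
        calc pathDisc k u * (|k s| * (pathDisc k s)⁻¹)
            = |k s| * (pathDisc k u * (pathDisc k s)⁻¹) := by ring
          _ ≤ (k s + 2 * κ s) * (pathDisc k u * (pathDisc k s)⁻¹) :=
              mul_le_mul_of_nonneg_right h6 h8
          _ = pathDisc k u * (k s * (pathDisc k s)⁻¹) +
              2 * κ s * (pathDisc k u * (pathDisc k s)⁻¹) := by ring
          _ ≤ pathDisc k u * (k s * (pathDisc k s)⁻¹) + 2 * κ s * E := by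
              have := mul_le_mul_of_nonneg_left h7 (hκ0 s); linarith
          _ = _ := by ring
    _ = (∫ s in Iic u, pathDisc k u * (k s * (pathDisc k s)⁻¹) ∂lebesgue) +
          2 * E * ∫ s in Iic u, κ s ∂lebesgue := by
        rw [integral_add (hi.const_mul _) (hκ.integrableOn.const_mul _), integral_const_mul (2 * E)]
    _ ≤ 1 + 2 * E * ∫ s, κ s ∂lebesgue := by gcongr
    _ = _ := by ring

/-- Exchanging the integrals leaves `h_u ∫_t^u k D = h_u (D_t - D_u)` under the outer one. The bound
by `∫ |h|` with a deterministic factor is what later survives taking expectations. -/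
lemma mul_pathDisc_mul_tail (hkm : Measurable k) (hk : Integrable k lebesgue)
    (hhm : Measurable h) (hh : Integrable h lebesgue) :
    Integrable (fun s => k s * pathDisc k s * ∫ u in Ioi s, h u ∂lebesgue) lebesgue ∧
    ∫ s, |k s * pathDisc k s * ∫ u in Ioi s, h u ∂lebesgue| ∂lebesgue ≤
      (1 + 2 * (∫ s, κ s ∂lebesgue) * Real.exp (∫ s, κ s ∂lebesgue)) * ∫ u, |h u| ∂lebesgue ∧
    ∀ t, ∫ s in Ioi t, k s * pathDisc k s * (∫ u in Ioi s, h u ∂lebesgue) ∂lebesgue =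
      pathDisc k t * (∫ u in Ioi t, h u ∂lebesgue) -
        ∫ u in Ioi t, pathDisc k u * h u ∂lebesgue := by
  have hcm : Measurable fun s => k s * pathDisc k s := hkm.mul (measurable_pathDisc hkm)
  have hci := integrableOn_mul_pathDisc hkm hk
  have hb := setIntegral_abs_mul_pathDisc_le hκ0 hκ hkκ hkm hk
  have hS : Integrable
      (fun u => |h u| * ∫ s in Iic u, |k s * pathDisc k s| ∂lebesgue) lebesgue := by
    refine hh.abs.mul_bdd (c := 1 + 2 * (∫ s, κ s ∂lebesgue) * Real.exp (∫ s, κ s ∂lebesgue))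
      (measurable_setIntegral_Iic hcm.abs).aestronglyMeasurable (ae_of_all _ fun u => ?_)
    rw [Real.norm_of_nonneg (integral_nonneg fun s => abs_nonneg _)]
    exact hb u
  refine ⟨integrable_mul_tail hcm hhm hci hS,
    (integral_abs_mul_tail_le hcm hhm hci hS).trans ?_, fun t => ?_⟩
  · rw [← integral_const_mul]
    refine integral_mono hS (hh.abs.const_mul _) fun u => ?_
    simp only
    rw [mul_comm]
    exact mul_le_mul_of_nonneg_right (hb u) (abs_nonneg _)
  · rw [setIntegral_mul_tail hcm hhm hci hS t, ← integral_const_mul, ← integral_sub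
      (hh.integrableOn.const_mul _)]
    · refine setIntegral_congr_fun measurableSet_Ioi fun u hu => ?_
      rw [setIntegral_mul_pathDisc (le_of_lt hu) hk.integrableOn]
      ring
    · refine Integrable.bdd_mul (c := Real.exp (∫ s, κ s ∂lebesgue)) hh.integrableOn
        (measurable_pathDisc hkm).aestronglyMeasurable (ae_of_all _ fun s => ?_)
      rw [Real.norm_of_nonneg (pathDisc_pos _ _).le]
      exact pathDisc_le hκ0 hκ hkκ s

/-- The inverse of the previous transformation: the weight is `k / D`, the cash flow is `D h`, and
`∫_t^u k / D = 1 / D_u - 1 / D_t`. -/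
lemma mul_inv_pathDisc_mul_tail (hkm : Measurable k) (hk : Integrable k lebesgue)
    (hhm : Measurable h) (hh : Integrable h lebesgue) :
    Integrable (fun s => k s * ((pathDisc k s)⁻¹ *
      ∫ u in Ioi s, pathDisc k u * h u ∂lebesgue)) lebesgue ∧
    ∫ s, |k s * ((pathDisc k s)⁻¹ * ∫ u in Ioi s, pathDisc k u * h u ∂lebesgue)| ∂lebesgue ≤
      (1 + 2 * (∫ s, κ s ∂lebesgue) * Real.exp (∫ s, κ s ∂lebesgue)) * ∫ u, |h u| ∂lebesgue ∧
    ∀ t, ∫ s in Ioi t, k s * ((pathDisc k s)⁻¹ *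
        ∫ u in Ioi s, pathDisc k u * h u ∂lebesgue) ∂lebesgue =
      (∫ u in Ioi t, h u ∂lebesgue) -
        (pathDisc k t)⁻¹ * ∫ u in Ioi t, pathDisc k u * h u ∂lebesgue := by
  have hDm := measurable_pathDisc hkm
  have hcm : Measurable fun s => k s * (pathDisc k s)⁻¹ := hkm.mul hDm.inv
  have hdm : Measurable fun s => pathDisc k s * h s := hDm.mul hhm
  have hci : ∀ u, IntegrableOn (fun s => k s * (pathDisc k s)⁻¹) (Iic u) lebesgue := by
    intro u
    have := (integrableOn_mul_pathDisc hkm.neg hk.neg u).neg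
    refine this.congr (ae_of_all _ fun s => ?_)
    have h := pathDisc_neg k s
    simp only [Pi.neg_apply, neg_mul, neg_neg]
    rw [← h]; rfl
  have hb := setIntegral_abs_div_pathDisc_le hκ0 hκ hkκ hkm hk
  have hS' : ∀ u, |pathDisc k u * h u| * ∫ s in Iic u, |k s * (pathDisc k s)⁻¹| ∂lebesgue =
      |h u| * (pathDisc k u * ∫ s in Iic u, |k s * (pathDisc k s)⁻¹| ∂lebesgue) := by
    intro u
    rw [abs_mul, abs_of_pos (pathDisc_pos k u)]; ring
  have hS : Integrable (fun u => |pathDisc k u * h u| *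
      ∫ s in Iic u, |k s * (pathDisc k s)⁻¹| ∂lebesgue) lebesgue := by
    simp only [hS']
    refine hh.abs.mul_bdd (c := 1 + 2 * (∫ s, κ s ∂lebesgue) * Real.exp (∫ s, κ s ∂lebesgue))
      (hDm.mul (measurable_setIntegral_Iic hcm.abs)).aestronglyMeasurable
      (ae_of_all _ fun u => ?_)
    rw [Real.norm_of_nonneg (mul_nonneg (pathDisc_pos k u).le
      (integral_nonneg fun s => abs_nonneg _))]
    exact hb u
  have hDh : Integrable (fun u => pathDisc k u * h u) lebesgue := by
    refine Integrable.bdd_mul (c := Real.exp (∫ s, κ s ∂lebesgue)) hh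
      hDm.aestronglyMeasurable (ae_of_all _ fun s => ?_)
    rw [Real.norm_of_nonneg (pathDisc_pos _ _).le]
    exact pathDisc_le hκ0 hκ hkκ s
  simp only [← mul_assoc]
  refine ⟨integrable_mul_tail hcm hdm hci hS,
    (integral_abs_mul_tail_le hcm hdm hci hS).trans ?_, fun t => ?_⟩
  · rw [← integral_const_mul]
    refine integral_mono hS (hh.abs.const_mul _) fun u => ?_
    simp only
    rw [hS' u, mul_comm]
    exact mul_le_mul_of_nonneg_right (hb u) (abs_nonneg _)
  · rw [setIntegral_mul_tail hcm hdm hci hS t, ← integral_const_mul, ← integral_sub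
      hh.integrableOn (hDh.integrableOn.const_mul _)]
    refine setIntegral_congr_fun measurableSet_Ioi fun u hu => ?_
    rw [setIntegral_div_pathDisc (le_of_lt hu) hk.integrableOn]
    have := (pathDisc_pos k u).ne'
    field_simp

end Rate

end XVA

/-! ### Progressive processes and their stability properties. -/

namespace XVA

open Filter Set
open scoped Topology

variable {Ω : Type*} {m : MeasurableSpace Ω} {𝓖 : Filtration ℝ≥0 m} {P : Measure Ω}

lemma measurable_of_forall_eq {α β : Type*} {_ : MeasurableSpace α} {_ : MeasurableSpace β}
    {f g : α → β} (hg : Measurable g) (h : ∀ x, f x = g x) : Measurable f :=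
  (funext h) ▸ hg

/-- The progressive process `u` stopped at `t` is jointly measurable with respect to `𝓖 t`. -/
lemma measurable_uncurry_min {u : ℝ≥0 → Ω → ℝ} (hu : IsStronglyProgressive 𝓖 u) (t : ℝ≥0) :
    Measurable[MeasurableSpace.prod inferInstance (𝓖 t)]
      (Function.uncurry fun s ω => u (min s t) ω) := by
  let _mt : MeasurableSpace Ω := 𝓖 t
  have h1 : Measurable fun p : ℝ≥0 × Ω => ((⟨min p.1 t, mem_Iic.2 (min_le_right _ _)⟩ : Iic t), p.2) :=
    ((measurable_fst.min measurable_const).subtype_mk).prodMk measurable_snd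
  exact (hu t).measurable.comp h1

/-- The processes stopped at integer times are jointly measurable and, at each point, eventually
equal to `u`. -/
lemma measurable_uncurry {u : ℝ≥0 → Ω → ℝ} (hu : IsStronglyProgressive 𝓖 u) :
    Measurable (Function.uncurry u) := by
  have h1 : ∀ n : ℕ, Measurable (Function.uncurry fun s ω => u (min s (n : ℝ≥0)) ω) := fun n =>
    (measurable_uncurry_min hu n).mono
      (sup_le_sup le_rfl (MeasurableSpace.comap_mono (𝓖.le _))) le_rfl
  refine measurable_of_tendsto_metrizable h1 (tendsto_pi_nhds.2 fun p => ?_)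
  obtain ⟨N, hN⟩ := exists_nat_ge p.1
  refine tendsto_const_nhds.congr' ?_
  filter_upwards [eventually_ge_atTop N] with n hn
  have : p.1 ≤ (n : ℝ≥0) := hN.trans (by exact_mod_cast hn)
  simp [Function.uncurry, min_eq_left this]

lemma _root_.MeasureTheory.IsStronglyProgressive.map₂ {u v : ℝ≥0 → Ω → ℝ} {g : ℝ → ℝ → ℝ}
    (hg : Measurable (Function.uncurry g)) (hu : IsStronglyProgressive 𝓖 u)
    (hv : IsStronglyProgressive 𝓖 v) :
    IsStronglyProgressive 𝓖 fun t ω => g (u t ω) (v t ω) := fun t => by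
  let _mt : MeasurableSpace Ω := 𝓖 t
  exact (hg.comp ((hu t).measurable.prodMk (hv t).measurable)).stronglyMeasurable

lemma _root_.MeasureTheory.IsStronglyProgressive.map {u : ℝ≥0 → Ω → ℝ} {g : ℝ → ℝ}
    (hg : Measurable g) (hu : IsStronglyProgressive 𝓖 u) :
    IsStronglyProgressive 𝓖 fun t ω => g (u t ω) := fun t => by
  let _mt : MeasurableSpace Ω := 𝓖 t
  exact (hg.comp (hu t).measurable).stronglyMeasurable

lemma isStronglyProgressive_time {f : ℝ≥0 → ℝ} (hf : Measurable f) :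
    IsStronglyProgressive 𝓖 fun t _ => f t := fun t => by
  let _mt : MeasurableSpace Ω := 𝓖 t
  exact (hf.comp (measurable_subtype_coe.comp measurable_fst)).stronglyMeasurable

lemma isStronglyProgressive_iSup {u : ℕ → ℝ≥0 → Ω → ℝ}
    (hu : ∀ j, IsStronglyProgressive 𝓖 (u j)) :
    IsStronglyProgressive 𝓖 fun t ω => ⨆ j, u j t ω := fun t => by
  let _mt : MeasurableSpace Ω := 𝓖 t
  exact (Measurable.iSup fun j => (hu j t).measurable).stronglyMeasurable

lemma isStronglyProgressive_iInf {u : ℕ → ℝ≥0 → Ω → ℝ}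
    (hu : ∀ j, IsStronglyProgressive 𝓖 (u j)) :
    IsStronglyProgressive 𝓖 fun t ω => ⨅ j, u j t ω := fun t => by
  let _mt : MeasurableSpace Ω := 𝓖 t
  exact (Measurable.iInf fun j => (hu j t).measurable).stronglyMeasurable

lemma isStronglyProgressive_limsup {u : ℕ → ℝ≥0 → Ω → ℝ}
    (hu : ∀ j, IsStronglyProgressive 𝓖 (u j)) :
    IsStronglyProgressive 𝓖 fun t ω => limsup (fun j => u j t ω) atTop := fun t => by
  let _mt : MeasurableSpace Ω := 𝓖 t
  exact (Measurable.limsup fun j => (hu j t).measurable).stronglyMeasurable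

lemma isStronglyProgressive_integral {u : ℝ≥0 → Ω → ℝ} (hu : IsStronglyProgressive 𝓖 u) :
    IsStronglyProgressive 𝓖 fun t ω => ∫ s in Iic t, u s ω ∂lebesgue := fun t => by
  have h1 := measurable_uncurry_min hu t
  let _mt : MeasurableSpace Ω := 𝓖 t
  have h2 := (measurable_integral_Iic h1).comp
    ((measurable_subtype_coe (p := (· ∈ Iic t))).prodMap (measurable_id (α := Ω)))
  refine Measurable.stronglyMeasurable ?_
  refine measurable_of_forall_eq h2 fun p => ?_
  refine setIntegral_congr_fun measurableSet_Iic fun s hs => ?_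
  have : s ≤ t := le_trans (mem_Iic.1 hs) p.1.2
  simp [min_eq_left this]

/-! ### Progressive versions of closed martingales. -/

section MartingaleVersion

variable [IsProbabilityMeasure P]

/-- Orthogonality of martingale increments. It makes the second moment nondecreasing in time and
lets it control the increments. -/
lemma integral_sq_condExp_sub {ξ : Ω → ℝ} {C : ℝ} (hC : ∀ ω, |ξ ω| ≤ C)
    {q t : ℝ≥0} (hqt : q ≤ t) :
    ∫ ω, ((P[ξ | 𝓖 t]) ω - (P[ξ | 𝓖 q]) ω) ^ 2 ∂P =
      ∫ ω, (P[ξ | 𝓖 t]) ω ^ 2 ∂P - ∫ ω, (P[ξ | 𝓖 q]) ω ^ 2 ∂P := by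
  have hb : ∀ s, ∀ᵐ ω ∂P, ‖(P[ξ | 𝓖 s]) ω‖ ≤ C := fun s => by
    exact ae_bdd_abs_condExp_of_ae_bdd_abs (ae_of_all _ hC)
  have hm : ∀ s, AEStronglyMeasurable (P[ξ | 𝓖 s]) P := fun s => integrable_condExp.1
  have hi : ∀ s s', Integrable (fun ω => (P[ξ | 𝓖 s]) ω * (P[ξ | 𝓖 s']) ω) P := fun s s' =>
    Integrable.bdd_mul integrable_condExp (hm s) (hb s)
  have key : ∫ ω, (P[ξ | 𝓖 q]) ω * (P[ξ | 𝓖 t]) ω ∂P = ∫ ω, (P[ξ | 𝓖 q]) ω ^ 2 ∂P := by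
    have h1 : P[fun ω => (P[ξ | 𝓖 q]) ω * (P[ξ | 𝓖 t]) ω | 𝓖 q] =ᵐ[P]
        fun ω => (P[ξ | 𝓖 q]) ω * (P[P[ξ | 𝓖 t] | 𝓖 q]) ω :=
      condExp_mul_of_stronglyMeasurable_left stronglyMeasurable_condExp (hi q t)
        integrable_condExp
    rw [← integral_condExp (𝓖.le q), integral_congr_ae h1]
    refine integral_congr_ae ?_
    filter_upwards [condExp_condExp_of_le (μ := P) (f := ξ) (𝓖.mono hqt) (𝓖.le t)] with ω hω
    rw [hω, sq]
  have hsq : ∀ s, Integrable (fun ω => (P[ξ | 𝓖 s]) ω ^ 2) P := fun s => by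
    simpa only [sq] using hi s s
  have : ∀ ω, ((P[ξ | 𝓖 t]) ω - (P[ξ | 𝓖 q]) ω) ^ 2 = (P[ξ | 𝓖 t]) ω ^ 2 +
      (P[ξ | 𝓖 q]) ω ^ 2 - 2 * ((P[ξ | 𝓖 q]) ω * (P[ξ | 𝓖 t]) ω) := fun ω => by ring
  simp only [this]
  rw [integral_sub (by exact (hsq t).add (hsq q)) ((hi q t).const_mul 2),
    integral_add (hsq t) (hsq q), integral_const_mul, key]
  ring

/-- A monotone real function on `[0, ∞)` is approximated from the left along a countable set. -/
lemma exists_seq_le_sub_le {v : ℝ≥0 → ℝ} (hv : Monotone v) :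
    ∃ q : ℕ → ℝ≥0, ∀ t, ∀ ε > 0, ∃ i, q i ≤ t ∧ v t - v (q i) ≤ ε := by
  -- The countable set consists of the jump times of `v`, which serve as their own approximation,
  -- and of the nonnegative rationals, which approximate continuity points from the left.
  have hc : ({t | ¬ContinuousAt v t} ∪ range fun n : ℕ × ℕ => (n.1 : ℝ≥0) / n.2).Countable :=
    hv.countable_not_continuousAt.union (countable_range _)
  obtain ⟨q, hq⟩ := hc.exists_eq_range ⟨0, Or.inr ⟨(0, 0), by simp⟩⟩
  refine ⟨q, fun t ε hε => ?_⟩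
  suffices h : ∃ s ∈ range q, s ≤ t ∧ v t - v s ≤ ε by
    obtain ⟨_, ⟨i, rfl⟩, hi⟩ := h
    exact ⟨i, hi⟩
  rw [← hq]
  by_cases ht : ContinuousAt v t
  · rcases eq_or_ne t 0 with rfl | ht0
    · exact ⟨0, Or.inr ⟨(0, 0), by simp⟩, le_rfl, by simpa using hε.le⟩
    · have h1 : ∀ᶠ s in 𝓝 t, v t - ε < v s := ht.eventually (lt_mem_nhds (by linarith))
      obtain ⟨l, hl, hl'⟩ := exists_Ioc_subset_of_mem_nhds h1 ⟨0, pos_iff_ne_zero.2 ht0⟩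
      obtain ⟨r, hr1, hr2⟩ := exists_rat_btwn (show (l : ℝ) < t from hl)
      have hr0 : (0 : ℝ) ≤ r := l.2.trans hr1.le
      refine ⟨(r : ℝ).toNNReal, Or.inr ⟨(r.num.natAbs, r.den), ?_⟩, ?_, ?_⟩
      · apply NNReal.coe_injective
        have h0 : 0 ≤ r := by exact_mod_cast hr0
        rw [Real.coe_toNNReal _ hr0]
        push_cast
        rw [Nat.cast_natAbs, abs_of_nonneg (Rat.num_nonneg.2 h0)]
        exact (Rat.cast_def r).symm
      · exact Real.toNNReal_le_iff_le_coe.2 hr2.le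
      · have h2 : (r : ℝ).toNNReal ∈ Ioc l t :=
          ⟨Real.lt_toNNReal_iff_coe_lt.2 hr1, Real.toNNReal_le_iff_le_coe.2 hr2.le⟩
        have h3 : v t - ε < v (r : ℝ).toNNReal := hl' h2
        linarith
  · exact ⟨t, Or.inl ht, le_rfl, by simpa using hε.le⟩

/-- The value at `t` is the martingale at an earlier time `q`, taken from a fixed countable set, at
which the second moment is within `ε` of its value at `t`. Only countably many conditional
expectations occur, so joint measurability is immediate, and `q ≤ t` keeps the process progressive.
-/
lemma exists_progressive_approx {ξ : Ω → ℝ} {C : ℝ}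
    (hC : ∀ ω, |ξ ω| ≤ C) {ε : ℝ} (hε : 0 < ε) :
    ∃ N : ℝ≥0 → Ω → ℝ, IsStronglyProgressive 𝓖 N ∧
      ∀ t, ∃ q ≤ t, N t = P[ξ | 𝓖 q] ∧
        ∫ ω, ((P[ξ | 𝓖 t]) ω - (P[ξ | 𝓖 q]) ω) ^ 2 ∂P ≤ ε := by
  classical
  set v : ℝ≥0 → ℝ := fun t => ∫ ω, (P[ξ | 𝓖 t]) ω ^ 2 ∂P with hv
  have hmono : Monotone v := fun q t hqt => by
    have h1 := integral_sq_condExp_sub (P := P) (𝓖 := 𝓖) hC hqt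
    have h2 : 0 ≤ ∫ ω, ((P[ξ | 𝓖 t]) ω - (P[ξ | 𝓖 q]) ω) ^ 2 ∂P :=
      integral_nonneg fun ω => sq_nonneg _
    simp only [hv]; linarith
  obtain ⟨q, hq⟩ := exists_seq_le_sub_le hmono
  have hq' := fun t => hq t ε hε
  let i : ℝ≥0 → ℕ := fun t => Nat.find (hq' t)
  have hi : ∀ t, q (i t) ≤ t ∧ v t - v (q (i t)) ≤ ε := fun t => Nat.find_spec (hq' t)
  -- The selected index depends measurably on time because the monotone function `v` is Borel.
  have him : Measurable i := by
    refine measurable_find hq' fun j => ?_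
    exact (measurableSet_le measurable_const measurable_id).inter
      (measurableSet_le (hmono.measurable.sub measurable_const) measurable_const)
  refine ⟨fun t => P[ξ | 𝓖 (q (i t))], fun t => ?_, fun t => ⟨q (i t), (hi t).1, rfl, ?_⟩⟩
  -- Setting the entries with `q j > t` to zero makes the whole family `𝓖 t`-measurable; they are
  -- never selected at times up to `t`.
  · let M : ℕ → Ω → ℝ := fun j => if q j ≤ t then P[ξ | 𝓖 (q j)] else 0
    let _mt : MeasurableSpace Ω := 𝓖 t
    have hM : Measurable (fun p : ℕ × Ω => M p.1 p.2) := by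
      refine measurable_from_prod_countable_right fun j => ?_
      by_cases hj : q j ≤ t
      · simp only [M, hj, if_true]
        exact (stronglyMeasurable_condExp.mono (𝓖.mono hj)).measurable
      · simp only [M, hj, if_false]
        exact measurable_const
    have h1 := hM.comp ((him.comp (measurable_subtype_coe (p := (· ∈ Iic t)))).prodMap
      (measurable_id (α := Ω)))
    refine Measurable.stronglyMeasurable ?_
    refine measurable_of_forall_eq h1 fun p => ?_
    have : q (i p.1) ≤ t := (hi p.1).1.trans p.1.2
    simp [M, this]
  · rw [integral_sq_condExp_sub hC (hi t).1]
    exact (hi t).2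

/-- Integrate `|X| ≤ δ/2 + X²/(2δ)`. -/
lemma lintegral_enorm_le_of_integral_sq_le {X : Ω → ℝ} (hi : Integrable X P)
    (hi2 : Integrable (fun ω => X ω ^ 2) P) {δ : ℝ} (hδ : 0 < δ)
    (h : ∫ ω, X ω ^ 2 ∂P ≤ δ ^ 2) : ∫⁻ ω, ‖X ω‖ₑ ∂P ≤ ENNReal.ofReal δ := by
  rw [← ofReal_integral_norm_eq_lintegral_enorm hi]
  refine ENNReal.ofReal_le_ofReal ?_
  calc ∫ ω, ‖X ω‖ ∂P ≤ ∫ ω, (δ / 2 + (2 * δ)⁻¹ * X ω ^ 2) ∂P := by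
        refine integral_mono hi.norm ((integrable_const _).add (hi2.const_mul _)) fun ω => ?_
        simp only [Real.norm_eq_abs]
        have h2 : δ / 2 + (2 * δ)⁻¹ * X ω ^ 2 - |X ω| = (2 * δ)⁻¹ * (δ - |X ω|) ^ 2 := by
          rw [← sq_abs (X ω)]; field_simp; ring
        have h3 : 0 ≤ (2 * δ)⁻¹ * (δ - |X ω|) ^ 2 := by positivity
        linarith
    _ = δ / 2 + (2 * δ)⁻¹ * ∫ ω, X ω ^ 2 ∂P := by
        rw [integral_add (integrable_const _) (hi2.const_mul _), integral_const_mul]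
        simp
    _ ≤ δ / 2 + (2 * δ)⁻¹ * δ ^ 2 := by gcongr
    _ = δ := by field_simp; ring

/-- One `δ` pays for replacing `ξ` by a bounded simple function, since conditional expectation
contracts `L¹`; the other pays for the time approximation of the bounded martingale. -/
lemma exists_progressive_lintegral_sub_le {ξ : Ω → ℝ} (hξ : Integrable ξ P) {δ : ℝ}
    (hδ : 0 < δ) :
    ∃ N : ℝ≥0 → Ω → ℝ, IsStronglyProgressive 𝓖 N ∧
      ∀ t, ∫⁻ ω, ‖N t ω - (P[ξ | 𝓖 t]) ω‖ₑ ∂P ≤ ENNReal.ofReal δ + ENNReal.ofReal δ := by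
  obtain ⟨g₀, hg, hg'⟩ := (memLp_one_iff_integrable.2 hξ).exists_simpleFunc_eLpNorm_sub_lt
    (by simp) (ε := ENNReal.ofReal δ) (by simpa using hδ)
  obtain ⟨C, hC⟩ := g₀.exists_forall_norm_le
  generalize (g₀ : Ω → ℝ) = g at hg hg' hC
  have hgi : Integrable g P := memLp_one_iff_integrable.1 hg'
  obtain ⟨N, hN, hN'⟩ := exists_progressive_approx (P := P) (𝓖 := 𝓖) hC (pow_pos hδ 2)
  refine ⟨N, hN, fun t => ?_⟩
  obtain ⟨q, hqt, hNq, hq⟩ := hN' t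
  have hi : Integrable (fun ω => (P[g | 𝓖 t]) ω - (P[g | 𝓖 q]) ω) P :=
    integrable_condExp.sub integrable_condExp
  have h1 : ∫⁻ ω, ‖(P[g | 𝓖 t]) ω - (P[g | 𝓖 q]) ω‖ₑ ∂P ≤ ENNReal.ofReal δ := by
    have hb : ∀ s, ∀ᵐ ω ∂P, ‖(P[g | 𝓖 s]) ω‖ ≤ C := fun s =>
      ae_bdd_abs_condExp_of_ae_bdd_abs (ae_of_all _ hC)
    refine lintegral_enorm_le_of_integral_sq_le hi ?_ hδ hq
    simp only [sq]
    refine Integrable.bdd_mul (c := C + C) hi hi.1 ?_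
    filter_upwards [hb t, hb q] with ω h h'
    exact (norm_sub_le _ _).trans (add_le_add h h')
  have h2 : ∫⁻ ω, ‖(P[ξ | 𝓖 t]) ω - (P[g | 𝓖 t]) ω‖ₑ ∂P ≤ ENNReal.ofReal δ := by
    have h3 := (eLpNorm_condExp_le_eLpNorm (m := 𝓖 t) (μ := P) (ξ - g) le_rfl).trans hg.le
    refine le_trans (le_of_eq ?_) h3
    rw [eLpNorm_one_eq_lintegral_enorm]
    refine lintegral_congr_ae ?_
    filter_upwards [condExp_sub hξ hgi (𝓖 t)] with ω hω
    rw [hω]; rfl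
  calc ∫⁻ ω, ‖N t ω - (P[ξ | 𝓖 t]) ω‖ₑ ∂P
      ≤ ∫⁻ ω, (‖(P[g | 𝓖 t]) ω - (P[g | 𝓖 q]) ω‖ₑ +
          ‖(P[ξ | 𝓖 t]) ω - (P[g | 𝓖 t]) ω‖ₑ) ∂P := by
        refine lintegral_mono fun ω => ?_
        rw [hNq, ← enorm_neg]
        refine le_trans (le_of_eq ?_) (enorm_add_le _ _)
        congr 1; ring
    _ = ∫⁻ ω, ‖(P[g | 𝓖 t]) ω - (P[g | 𝓖 q]) ω‖ₑ ∂P +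
          ∫⁻ ω, ‖(P[ξ | 𝓖 t]) ω - (P[g | 𝓖 t]) ω‖ₑ ∂P := lintegral_add_left' hi.1.enorm _
    _ ≤ _ := add_le_add h1 h2

/-- The martingale `t ↦ E[ξ | 𝓖 t]` has a progressive version. -/
theorem exists_progressive_condExp {ξ : Ω → ℝ} (hξ : Integrable ξ P) :
    ∃ N : ℝ≥0 → Ω → ℝ, IsStronglyProgressive 𝓖 N ∧ ∀ t, N t =ᵐ[P] P[ξ | 𝓖 t] := by
  have hstep := fun n : ℕ => exists_progressive_lintegral_sub_le (𝓖 := 𝓖) hξ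
    (δ := (1 / 2) ^ n) (by positivity)
  choose N hN hN' using hstep
  -- The `limsup` is progressive without any convergence. At each fixed `t` the `L¹` errors are
  -- summable, so the sequence converges almost surely and the `limsup` is the limit.
  refine ⟨_, isStronglyProgressive_limsup hN, fun t => ?_⟩
  have hfin : ∑' n, ∫⁻ ω, ‖N n t ω - (P[ξ | 𝓖 t]) ω‖ₑ ∂P ≠ ⊤ := by
    refine ne_top_of_le_ne_top ?_ (ENNReal.tsum_le_tsum fun n => hN' n t)
    rw [ENNReal.tsum_add, ← ENNReal.ofReal_tsum_of_nonneg (fun n => by positivity)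
      summable_geometric_two]
    exact ENNReal.add_ne_top.2 ⟨ENNReal.ofReal_ne_top, ENNReal.ofReal_ne_top⟩
  have hmeas : ∀ n, AEMeasurable (fun ω => ‖N n t ω - (P[ξ | 𝓖 t]) ω‖ₑ) P := fun n =>
    ((((hN n).stronglyAdapted t).mono (𝓖.le t)).aestronglyMeasurable.sub
      integrable_condExp.1).enorm
  rw [← lintegral_tsum hmeas] at hfin
  filter_upwards [ae_lt_top' (AEMeasurable.tsum hmeas) hfin] with ω hω
  refine Tendsto.limsup_eq ?_
  have h0 := ENNReal.tendsto_atTop_zero_of_tsum_ne_top hω.ne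
  rw [tendsto_iff_edist_tendsto_0]
  simpa only [edist_eq_enorm_sub] using h0

end MartingaleVersion

end XVA

/-! ### Value processes and linear equations. -/

namespace XVA

open Filter Set
open scoped Topology

variable {Ω : Type*} {m : MeasurableSpace Ω} {𝓖 : Filtration ℝ≥0 m} {P : Measure Ω}

/-- The remaining cash flow `∫_t^∞ h_s ds` of a process `h`. -/
def tail (h : ℝ≥0 → Ω → ℝ) (t : ℝ≥0) (ω : Ω) : ℝ := ∫ s in Ioi t, h s ω ∂lebesgue

/-- The discount factor `exp (-∫₀ᵗ k_s ds)` of a rate process `k`. -/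
def discount (k : ℝ≥0 → Ω → ℝ) (t : ℝ≥0) (ω : Ω) : ℝ := pathDisc (fun s => k s ω) t

/-- `k` is a progressive rate with integrable paths, bounded from below by the integrable
deterministic function `-κ`. -/
structure IsRate (𝓖 : Filtration ℝ≥0 m) (P : Measure Ω) (κ : ℝ≥0 → ℝ) (k : ℝ≥0 → Ω → ℝ) :
    Prop where
  progressive : IsStronglyProgressive 𝓖 k
  bound_nonneg : ∀ s, 0 ≤ κ s
  bound_integrable : Integrable κ lebesgue
  neg_bound_le : ∀ s ω, -κ s ≤ k s ω
  integrable : ∀ᵐ ω ∂P, Integrable (fun s => k s ω) lebesgue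

lemma discount_pos (k : ℝ≥0 → Ω → ℝ) (t : ℝ≥0) (ω : Ω) : 0 < discount k t ω := pathDisc_pos _ _

lemma isStronglyProgressive_discount {k : ℝ≥0 → Ω → ℝ} (hk : IsStronglyProgressive 𝓖 k) :
    IsStronglyProgressive 𝓖 (discount k) :=
  (isStronglyProgressive_integral hk).map (g := fun x => Real.exp (-x))
    (Real.measurable_exp.comp measurable_neg)

lemma measurable_apply {h : ℝ≥0 → Ω → ℝ} (hh : Measurable (Function.uncurry h)) (t : ℝ≥0) :
    Measurable (h t) := hh.comp measurable_prodMk_left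

lemma measurable_path {h : ℝ≥0 → Ω → ℝ} (hh : Measurable (Function.uncurry h)) (ω : Ω) :
    Measurable fun t => h t ω := hh.comp measurable_prodMk_right

lemma measurable_tail {h : ℝ≥0 → Ω → ℝ} (hh : Measurable (Function.uncurry h)) :
    Measurable (Function.uncurry (tail h)) := measurable_integral_Ioi hh

section RateBasic

variable {κ : ℝ≥0 → ℝ} {k : ℝ≥0 → Ω → ℝ}

lemma IsRate.discount_le (hk : IsRate 𝓖 P κ k) (t : ℝ≥0) (ω : Ω) :
    discount k t ω ≤ Real.exp (∫ s, κ s ∂lebesgue) :=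
  pathDisc_le hk.bound_nonneg hk.bound_integrable (fun s => hk.neg_bound_le s ω) t

lemma IsRate.discount_le_mul (hk : IsRate 𝓖 P κ k) {ω : Ω}
    (hω : Integrable (fun s => k s ω) lebesgue) {t u : ℝ≥0} (htu : t ≤ u) :
    discount k u ω ≤ Real.exp (∫ s, κ s ∂lebesgue) * discount k t ω :=
  pathDisc_le_mul hk.bound_nonneg hk.bound_integrable (fun s => hk.neg_bound_le s ω) htu
    hω.integrableOn

lemma IsRate.measurable_discount (hk : IsRate 𝓖 P κ k) :
    Measurable (Function.uncurry (discount k)) :=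
  measurable_uncurry (isStronglyProgressive_discount hk.progressive)

end RateBasic

variable [IsProbabilityMeasure P]

lemma integrable_path {h : ℝ≥0 → Ω → ℝ}
    (hi : Integrable (Function.uncurry h) (lebesgue.prod P)) :
    ∀ᵐ ω ∂P, Integrable (fun s => h s ω) lebesgue := hi.prod_left_ae

lemma integrable_integral_abs {h : ℝ≥0 → Ω → ℝ}
    (hi : Integrable (Function.uncurry h) (lebesgue.prod P)) :
    Integrable (fun ω => ∫ s, |h s ω| ∂lebesgue) P := hi.abs.integral_prod_right

lemma integrable_tail {h : ℝ≥0 → Ω → ℝ}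
    (hi : Integrable (Function.uncurry h) (lebesgue.prod P)) (t : ℝ≥0) :
    Integrable (tail h t) P :=
  (hi.mono_measure (Measure.prod_mono Measure.restrict_le_self le_rfl) :
    Integrable (Function.uncurry h) ((lebesgue.restrict (Ioi t)).prod P)).integral_prod_right

lemma abs_tail_le {h : ℝ≥0 → Ω → ℝ} {ω : Ω} (hi : Integrable (fun s => h s ω) lebesgue)
    (t : ℝ≥0) : |tail h t ω| ≤ ∫ s, |h s ω| ∂lebesgue :=
  (norm_integral_le_integral_norm (μ := lebesgue.restrict (Ioi t)) (fun s => h s ω)).trans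
    (setIntegral_le_integral hi.abs (ae_of_all _ fun _ => abs_nonneg _))

lemma integrable_prod_of_forall_le {h : ℝ≥0 → Ω → ℝ} (hh : Measurable (Function.uncurry h))
    {g : Ω → ℝ} (hg : Integrable g P) (hi : ∀ᵐ ω ∂P, Integrable (fun s => h s ω) lebesgue)
    (hle : ∀ᵐ ω ∂P, ∫ s, |h s ω| ∂lebesgue ≤ g ω) :
    Integrable (Function.uncurry h) (lebesgue.prod P) := by
  rw [integrable_prod_iff' hh.aestronglyMeasurable]
  refine ⟨hi, hg.mono' ?_ ?_⟩
  · exact (hh.norm.aestronglyMeasurable (μ := lebesgue.prod P)).prod_swap.integral_prod_right'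
  · filter_upwards [hle] with ω hω
    rw [Real.norm_of_nonneg (integral_nonneg fun s => norm_nonneg _)]
    exact hω

/-- Inside a conditional expectation of an integral, a process can be replaced by one of which it
is the optional projection. -/
lemma condExp_tail_mul {c A Y : ℝ≥0 → Ω → ℝ} (hc : IsStronglyProgressive 𝓖 c)
    (hY : Measurable (Function.uncurry Y)) (hAi : ∀ s, Integrable (A s) P)
    (hYA : ∀ s, Y s =ᵐ[P] P[A s | 𝓖 s])
    (hcA : Integrable (Function.uncurry fun s ω => c s ω * A s ω) (lebesgue.prod P)) :
    Integrable (Function.uncurry fun s ω => c s ω * Y s ω) (lebesgue.prod P) ∧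
    ∀ t, P[tail (fun s ω => c s ω * Y s ω) t | 𝓖 t] =ᵐ[P]
      P[tail (fun s ω => c s ω * A s ω) t | 𝓖 t] := by
  have hcm := measurable_uncurry hc
  have hs : ∀ᵐ s ∂lebesgue, Integrable (fun ω => c s ω * A s ω) P ∧
      (fun ω => c s ω * Y s ω) =ᵐ[P] P[fun ω => c s ω * A s ω | 𝓖 s] := by
    filter_upwards [hcA.prod_right_ae] with s hs
    have hs' : Integrable (fun ω => c s ω * A s ω) P := hs
    refine ⟨hs', ?_⟩
    have h1 : P[fun ω => c s ω * A s ω | 𝓖 s] =ᵐ[P] fun ω => c s ω * (P[A s | 𝓖 s]) ω :=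
      condExp_mul_of_stronglyMeasurable_left (hc.stronglyAdapted s) hs' (hAi s)
    filter_upwards [h1, hYA s] with ω h2 h3
    rw [h2, h3]
  have hcY : Integrable (Function.uncurry fun s ω => c s ω * Y s ω) (lebesgue.prod P) := by
    have hm : Measurable (Function.uncurry fun s ω => c s ω * Y s ω) := hcm.mul hY
    rw [integrable_prod_iff hm.aestronglyMeasurable]
    refine ⟨?_, hcA.norm.integral_prod_left.mono' ?_ ?_⟩
    · filter_upwards [hs] with s hs
      exact integrable_condExp.congr hs.2.symm
    · exact hm.norm.aestronglyMeasurable.integral_prod_right'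
    · filter_upwards [hs] with s hs
      rw [Real.norm_of_nonneg (integral_nonneg fun s => norm_nonneg _)]
      calc ∫ ω, ‖c s ω * Y s ω‖ ∂P = ∫ ω, |(P[fun ω => c s ω * A s ω | 𝓖 s]) ω| ∂P := by
            refine integral_congr_ae ?_
            filter_upwards [hs.2] with ω hω
            rw [hω, Real.norm_eq_abs]
        _ ≤ ∫ ω, |c s ω * A s ω| ∂P := integral_abs_condExp_le _
  refine ⟨hcY, fun t => ?_⟩
  have hres : ∀ {h : ℝ≥0 → Ω → ℝ}, Integrable (Function.uncurry h) (lebesgue.prod P) →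
      ∀ G : Set Ω, ∫ ω in G, tail h t ω ∂P = ∫ s in Ioi t, ∫ ω in G, h s ω ∂P ∂lebesgue := by
    intro h hi G
    refine integral_integral_swap (f := fun ω s => h s ω) (μ := P.restrict G)
      (ν := lebesgue.restrict (Ioi t)) ?_
    refine Integrable.swap (f := Function.uncurry h) ?_
    exact hi.mono_measure (Measure.prod_mono Measure.restrict_le_self Measure.restrict_le_self)
  -- Test on `G ∈ 𝓖 t` and exchange time with expectation: for `s > t` the set `G` lies in `𝓖 s`,
  -- where `c A` may be replaced by its conditional expectation `c Y`.
  refine ae_eq_condExp_of_forall_setIntegral_eq (𝓖.le t) (integrable_tail hcA t)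
    (fun G _ _ => integrable_condExp.integrableOn) (fun G hG _ => ?_)
    stronglyMeasurable_condExp.aestronglyMeasurable
  rw [setIntegral_condExp (𝓖.le t) (integrable_tail hcY t) hG, hres hcY, hres hcA]
  refine setIntegral_congr_ae measurableSet_Ioi ?_
  filter_upwards [hs] with s hs hst
  rw [← setIntegral_condExp (𝓖.le s) hs.1 (𝓖.mono (le_of_lt hst) G hG)]
  exact integral_congr_ae (ae_restrict_of_ae hs.2)

section Rate

variable {κ : ℝ≥0 → ℝ} {k : ℝ≥0 → Ω → ℝ}

omit [IsProbabilityMeasure P] in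
lemma IsRate.integrable_discount_mul (hk : IsRate 𝓖 P κ k) {f : ℝ≥0 → Ω → ℝ}
    (hf : Integrable (Function.uncurry f) (lebesgue.prod P)) :
    Integrable (Function.uncurry fun s ω => discount k s ω * f s ω) (lebesgue.prod P) := by
  refine Integrable.bdd_mul (c := Real.exp (∫ s, κ s ∂lebesgue)) hf
    hk.measurable_discount.aestronglyMeasurable (ae_of_all _ fun p => ?_)
  rw [Real.norm_of_nonneg (discount_pos _ _ _).le]
  exact hk.discount_le _ _

lemma tail_add {f g : ℝ≥0 → Ω → ℝ} {ω : Ω} (hf : Integrable (fun s => f s ω) lebesgue)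
    (hg : Integrable (fun s => g s ω) lebesgue) (t : ℝ≥0) :
    tail (fun s ω => f s ω + g s ω) t ω = tail f t ω + tail g t ω :=
  integral_add hf.integrableOn hg.integrableOn

lemma tail_sub {f g : ℝ≥0 → Ω → ℝ} {ω : Ω} (hf : Integrable (fun s => f s ω) lebesgue)
    (hg : Integrable (fun s => g s ω) lebesgue) (t : ℝ≥0) :
    tail (fun s ω => f s ω - g s ω) t ω = tail f t ω - tail g t ω :=
  integral_sub hf.integrableOn hg.integrableOn

/-- Discounting a value process at the rate `k` adds `k Y` to its cash flow. -/
theorem IsRate.discounted_of_value (hk : IsRate 𝓖 P κ k) {h Y : ℝ≥0 → Ω → ℝ}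
    (hh : Measurable (Function.uncurry h)) (hY : Measurable (Function.uncurry Y))
    (hhi : Integrable (Function.uncurry h) (lebesgue.prod P))
    (hYh : ∀ t, Y t =ᵐ[P] P[tail h t | 𝓖 t]) (t : ℝ≥0) :
    (fun ω => discount k t ω * Y t ω) =ᵐ[P]
      P[tail (fun s ω => discount k s ω * (h s ω + k s ω * Y s ω)) t | 𝓖 t] := by
  have hD := isStronglyProgressive_discount hk.progressive
  have hkm := measurable_uncurry hk.progressive
  have hcA : Integrable (Function.uncurry fun s ω => k s ω * discount k s ω * tail h s ω)
      (lebesgue.prod P) := by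
    refine integrable_prod_of_forall_le ((hkm.mul hk.measurable_discount).mul
      (measurable_tail hh)) ((integrable_integral_abs hhi).const_mul
      (1 + 2 * (∫ s, κ s ∂lebesgue) * Real.exp (∫ s, κ s ∂lebesgue))) ?_ ?_
    all_goals
      filter_upwards [hk.integrable, integrable_path hhi] with ω h1 h2
      have h3 := mul_pathDisc_mul_tail hk.bound_nonneg hk.bound_integrable
        (fun s => hk.neg_bound_le s ω) (measurable_path hkm ω) h1 (measurable_path hh ω) h2
    · exact h3.1
    · exact h3.2.1
  -- Here `Y` replaces the random future cash flow `tail h` inside the term that Fubini produces.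
  obtain ⟨hcY, hE⟩ := condExp_tail_mul (hk.progressive.mul hD) hY (integrable_tail hhi) hYh hcA
  have hDh := hk.integrable_discount_mul hhi
  have e1 : tail (fun s ω => k s ω * discount k s ω * tail h s ω) t =ᵐ[P]
      (fun ω => discount k t ω * tail h t ω) - tail (fun s ω => discount k s ω * h s ω) t := by
    filter_upwards [hk.integrable, integrable_path hhi] with ω h1 h2
    exact (mul_pathDisc_mul_tail hk.bound_nonneg hk.bound_integrable
        (fun s => hk.neg_bound_le s ω) (measurable_path hkm ω) h1 (measurable_path hh ω) h2).2.2 t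
  have e2 : tail (fun s ω => discount k s ω * (h s ω + k s ω * Y s ω)) t =ᵐ[P]
      tail (fun s ω => discount k s ω * h s ω) t +
        tail (fun s ω => k s ω * discount k s ω * Y s ω) t := by
    filter_upwards [integrable_path hDh, integrable_path hcY] with ω h1 h2
    rw [Pi.add_apply, ← tail_add h1 h2]
    refine integral_congr_ae (ae_of_all _ fun s => ?_)
    simp only; ring
  have hDt : Integrable (fun ω => discount k t ω * tail h t ω) P := by
    refine Integrable.bdd_mul (c := Real.exp (∫ s, κ s ∂lebesgue)) (integrable_tail hhi t)
      (measurable_apply hk.measurable_discount t).aestronglyMeasurable (ae_of_all _ fun ω => ?_)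
    rw [Real.norm_of_nonneg (discount_pos _ _ _).le]
    exact hk.discount_le _ _
  have e3 : P[fun ω => discount k t ω * tail h t ω | 𝓖 t] =ᵐ[P]
      fun ω => discount k t ω * (P[tail h t | 𝓖 t]) ω :=
    condExp_mul_of_stronglyMeasurable_left (hD.stronglyAdapted t) hDt (integrable_tail hhi t)
  filter_upwards [hE t, condExp_congr_ae (m := 𝓖 t) e1, condExp_congr_ae (m := 𝓖 t) e2, e3, hYh t,
    condExp_sub hDt (integrable_tail hDh t) (𝓖 t),
    condExp_add (integrable_tail hDh t) (integrable_tail hcY t) (𝓖 t)] with ω a1 a2 a3 a4 a5 a6 a7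
  rw [a3, a7, Pi.add_apply, a1, a2, a6, Pi.sub_apply, a4, a5]
  ring

/-- The solution of the linear equation with discounted cash flow `f`. -/
theorem IsRate.value_of_discounted (hk : IsRate 𝓖 P κ k) {f Y : ℝ≥0 → Ω → ℝ}
    (hf : Measurable (Function.uncurry f)) (hY : Measurable (Function.uncurry Y))
    (hfi : Integrable (Function.uncurry f) (lebesgue.prod P))
    (hYf : ∀ t, (fun ω => discount k t ω * Y t ω) =ᵐ[P]
      P[tail (fun s ω => discount k s ω * f s ω) t | 𝓖 t]) :
    Integrable (Function.uncurry fun s ω => k s ω * Y s ω) (lebesgue.prod P) ∧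
    ∀ t, Y t =ᵐ[P] P[tail (fun s ω => f s ω - k s ω * Y s ω) t | 𝓖 t] := by
  have hD := isStronglyProgressive_discount hk.progressive
  have hDm := hk.measurable_discount
  have hkm := measurable_uncurry hk.progressive
  have hDf := hk.integrable_discount_mul hfi
  have hDfm : Measurable (Function.uncurry fun s ω => discount k s ω * f s ω) := hDm.mul hf
  -- `A` is the unprojected solution: `Y s` is its conditional expectation given `𝓖 s`, and on each
  -- path it satisfies the linear equation without any expectation.
  set A : ℝ≥0 → Ω → ℝ := fun s ω => (discount k s ω)⁻¹ *
    tail (fun s ω => discount k s ω * f s ω) s ω with hA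
  have hAm : Measurable (Function.uncurry A) := hDm.inv.mul (measurable_tail hDfm)
  have hpath : ∀ᵐ ω ∂P, Integrable (fun s => k s ω * A s ω) lebesgue ∧
      ∫ s, |k s ω * A s ω| ∂lebesgue ≤
        (1 + 2 * (∫ s, κ s ∂lebesgue) * Real.exp (∫ s, κ s ∂lebesgue)) *
          ∫ u, |f u ω| ∂lebesgue ∧
      ∀ t, tail (fun s ω => k s ω * A s ω) t ω = tail f t ω - A t ω := by
    filter_upwards [hk.integrable, integrable_path hfi] with ω h1 h2
    exact mul_inv_pathDisc_mul_tail hk.bound_nonneg hk.bound_integrable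
        (fun s => hk.neg_bound_le s ω) (measurable_path hkm ω) h1 (measurable_path hf ω) h2
  -- The unbounded factor `1 / D_s` is harmless because `D_u ≤ exp (∫ κ) D_s` for `u ≥ s`.
  have hAi : ∀ s, Integrable (A s) P := fun s => by
    refine ((integrable_integral_abs hfi).const_mul (Real.exp (∫ s, κ s ∂lebesgue))).mono'
      (measurable_apply hAm s).aestronglyMeasurable ?_
    filter_upwards [hk.integrable, integrable_path hfi, integrable_path hDf] with ω h1 h2 h3
    have hp := discount_pos k s ω
    rw [Real.norm_eq_abs, hA, abs_mul, abs_of_pos (inv_pos.2 hp), inv_mul_le_iff₀ hp]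
    calc |tail (fun s ω => discount k s ω * f s ω) s ω|
        ≤ ∫ u in Ioi s, |discount k u ω * f u ω| ∂lebesgue :=
          norm_integral_le_integral_norm (μ := lebesgue.restrict (Ioi s))
            (fun u => discount k u ω * f u ω)
      _ ≤ ∫ u in Ioi s, Real.exp (∫ s, κ s ∂lebesgue) * discount k s ω * |f u ω| ∂lebesgue := by
          refine setIntegral_mono_on h3.abs.integrableOn (h2.abs.const_mul _).integrableOn
            measurableSet_Ioi fun u hu => ?_
          rw [abs_mul, abs_of_pos (discount_pos k u ω)]
          exact mul_le_mul_of_nonneg_right (hk.discount_le_mul h1 (le_of_lt hu)) (abs_nonneg _)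
      _ ≤ ∫ u, Real.exp (∫ s, κ s ∂lebesgue) * discount k s ω * |f u ω| ∂lebesgue := by
          refine setIntegral_le_integral (h2.abs.const_mul _) (ae_of_all _ fun u => ?_)
          exact mul_nonneg (mul_nonneg (Real.exp_pos _).le hp.le) (abs_nonneg _)
      _ = discount k s ω * (Real.exp (∫ s, κ s ∂lebesgue) * ∫ u, |f u ω| ∂lebesgue) := by
          rw [integral_const_mul]; ring
  have hYA : ∀ s, Y s =ᵐ[P] P[A s | 𝓖 s] := fun s => by
    have h1 : P[A s | 𝓖 s] =ᵐ[P] fun ω => (discount k s ω)⁻¹ *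
        (P[tail (fun s ω => discount k s ω * f s ω) s | 𝓖 s]) ω :=
      condExp_mul_of_stronglyMeasurable_left (hD.stronglyAdapted s).measurable.inv.stronglyMeasurable
        (hAi s) (integrable_tail hDf s)
    filter_upwards [h1, hYf s] with ω h1 h2
    rw [h1, ← h2, inv_mul_cancel_left₀ (discount_pos k s ω).ne']
  have hcA : Integrable (Function.uncurry fun s ω => k s ω * A s ω) (lebesgue.prod P) := by
    refine integrable_prod_of_forall_le (hkm.mul hAm) ((integrable_integral_abs hfi).const_mul
      (1 + 2 * (∫ s, κ s ∂lebesgue) * Real.exp (∫ s, κ s ∂lebesgue))) ?_ ?_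
    all_goals filter_upwards [hpath] with ω h3
    · exact h3.1
    · exact h3.2.1
  obtain ⟨hcY, hE⟩ := condExp_tail_mul hk.progressive hY hAi hYA hcA
  refine ⟨hcY, fun t => ?_⟩
  have e1 : tail (fun s ω => k s ω * A s ω) t =ᵐ[P] tail f t - A t := by
    filter_upwards [hpath] with ω h
    exact h.2.2 t
  have e2 : tail (fun s ω => f s ω - k s ω * Y s ω) t =ᵐ[P]
      tail f t - tail (fun s ω => k s ω * Y s ω) t := by
    filter_upwards [integrable_path hfi, integrable_path hcY] with ω h1 h2
    exact tail_sub h1 h2 t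
  filter_upwards [hE t, condExp_congr_ae (m := 𝓖 t) e1, condExp_congr_ae (m := 𝓖 t) e2, hYA t,
    condExp_sub (integrable_tail hfi t) (hAi t) (𝓖 t),
    condExp_sub (integrable_tail hfi t) (integrable_tail hcY t) (𝓖 t)] with ω a1 a2 a3 a4 a5 a6
  rw [a3, a6, Pi.sub_apply, a1, a2, a5, Pi.sub_apply, a4]
  ring

/-- Take a progressive version of the martingale of the total discounted cash flow, subtract the
flow accumulated up to `t`, and divide by the discount factor. -/
lemma IsRate.exists_discounted (hk : IsRate 𝓖 P κ k) {f : ℝ≥0 → Ω → ℝ}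
    (hf : IsStronglyProgressive 𝓖 f) (hfi : Integrable (Function.uncurry f) (lebesgue.prod P)) :
    ∃ Y : ℝ≥0 → Ω → ℝ, IsStronglyProgressive 𝓖 Y ∧
      ∀ t, (fun ω => discount k t ω * Y t ω) =ᵐ[P]
        P[tail (fun s ω => discount k s ω * f s ω) t | 𝓖 t] := by
  have hD := isStronglyProgressive_discount hk.progressive
  have hDf := hk.integrable_discount_mul hfi
  obtain ⟨N, hN, hN'⟩ := exists_progressive_condExp (𝓖 := 𝓖)
    (ξ := fun ω => ∫ s, discount k s ω * f s ω ∂lebesgue) hDf.integral_prod_right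
  have hI := isStronglyProgressive_integral (hD.mul hf)
  refine ⟨fun t ω => (discount k t ω)⁻¹ *
    (N t ω - ∫ s in Iic t, discount k s ω * f s ω ∂lebesgue),
    (hD.map measurable_inv).mul (hN.sub hI), fun t => ?_⟩
  have e1 : tail (fun s ω => discount k s ω * f s ω) t =ᵐ[P]
      (fun ω => ∫ s, discount k s ω * f s ω ∂lebesgue) -
        fun ω => ∫ s in Iic t, discount k s ω * f s ω ∂lebesgue := by
    filter_upwards [integrable_path hDf] with ω h
    rw [Pi.sub_apply, ← integral_add_compl (measurableSet_Iic (a := t)) h, compl_Iic]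
    simp [tail]
  have hIi : Integrable (fun ω => ∫ s in Iic t, discount k s ω * f s ω ∂lebesgue) P :=
    (hDf.mono_measure (Measure.prod_mono Measure.restrict_le_self le_rfl) :
      Integrable (Function.uncurry fun s ω => discount k s ω * f s ω)
        ((lebesgue.restrict (Iic t)).prod P)).integral_prod_right
  filter_upwards [condExp_congr_ae (m := 𝓖 t) e1, hN' t,
    condExp_sub hDf.integral_prod_right hIi (𝓖 t)] with ω a1 a2 a3
  rw [condExp_of_stronglyMeasurable (𝓖.le t) (hI.stronglyAdapted t) hIi] at a3
  rw [mul_inv_cancel_left₀ (discount_pos k t ω).ne', a1, a2]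
  exact a3.symm

/-- Comparison principle for linear equations. -/
theorem IsRate.value_nonneg (hk : IsRate 𝓖 P κ k) {h Y : ℝ≥0 → Ω → ℝ}
    (hh : Measurable (Function.uncurry h)) (hY : Measurable (Function.uncurry Y))
    (hhi : Integrable (Function.uncurry h) (lebesgue.prod P))
    (hYh : ∀ t, Y t =ᵐ[P] P[tail h t | 𝓖 t])
    (hpos : ∀ᵐ ω ∂P, ∀ᵐ s ∂lebesgue, 0 ≤ h s ω + k s ω * Y s ω) (t : ℝ≥0) :
    ∀ᵐ ω ∂P, 0 ≤ Y t ω := by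
  have h1 : 0 ≤ᵐ[P]
      P[tail (fun s ω => discount k s ω * (h s ω + k s ω * Y s ω)) t | 𝓖 t] := by
    refine condExp_nonneg ?_
    filter_upwards [hpos] with ω hω
    refine integral_nonneg_of_ae (ae_restrict_of_ae ?_)
    filter_upwards [hω] with s hs
    exact mul_nonneg (discount_pos k s ω).le hs
  filter_upwards [h1, hk.discounted_of_value hh hY hhi hYh t] with ω h2 h3
  rw [← h3] at h2
  exact nonneg_of_mul_nonneg_right h2 (discount_pos k t ω)

end Rate

end XVA

/-! ### Operations on rates, domination, and uniqueness for the reduced equation. -/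

namespace XVA

open Filter Set
open scoped Topology

variable {Ω : Type*} {m : MeasurableSpace Ω} {𝓖 : Filtration ℝ≥0 m} {P : Measure Ω}
  [IsProbabilityMeasure P]

lemma ae_prod_of_forall {p : ℝ≥0 → Ω → Prop} (hm : MeasurableSet {q : ℝ≥0 × Ω | p q.1 q.2})
    (h : ∀ s, ∀ᵐ ω ∂P, p s ω) : ∀ᵐ q ∂(lebesgue.prod P), p q.1 q.2 :=
  (Measure.ae_prod_mem_iff_ae_ae_mem hm).2 (ae_of_all _ h)

lemma ae_path_of_forall {p : ℝ≥0 → Ω → Prop} (hm : MeasurableSet {q : ℝ≥0 × Ω | p q.1 q.2})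
    (h : ∀ s, ∀ᵐ ω ∂P, p s ω) : ∀ᵐ ω ∂P, ∀ᵐ s ∂lebesgue, p s ω :=
  (Measure.ae_ae_comm hm).1 (ae_of_all _ h)

section Rate

variable {κ : ℝ≥0 → ℝ} {k l : ℝ≥0 → Ω → ℝ}

omit [IsProbabilityMeasure P] in
lemma IsRate.of_abs_le (hl : IsRate 𝓖 P κ l) (hk : IsStronglyProgressive 𝓖 k)
    (hkκ : ∀ s ω, -κ s ≤ k s ω) (hle : ∀ s ω, |k s ω| ≤ |l s ω|) : IsRate 𝓖 P κ k where
  progressive := hk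
  bound_nonneg := hl.bound_nonneg
  bound_integrable := hl.bound_integrable
  neg_bound_le := hkκ
  integrable := by
    filter_upwards [hl.integrable] with ω hω
    exact hω.mono (measurable_path (measurable_uncurry hk) ω).aestronglyMeasurable
      (ae_of_all _ fun s => hle s ω)

omit [IsProbabilityMeasure P] in
lemma IsRate.mul_fraction (hl : IsRate 𝓖 P κ l) {θ : ℝ≥0 → Ω → ℝ}
    (hθ : IsStronglyProgressive 𝓖 θ) (h0 : ∀ s ω, 0 ≤ θ s ω) (h1 : ∀ s ω, θ s ω ≤ 1) :
    IsRate 𝓖 P κ fun s ω => l s ω * θ s ω := by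
  refine hl.of_abs_le (hl.progressive.mul hθ) (fun s ω => ?_) fun s ω => ?_
  · have h2 := hl.neg_bound_le s ω
    have h3 := hl.bound_nonneg s
    calc -κ s ≤ -κ s * θ s ω := by nlinarith [h1 s ω]
      _ ≤ l s ω * θ s ω := mul_le_mul_of_nonneg_right h2 (h0 s ω)
  · rw [abs_mul, abs_of_nonneg (h0 s ω)]
    exact mul_le_of_le_one_right (abs_nonneg _) (h1 s ω)

omit [IsProbabilityMeasure P] in
lemma IsRate.posPart (hl : IsRate 𝓖 P κ l) : IsRate 𝓖 P κ fun s ω => max (l s ω) 0 := by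
  refine hl.of_abs_le (hl.progressive.map (measurable_id.max measurable_const)) (fun s ω => ?_)
    fun s ω => ?_
  · exact (neg_nonpos.2 (hl.bound_nonneg s)).trans (le_max_right _ _)
  · rw [abs_of_nonneg (le_max_right _ _)]
    exact max_le (le_abs_self _) (abs_nonneg _)

/-- A value process is bounded by a multiple of the value of a bound of its cash flow. -/
lemma IsRate.value_le (hk : IsRate 𝓖 P κ k) {f w Y U : ℝ≥0 → Ω → ℝ}
    (hf : Integrable (Function.uncurry f) (lebesgue.prod P))
    (hw : Integrable (Function.uncurry w) (lebesgue.prod P)) (hw0 : ∀ s ω, 0 ≤ w s ω)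
    (hYf : ∀ t, (fun ω => discount k t ω * Y t ω) =ᵐ[P]
      P[tail (fun s ω => discount k s ω * f s ω) t | 𝓖 t])
    (hU : ∀ t, U t =ᵐ[P] P[tail w t | 𝓖 t])
    (hfw : ∀ᵐ ω ∂P, ∀ᵐ s ∂lebesgue, f s ω ≤ w s ω) (t : ℝ≥0) :
    ∀ᵐ ω ∂P, Y t ω ≤ Real.exp (∫ s, κ s ∂lebesgue) * U t ω := by
  have hD := isStronglyProgressive_discount hk.progressive
  have hDf := hk.integrable_discount_mul hf
  set E := Real.exp (∫ s, κ s ∂lebesgue) with hE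
  have hi : Integrable (fun ω => (E * discount k t ω) * tail w t ω) P := by
    refine Integrable.bdd_mul (c := E * E) (integrable_tail hw t)
      ((measurable_apply hk.measurable_discount t).const_mul _).aestronglyMeasurable
      (ae_of_all _ fun ω => ?_)
    rw [Real.norm_of_nonneg (mul_nonneg (Real.exp_pos _).le (discount_pos _ _ _).le)]
    exact mul_le_mul_of_nonneg_left (hk.discount_le _ _) (Real.exp_pos _).le
  -- Bounding `D_s` by `exp (∫ κ) D_t` leaves a `𝓖 t`-measurable factor, which cancels against the
  -- one on the left of the equation for `Y`.
  have h1 : P[tail (fun s ω => discount k s ω * f s ω) t | 𝓖 t] ≤ᵐ[P]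
      P[fun ω => (E * discount k t ω) * tail w t ω | 𝓖 t] := by
    refine condExp_mono (integrable_tail hDf t) hi ?_
    filter_upwards [hfw, hk.integrable, integrable_path hw, integrable_path hDf] with ω a1 a2 a3 a4
    rw [tail, tail, ← integral_const_mul]
    refine setIntegral_mono_on_ae a4.integrableOn (a3.const_mul _).integrableOn
      measurableSet_Ioi ?_
    filter_upwards [a1] with s hs hst
    calc discount k s ω * f s ω ≤ discount k s ω * w s ω :=
          mul_le_mul_of_nonneg_left hs (discount_pos _ _ _).le
      _ ≤ E * discount k t ω * w s ω :=
          mul_le_mul_of_nonneg_right (hk.discount_le_mul a2 (le_of_lt hst)) (hw0 s ω)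
  have h2 : P[fun ω => (E * discount k t ω) * tail w t ω | 𝓖 t] =ᵐ[P]
      fun ω => (E * discount k t ω) * (P[tail w t | 𝓖 t]) ω :=
    condExp_mul_of_stronglyMeasurable_left ((hD.stronglyAdapted t).const_mul E) hi
      (integrable_tail hw t)
  filter_upwards [h1, h2, hYf t, hU t] with ω a1 a2 a3 a4
  rw [← a3, a2, ← a4] at a1
  refine le_of_mul_le_mul_left (a1.trans_eq ?_) (discount_pos k t ω)
  ring

end Rate

/-- `y` solves `y_t = E_t ∫_t^∞ l_s (x_s - y_s)⁺ ds`. -/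
structure SolvesReduced (𝓖 : Filtration ℝ≥0 m) (P : Measure Ω) (l x y : ℝ≥0 → Ω → ℝ) : Prop where
  progressive : IsStronglyProgressive 𝓖 y
  integrable : Integrable (Function.uncurry fun s ω => l s ω * max (x s ω - y s ω) 0)
    (lebesgue.prod P)
  eq : ∀ t, y t =ᵐ[P] P[tail (fun s ω => l s ω * max (x s ω - y s ω) 0) t | 𝓖 t]

section Uniqueness

variable {κ : ℝ≥0 → ℝ} {l x : ℝ≥0 → Ω → ℝ}

/-- Linearisation: `l ((x - y)⁺ - (x - z)⁺) = -l θ (y - z)` with `θ ∈ [0,1]`, so `y - z` solves a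
linear equation with rate `l θ ≥ -κ` and zero residual cash flow, whatever the sign of `l`.
Comparison applies, and exchanging `y` and `z` gives equality. -/
lemma SolvesReduced.le (hl : IsRate 𝓖 P κ l) (hx : IsStronglyProgressive 𝓖 x)
    {y z : ℝ≥0 → Ω → ℝ} (hy : SolvesReduced 𝓖 P l x y) (hz : SolvesReduced 𝓖 P l x z)
    (t : ℝ≥0) : ∀ᵐ ω ∂P, z t ω ≤ y t ω := by
  have hpos : ∀ {u : ℝ≥0 → Ω → ℝ}, IsStronglyProgressive 𝓖 u →
      IsStronglyProgressive 𝓖 fun s ω => max (x s ω - u s ω) 0 := fun hu =>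
    (hx.sub hu).map (measurable_id.max measurable_const)
  -- Where `y = z` the quotient is `0` by convention, which is consistent since the numerator
  -- vanishes as well.
  set θ : ℝ≥0 → Ω → ℝ := fun s ω =>
    (max (x s ω - z s ω) 0 - max (x s ω - y s ω) 0) / (y s ω - z s ω) with hθ
  have hθp : IsStronglyProgressive 𝓖 θ :=
    ((hpos hz.progressive).sub (hpos hy.progressive)).map₂ (g := fun a b => a / b)
      measurable_div (hy.progressive.sub hz.progressive)
  have key : ∀ a b c : ℝ, 0 ≤ (max (a - c) 0 - max (a - b) 0) / (b - c) ∧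
      (max (a - c) 0 - max (a - b) 0) / (b - c) ≤ 1 ∧
      (max (a - c) 0 - max (a - b) 0) / (b - c) * (b - c) = max (a - c) 0 - max (a - b) 0 := by
    intro a b c
    rcases lt_trichotomy b c with h | rfl | h
    · have h' : b - c < 0 := by linarith
      refine ⟨div_nonneg_of_nonpos ?_ h'.le, (div_le_one_of_neg h').2 ?_,
        div_mul_cancel₀ _ h'.ne⟩ <;> rcases max_cases (a - c) 0 with h1 | h1 <;>
        rcases max_cases (a - b) 0 with h2 | h2 <;> linarith
    · simp
    · have h' : 0 < b - c := by linarith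
      refine ⟨div_nonneg ?_ h'.le, (div_le_one h').2 ?_,
        div_mul_cancel₀ _ h'.ne'⟩ <;> rcases max_cases (a - c) 0 with h1 | h1 <;>
        rcases max_cases (a - b) 0 with h2 | h2 <;> linarith
  have hk := hl.mul_fraction hθp (fun s ω => (key _ _ _).1) (fun s ω => (key _ _ _).2.1)
  have hd := measurable_uncurry (hy.progressive.sub hz.progressive)
  have hh := measurable_uncurry ((hl.progressive.mul (hpos hy.progressive)).sub
    (hl.progressive.mul (hpos hz.progressive)))
  have h1 := hk.value_nonneg (P := P) hh hd (hy.integrable.sub hz.integrable) (fun t => ?_) ?_ t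
  · filter_upwards [h1] with ω hω
    linarith
  · have e1 : tail (fun s ω => l s ω * max (x s ω - y s ω) 0 - l s ω * max (x s ω - z s ω) 0) t
        =ᵐ[P] tail (fun s ω => l s ω * max (x s ω - y s ω) 0) t -
          tail (fun s ω => l s ω * max (x s ω - z s ω) 0) t := by
      filter_upwards [integrable_path hy.integrable, integrable_path hz.integrable] with ω a b
      exact tail_sub a b t
    filter_upwards [condExp_congr_ae (m := 𝓖 t) e1, hy.eq t, hz.eq t, condExp_sub
      (integrable_tail hy.integrable t) (integrable_tail hz.integrable t) (𝓖 t)] with ω a b c d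
    rw [a, d, Pi.sub_apply, ← b, ← c]
  · refine ae_of_all _ fun ω => ae_of_all _ fun s => le_of_eq ?_
    have := (key (x s ω) (y s ω) (z s ω)).2.2
    simp only [hθ]
    rw [mul_assoc, this]
    ring

lemma SolvesReduced.unique (hl : IsRate 𝓖 P κ l) (hx : IsStronglyProgressive 𝓖 x)
    {y z : ℝ≥0 → Ω → ℝ} (hy : SolvesReduced 𝓖 P l x y) (hz : SolvesReduced 𝓖 P l x z)
    (t : ℝ≥0) : y t =ᵐ[P] z t := by
  filter_upwards [hy.le hl hx hz t, hz.le hl hx hy t] with ω h1 h2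
  exact le_antisymm h2 h1

end Uniqueness

end XVA

/-! ### Subsolutions and the monotone iteration. -/

namespace XVA

open Filter Set
open scoped Topology

variable {Ω : Type*} {m : MeasurableSpace Ω} {𝓖 : Filtration ℝ≥0 m} {P : Measure Ω}

open Classical in
/-- The indicator of `y < x`. -/
def below (x y : ℝ≥0 → Ω → ℝ) (s : ℝ≥0) (ω : Ω) : ℝ := if y s ω < x s ω then 1 else 0

lemma below_nonneg (x y : ℝ≥0 → Ω → ℝ) (s : ℝ≥0) (ω : Ω) : 0 ≤ below x y s ω := by
  unfold below; split_ifs <;> norm_num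

lemma below_le_one (x y : ℝ≥0 → Ω → ℝ) (s : ℝ≥0) (ω : Ω) : below x y s ω ≤ 1 := by
  unfold below; split_ifs <;> norm_num

lemma below_mul_sub (x y : ℝ≥0 → Ω → ℝ) (s : ℝ≥0) (ω : Ω) :
    below x y s ω * (x s ω - y s ω) = max (x s ω - y s ω) 0 := by
  unfold below
  split_ifs with h
  · rw [one_mul, max_eq_left (by linarith)]
  · rw [zero_mul, max_eq_right (by linarith)]

lemma isStronglyProgressive_below {x y : ℝ≥0 → Ω → ℝ} (hx : IsStronglyProgressive 𝓖 x)
    (hy : IsStronglyProgressive 𝓖 y) : IsStronglyProgressive 𝓖 (below x y) := by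
  classical
  refine hy.map₂ (g := fun a b => if a < b then (1 : ℝ) else 0) ?_ hx
  exact Measurable.ite (measurableSet_lt measurable_fst measurable_snd) measurable_const
    measurable_const

/-- The cash flow `l⁺ θ x - l⁻ (x - y)⁺`. -/
def linFlow (l x θ y : ℝ≥0 → Ω → ℝ) (s : ℝ≥0) (ω : Ω) : ℝ :=
  max (l s ω) 0 * θ s ω * x s ω - max (-l s ω) 0 * max (x s ω - y s ω) 0

lemma isStronglyProgressive_linFlow {l x θ y : ℝ≥0 → Ω → ℝ} (hl : IsStronglyProgressive 𝓖 l)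
    (hx : IsStronglyProgressive 𝓖 x) (hθ : IsStronglyProgressive 𝓖 θ)
    (hy : IsStronglyProgressive 𝓖 y) : IsStronglyProgressive 𝓖 (linFlow l x θ y) :=
  (((hl.map (measurable_id.max measurable_const)).mul hθ).mul hx).sub
    ((hl.map (g := fun a => max (-a) 0) (measurable_neg.max measurable_const)).mul
      ((hx.sub hy).map (measurable_id.max measurable_const)))

/-- The part with `l⁻` only lowers the flow, so the upper bound is free of `y`. This gives every
iterate the same upper bound. -/
lemma linFlow_le {l x θ y : ℝ≥0 → Ω → ℝ} {s : ℝ≥0} {ω : Ω} (h0 : 0 ≤ θ s ω) (h1 : θ s ω ≤ 1) :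
    linFlow l x θ y s ω ≤ |l s ω * x s ω| := by
  have h2 : max (l s ω) 0 ≤ |l s ω| := max_le (le_abs_self _) (abs_nonneg _)
  have h3 : 0 ≤ max (-l s ω) 0 * max (x s ω - y s ω) 0 :=
    mul_nonneg (le_max_right _ _) (le_max_right _ _)
  have h4 : max (l s ω) 0 * θ s ω * x s ω ≤ |l s ω| * |x s ω| := by
    refine (le_abs_self _).trans ?_
    rw [abs_mul, abs_mul, abs_of_nonneg h0, abs_of_nonneg (le_max_right (l s ω) 0)]
    refine mul_le_mul_of_nonneg_right ?_ (abs_nonneg _)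
    exact (mul_le_of_le_one_right (le_max_right _ _) h1).trans h2
  rw [abs_mul]
  unfold linFlow
  linarith

lemma abs_linFlow_le {l x θ y : ℝ≥0 → Ω → ℝ} {s : ℝ≥0} {ω : Ω} {c : ℝ} (h0 : 0 ≤ θ s ω)
    (h1 : θ s ω ≤ 1) (hc : -c ≤ l s ω) (hc0 : 0 ≤ c) :
    |linFlow l x θ y s ω| ≤ 2 * |l s ω * x s ω| + c * |y s ω| := by
  have h5 : 0 ≤ c * |y s ω| := mul_nonneg hc0 (abs_nonneg _)
  refine abs_le.2 ⟨?_, (linFlow_le h0 h1).trans (by linarith [abs_nonneg (l s ω * x s ω)])⟩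
  have h2 : max (l s ω) 0 ≤ |l s ω| := max_le (le_abs_self _) (abs_nonneg _)
  have h4 : -(|l s ω| * |x s ω|) ≤ max (l s ω) 0 * θ s ω * x s ω := by
    refine le_trans (neg_le_neg ?_) (neg_abs_le _)
    rw [abs_mul, abs_mul, abs_of_nonneg h0, abs_of_nonneg (le_max_right (l s ω) 0)]
    refine mul_le_mul_of_nonneg_right ?_ (abs_nonneg _)
    exact (mul_le_of_le_one_right (le_max_right _ _) h1).trans h2
  -- Two bounds on `l⁻` are used: `|l|` against `|x|`, where only the product is controlled, and `c`
  -- against `|y|`.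
  have h6 : max (-l s ω) 0 * max (x s ω - y s ω) 0 ≤ |l s ω| * |x s ω| + c * |y s ω| := by
    have a1 : max (x s ω - y s ω) 0 ≤ |x s ω| + |y s ω| := by
      refine max_le ?_ (by positivity)
      linarith [le_abs_self (x s ω), neg_abs_le (y s ω)]
    have a2 : max (-l s ω) 0 ≤ |l s ω| := max_le (neg_le_abs _) (abs_nonneg _)
    have a3 : max (-l s ω) 0 ≤ c := max_le (by linarith) hc0
    calc max (-l s ω) 0 * max (x s ω - y s ω) 0
        ≤ max (-l s ω) 0 * (|x s ω| + |y s ω|) :=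
          mul_le_mul_of_nonneg_left a1 (le_max_right _ _)
      _ = max (-l s ω) 0 * |x s ω| + max (-l s ω) 0 * |y s ω| := by ring
      _ ≤ _ := add_le_add (mul_le_mul_of_nonneg_right a2 (abs_nonneg _))
          (mul_le_mul_of_nonneg_right a3 (abs_nonneg _))
  rw [abs_mul]
  unfold linFlow
  linarith

/-- `y` is a value process with cash flow `h ≤ l (x - y)⁺`, bounded by a multiple of `U`. -/
structure IsSubsolution (𝓖 : Filtration ℝ≥0 m) (P : Measure Ω) (κ : ℝ≥0 → ℝ)
    (l x U y h : ℝ≥0 → Ω → ℝ) : Prop where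
  progressive : IsStronglyProgressive 𝓖 y
  measurable : Measurable (Function.uncurry h)
  integrable : Integrable (Function.uncurry h) (lebesgue.prod P)
  eq : ∀ t, y t =ᵐ[P] P[tail h t | 𝓖 t]
  flow_le : ∀ᵐ ω ∂P, ∀ᵐ s ∂lebesgue, h s ω ≤ l s ω * max (x s ω - y s ω) 0
  bound : ∀ t, ∀ᵐ ω ∂P, |y t ω| ≤ Real.exp (∫ s, κ s ∂lebesgue) * U t ω

section Existence

variable [IsProbabilityMeasure P] {κ : ℝ≥0 → ℝ} {l x U : ℝ≥0 → Ω → ℝ}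

/-- The first moment of `y s` is bounded uniformly in `s` by a multiple of that of `∫ |w|`, and `κ`
is deterministic and integrable in time. -/
lemma integrable_bound_mul (hκm : Measurable κ) (hκ0 : ∀ s, 0 ≤ κ s)
    (hκ : Integrable κ lebesgue) {w U y : ℝ≥0 → Ω → ℝ}
    (hw : Integrable (Function.uncurry w) (lebesgue.prod P))
    (hU : ∀ t, U t =ᵐ[P] P[tail w t | 𝓖 t]) (hy : Measurable (Function.uncurry y)) {E : ℝ}
    (hE : 0 ≤ E) (hyU : ∀ t, ∀ᵐ ω ∂P, |y t ω| ≤ E * U t ω) :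
    Integrable (Function.uncurry fun s ω => κ s * y s ω) (lebesgue.prod P) := by
  have hm : Measurable (Function.uncurry fun s ω => κ s * y s ω) :=
    (hκm.comp measurable_fst).mul hy
  have hUi : ∀ t, Integrable (U t) P := fun t => integrable_condExp.congr (hU t).symm
  have hyi : ∀ t, Integrable (y t) P := fun t =>
    ((hUi t).const_mul E).mono' (measurable_apply hy t).aestronglyMeasurable (hyU t)
  rw [integrable_prod_iff hm.aestronglyMeasurable]
  refine ⟨ae_of_all _ fun s => (hyi s).const_mul (κ s), ?_⟩
  refine (hκ.mul_const (E * ∫ ω, ∫ s, |w s ω| ∂lebesgue ∂P)).mono'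
    hm.norm.aestronglyMeasurable.integral_prod_right' (ae_of_all _ fun s => ?_)
  rw [Real.norm_of_nonneg (integral_nonneg fun s => norm_nonneg _)]
  calc ∫ ω, ‖κ s * y s ω‖ ∂P = κ s * ∫ ω, |y s ω| ∂P := by
        rw [← integral_const_mul]
        refine integral_congr_ae (ae_of_all _ fun ω => ?_)
        simp only [norm_mul, Real.norm_eq_abs, abs_of_nonneg (hκ0 s)]
    _ ≤ κ s * ∫ ω, E * U s ω ∂P := by
        refine mul_le_mul_of_nonneg_left ?_ (hκ0 s)
        exact integral_mono_ae (hyi s).abs ((hUi s).const_mul E) (hyU s)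
    _ = κ s * (E * ∫ ω, tail w s ω ∂P) := by
        rw [integral_const_mul, integral_congr_ae (hU s), integral_condExp (𝓖.le s)]
    _ ≤ κ s * (E * ∫ ω, ∫ s, |w s ω| ∂lebesgue ∂P) := by
        refine mul_le_mul_of_nonneg_left (mul_le_mul_of_nonneg_left ?_ hE) (hκ0 s)
        refine integral_mono_ae (integrable_tail hw s) (integrable_integral_abs hw) ?_
        filter_upwards [integrable_path hw] with ω hω
        exact (le_abs_self _).trans (abs_tail_le hω s)

lemma integrable_linFlow (hl : IsRate 𝓖 P κ l) (hκm : Measurable κ)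
    (hx : IsStronglyProgressive 𝓖 x)
    (hlx : Integrable (Function.uncurry fun s ω => l s ω * x s ω) (lebesgue.prod P))
    (hU : ∀ t, U t =ᵐ[P] P[tail (fun s ω => |l s ω * x s ω|) t | 𝓖 t])
    {y θ : ℝ≥0 → Ω → ℝ} (hy : IsStronglyProgressive 𝓖 y) (hθ : IsStronglyProgressive 𝓖 θ)
    (h0 : ∀ s ω, 0 ≤ θ s ω) (h1 : ∀ s ω, θ s ω ≤ 1)
    (hyU : ∀ t, ∀ᵐ ω ∂P, |y t ω| ≤ Real.exp (∫ s, κ s ∂lebesgue) * U t ω) :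
    Integrable (Function.uncurry (linFlow l x θ y)) (lebesgue.prod P) := by
  have hκy := integrable_bound_mul hκm hl.bound_nonneg hl.bound_integrable hlx.abs hU
    (measurable_uncurry hy) (Real.exp_pos _).le hyU
  refine ((hlx.abs.const_mul 2).add hκy.abs).mono' (measurable_uncurry
    (isStronglyProgressive_linFlow hl.progressive hx hθ hy)).aestronglyMeasurable
    (ae_of_all _ fun p => ?_)
  have := abs_linFlow_le (x := x) (y := y) (h0 p.1 p.2) (h1 p.1 p.2) (hl.neg_bound_le p.1 p.2)
    (hl.bound_nonneg p.1)
  simpa [Function.uncurry, abs_mul, abs_of_nonneg (hl.bound_nonneg p.1)] using this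

/-- The candidate is `-z`, where `z ≥ 0` solves the linear equation with rate `-κ` and source `|l
x|`. Its cash flow `-|l x| - κ z` lies below `l (x + z)⁺`: for `l ≥ 0` by sign, for `l ≤ 0` because
`-l ≤ κ`. -/
lemma IsRate.exists_subsolution (hl : IsRate 𝓖 P κ l) (hκm : Measurable κ)
    (hx : IsStronglyProgressive 𝓖 x)
    (hlx : Integrable (Function.uncurry fun s ω => l s ω * x s ω) (lebesgue.prod P))
    (hU : ∀ t, U t =ᵐ[P] P[tail (fun s ω => |l s ω * x s ω|) t | 𝓖 t]) :
    ∃ y h : ℝ≥0 → Ω → ℝ, IsSubsolution 𝓖 P κ l x U y h := by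
  have hk : IsRate 𝓖 P κ fun s _ => -κ s :=
    { progressive := isStronglyProgressive_time hκm.neg
      bound_nonneg := hl.bound_nonneg
      bound_integrable := hl.bound_integrable
      neg_bound_le := fun s ω => le_rfl
      integrable := ae_of_all _ fun ω => hl.bound_integrable.neg }
  have hwp : IsStronglyProgressive 𝓖 fun s ω => |l s ω * x s ω| :=
    (hl.progressive.mul hx).norm
  have hwm := measurable_uncurry hwp
  have hwi : Integrable (Function.uncurry fun s ω => |l s ω * x s ω|) (lebesgue.prod P) :=
    hlx.abs
  obtain ⟨z, hz, hzE⟩ := hk.exists_discounted hwp hlx.abs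
  have hzm := measurable_uncurry hz
  obtain ⟨hkz, hzv⟩ := hk.value_of_discounted hwm hzm hlx.abs hzE
  have hzU := hk.value_le hwi hwi (fun s ω => abs_nonneg _) hzE hU
    (ae_of_all _ fun ω => ae_of_all _ fun s => le_rfl)
  have hkm := measurable_uncurry hk.progressive
  have hz0 : ∀ t, ∀ᵐ ω ∂P, 0 ≤ z t ω := fun t => by
    refine hk.value_nonneg (h := fun s ω => |l s ω * x s ω| - -κ s * z s ω)
      (hwm.sub (hkm.mul hzm)) hzm (hwi.sub hkz) hzv ?_ t
    refine ae_of_all _ fun ω => ae_of_all _ fun s => ?_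
    simp only [sub_add_cancel]
    exact abs_nonneg _
  refine ⟨fun s ω => -z s ω, fun s ω => -(|l s ω * x s ω| - -κ s * z s ω),
    hz.map measurable_neg, (hwm.sub (hkm.mul hzm)).neg, (hlx.abs.sub hkz).neg, fun t => ?_, ?_,
    fun t => ?_⟩
  · have e1 : tail (fun s ω => -(|l s ω * x s ω| - -κ s * z s ω)) t =
        -tail (fun s ω => |l s ω * x s ω| - -κ s * z s ω) t := by
      ext ω
      exact integral_neg _
    rw [e1]
    filter_upwards [hzv t, condExp_neg (μ := P)
      (tail (fun s ω => |l s ω * x s ω| - -κ s * z s ω) t) (𝓖 t)] with ω a1 a2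
    rw [a2, Pi.neg_apply, a1]
  · filter_upwards [ae_path_of_forall (measurableSet_le measurable_const hzm) hz0] with ω hω
    filter_upwards [hω] with s hs
    have b1 := hl.neg_bound_le s ω
    have b2 := hl.bound_nonneg s
    rw [abs_mul, sub_neg_eq_add]
    have b3 : 0 ≤ |l s ω| * |x s ω| := by positivity
    have b4 : 0 ≤ κ s * z s ω := mul_nonneg b2 hs
    rcases le_total 0 (l s ω) with h | h
    · have : 0 ≤ l s ω * max (x s ω + z s ω) 0 := mul_nonneg h (le_max_right _ _)
      linarith
    · have a1 : max (x s ω + z s ω) 0 ≤ |x s ω| + z s ω :=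
        max_le (by linarith [le_abs_self (x s ω)]) (by positivity)
      have a2 : -l s ω * max (x s ω + z s ω) 0 ≤ -l s ω * (|x s ω| + z s ω) :=
        mul_le_mul_of_nonneg_left a1 (by linarith)
      have a3 : -l s ω * z s ω ≤ κ s * z s ω := mul_le_mul_of_nonneg_right (by linarith) hs
      rw [abs_of_nonpos h]
      linarith
  · filter_upwards [hzU t, hz0 t] with ω a1 a2
    rwa [abs_neg, abs_of_nonneg a2]

/-- With `θ = 1_{y < x}`, the new iterate has cash flow `l⁺ θ (x - z) - l⁻ (x - y)⁺`. The first term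
is the tangent at `y` of the convex function `z ↦ l⁺ (x - z)⁺`; the second is a nondecreasing
function frozen at `y`. The equation is linear in `z` with the nonnegative rate `l⁺ θ`. -/
lemma IsSubsolution.exists_step (hl : IsRate 𝓖 P κ l) (hκm : Measurable κ)
    (hx : IsStronglyProgressive 𝓖 x)
    (hlx : Integrable (Function.uncurry fun s ω => l s ω * x s ω) (lebesgue.prod P))
    (hU : ∀ t, U t =ᵐ[P] P[tail (fun s ω => |l s ω * x s ω|) t | 𝓖 t])
    {y h : ℝ≥0 → Ω → ℝ} (hy : IsSubsolution 𝓖 P κ l x U y h) :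
    ∃ y' h' : ℝ≥0 → Ω → ℝ, IsSubsolution 𝓖 P κ l x U y' h' ∧
      (∀ t, ∀ᵐ ω ∂P, y t ω ≤ y' t ω) ∧
      ∀ t, (fun ω => discount (fun s ω => max (l s ω) 0 * below x y s ω) t ω * y' t ω) =ᵐ[P]
        P[tail (fun s ω => discount (fun s ω => max (l s ω) 0 * below x y s ω) s ω *
          linFlow l x (below x y) y s ω) t | 𝓖 t] := by
  have hθ := isStronglyProgressive_below hx hy.progressive
  have hk := hl.posPart.mul_fraction hθ (below_nonneg x y) (below_le_one x y)
  set k : ℝ≥0 → Ω → ℝ := fun s ω => max (l s ω) 0 * below x y s ω with hkdef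
  have hfp := isStronglyProgressive_linFlow hl.progressive hx hθ hy.progressive
  have hfi := integrable_linFlow hl hκm hx hlx hU hy.progressive hθ (below_nonneg x y)
    (below_le_one x y) hy.bound
  have hfm := measurable_uncurry hfp
  obtain ⟨z, hz, hzE⟩ := hk.exists_discounted hfp hfi
  have hzm := measurable_uncurry hz
  have hym := measurable_uncurry hy.progressive
  have hkm := measurable_uncurry hk.progressive
  obtain ⟨hkz, hzv⟩ := hk.value_of_discounted hfm hzm hfi hzE
  have hwi : Integrable (Function.uncurry fun s ω => |l s ω * x s ω|) (lebesgue.prod P) :=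
    hlx.abs
  have hzU := hk.value_le hfi hwi (fun s ω => abs_nonneg _) hzE hU
    (ae_of_all _ fun ω => ae_of_all _ fun s => linFlow_le (below_nonneg x y s ω)
      (below_le_one x y s ω))
  have hgm : Measurable (Function.uncurry fun s ω => linFlow l x (below x y) y s ω - k s ω * z s ω) :=
    hfm.sub (hkm.mul hzm)
  have hgi : Integrable (Function.uncurry fun s ω => linFlow l x (below x y) y s ω - k s ω * z s ω)
    (lebesgue.prod P) := hfi.sub hkz
  -- Relative to the rate `l⁺ θ`, the residual flow of `z - y` is `l (x - y)⁺ - h`, nonnegative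
  -- because `y` is a subsolution.
  have hyz : ∀ t, ∀ᵐ ω ∂P, y t ω ≤ z t ω := fun t => by
    have h1 := hk.value_nonneg (P := P) (Y := fun s ω => z s ω - y s ω)
      (h := fun s ω => linFlow l x (below x y) y s ω - k s ω * z s ω - h s ω)
      (hgm.sub hy.measurable) (hzm.sub hym)
      (hgi.sub hy.integrable) (fun t => ?_) ?_ t
    · filter_upwards [h1] with ω hω
      simpa using hω
    · have e1 : tail (fun s ω => linFlow l x (below x y) y s ω - k s ω * z s ω - h s ω) t =ᵐ[P]
          tail (fun s ω => linFlow l x (below x y) y s ω - k s ω * z s ω) t - tail h t := by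
        filter_upwards [integrable_path hgi, integrable_path hy.integrable] with ω a b
        exact tail_sub a b t
      filter_upwards [condExp_congr_ae (m := 𝓖 t) e1, hzv t, hy.eq t, condExp_sub
        (integrable_tail hgi t) (integrable_tail hy.integrable t) (𝓖 t)] with ω a b c d
      refine Eq.trans ?_ a.symm
      rw [d, Pi.sub_apply, ← b, ← c]
    · filter_upwards [hy.flow_le] with ω hω
      filter_upwards [hω] with s hs
      have a1 := below_mul_sub x y s ω
      have a2 : linFlow l x (below x y) y s ω - k s ω * z s ω - h s ω +
          k s ω * (z s ω - y s ω) = l s ω * max (x s ω - y s ω) 0 - h s ω := by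
        have a3 : l s ω = max (l s ω) 0 - max (-l s ω) 0 := by
          rcases le_total 0 (l s ω) with h | h
          · rw [max_eq_left h, max_eq_right (by linarith)]; ring
          · rw [max_eq_right h, max_eq_left (by linarith)]; ring
        simp only [linFlow, hkdef]
        conv_rhs => rw [a3]
        linear_combination max (l s ω) 0 * a1
      linarith
  refine ⟨z, _, ⟨hz, hgm, hgi, hzv, ?_, fun t => ?_⟩, hyz, hzE⟩
  -- The subsolution property survives: a tangent lies below the convex function, and `z ≥ y` gives
  -- `-l⁻ (x - y)⁺ ≤ -l⁻ (x - z)⁺`.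
  · filter_upwards [ae_path_of_forall (measurableSet_le hym hzm) hyz] with ω hω
    filter_upwards [hω] with s hs
    have b1 : below x y s ω * (x s ω - z s ω) ≤ max (x s ω - z s ω) 0 := by
      rcases le_total 0 (x s ω - z s ω) with h | h
      · exact (mul_le_of_le_one_left h (below_le_one x y s ω)).trans (le_max_left _ _)
      · exact (mul_nonpos_of_nonneg_of_nonpos (below_nonneg x y s ω) h).trans (le_max_right _ _)
    have b2 : max (x s ω - z s ω) 0 ≤ max (x s ω - y s ω) 0 := max_le_max (by linarith) le_rfl
    have b3 := mul_le_mul_of_nonneg_left b1 (le_max_right (l s ω) 0)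
    have b4 := mul_le_mul_of_nonneg_left b2 (le_max_right (-l s ω) 0)
    have a3 : l s ω = max (l s ω) 0 - max (-l s ω) 0 := by
      rcases le_total 0 (l s ω) with h | h
      · rw [max_eq_left h, max_eq_right (by linarith)]; ring
      · rw [max_eq_right h, max_eq_left (by linarith)]; ring
    simp only [linFlow, hkdef]
    calc _ = max (l s ω) 0 * (below x y s ω * (x s ω - z s ω)) -
          max (-l s ω) 0 * max (x s ω - y s ω) 0 := by ring
      _ ≤ max (l s ω) 0 * max (x s ω - z s ω) 0 -
          max (-l s ω) 0 * max (x s ω - z s ω) 0 := by linarith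
      _ = l s ω * max (x s ω - z s ω) 0 := by conv_rhs => rw [a3, sub_mul]
  -- The upper bound comes from the flow, the lower one is inherited from `y ≤ z`.
  · filter_upwards [hzU t, hyz t, hy.bound t] with ω a1 a2 a3
    exact abs_le.2 ⟨by linarith [(abs_le.1 a3).1], a1⟩

end Existence

end XVA

/-! ### Passage to the limit and existence for the reduced equation. -/

namespace XVA

open Filter Set
open scoped Topology

variable {Ω : Type*} {m : MeasurableSpace Ω} {𝓖 : Filtration ℝ≥0 m} {P : Measure Ω}

lemma iInf_below_mem (x : ℝ≥0 → Ω → ℝ) (Y : ℕ → ℝ≥0 → Ω → ℝ) (s : ℝ≥0) (ω : Ω) :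
    0 ≤ (⨅ j, below x (Y j) s ω) ∧ (⨅ j, below x (Y j) s ω) ≤ 1 :=
  ⟨le_ciInf fun j => below_nonneg _ _ _ _,
    (ciInf_le ⟨0, by rintro _ ⟨j, rfl⟩; exact below_nonneg _ _ _ _⟩ 0).trans
      (below_le_one _ _ _ _)⟩

section Limit

variable {x : ℝ≥0 → Ω → ℝ} {Y : ℕ → ℝ≥0 → Ω → ℝ} {s : ℝ≥0} {ω : Ω}

lemma tendsto_below (hY : Monotone fun j => Y j s ω) :
    Tendsto (fun j => below x (Y j) s ω) atTop (𝓝 (⨅ j, below x (Y j) s ω)) := by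
  refine tendsto_atTop_ciInf (fun i j hij => ?_) ⟨0, by
    rintro _ ⟨j, rfl⟩; exact below_nonneg _ _ _ _⟩
  have : Y i s ω ≤ Y j s ω := hY hij
  unfold below
  split_ifs with h1 h2
  · exact le_rfl
  · exact absurd (this.trans_lt h1) h2
  · exact zero_le_one
  · exact le_rfl

/-- The limiting indicator can differ from that of `sup Y < x` only where `sup Y = x`, and there the
factor `x - sup Y` vanishes. -/
lemma iInf_below_mul_sub (hb : BddAbove (range fun j => Y j s ω)) :
    (⨅ j, below x (Y j) s ω) * (x s ω - ⨆ j, Y j s ω) = max (x s ω - ⨆ j, Y j s ω) 0 := by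
  by_cases h : ∀ j, Y j s ω < x s ω
  · have h1 : ∀ j, below x (Y j) s ω = 1 := fun j => by unfold below; rw [if_pos (h j)]
    have h2 : (⨆ j, Y j s ω) ≤ x s ω := ciSup_le fun j => (h j).le
    simp only [h1, ciInf_const, one_mul]
    rw [max_eq_left (by linarith)]
  · push Not at h
    obtain ⟨j, hj⟩ := h
    have h1 : (⨅ j, below x (Y j) s ω) ≤ 0 :=
      (ciInf_le ⟨0, by rintro _ ⟨j, rfl⟩; exact below_nonneg _ _ _ _⟩ j).trans_eq
        (by unfold below; rw [if_neg (not_lt.2 hj)])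
    have h2 : (⨅ j, below x (Y j) s ω) = 0 := le_antisymm h1 (iInf_below_mem x Y s ω).1
    have h3 : x s ω ≤ ⨆ j, Y j s ω := hj.trans (le_ciSup hb j)
    rw [h2, zero_mul, max_eq_right (by linarith)]

end Limit

variable [IsProbabilityMeasure P] {κ : ℝ≥0 → ℝ} {l x : ℝ≥0 → Ω → ℝ}

lemma IsRate.exists_seq (hl : IsRate 𝓖 P κ l) (hκm : Measurable κ)
    (hx : IsStronglyProgressive 𝓖 x)
    (hlx : Integrable (Function.uncurry fun s ω => l s ω * x s ω) (lebesgue.prod P))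
    {U : ℝ≥0 → Ω → ℝ} (hU : ∀ t, U t =ᵐ[P] P[tail (fun s ω => |l s ω * x s ω|) t | 𝓖 t]) :
    ∃ Y : ℕ → ℝ≥0 → Ω → ℝ, (∀ j, IsStronglyProgressive 𝓖 (Y j)) ∧
      (∀ j t, ∀ᵐ ω ∂P, |Y j t ω| ≤ Real.exp (∫ s, κ s ∂lebesgue) * U t ω) ∧
      (∀ j t, ∀ᵐ ω ∂P, Y j t ω ≤ Y (j + 1) t ω) ∧
      ∀ j t, (fun ω => discount (fun s ω => max (l s ω) 0 * below x (Y j) s ω) t ω *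
          Y (j + 1) t ω) =ᵐ[P]
        P[tail (fun s ω => discount (fun s ω => max (l s ω) 0 * below x (Y j) s ω) s ω *
          linFlow l x (below x (Y j)) (Y j) s ω) t | 𝓖 t] := by
  obtain ⟨y₀, h₀, hy₀⟩ := hl.exists_subsolution hκm hx hlx hU
  have hstep : ∀ p : {p : (ℝ≥0 → Ω → ℝ) × (ℝ≥0 → Ω → ℝ) // IsSubsolution 𝓖 P κ l x U p.1 p.2},
      ∃ q : {p : (ℝ≥0 → Ω → ℝ) × (ℝ≥0 → Ω → ℝ) // IsSubsolution 𝓖 P κ l x U p.1 p.2},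
      (∀ t, ∀ᵐ ω ∂P, p.1.1 t ω ≤ q.1.1 t ω) ∧
      ∀ t, (fun ω => discount (fun s ω => max (l s ω) 0 * below x p.1.1 s ω) t ω *
          q.1.1 t ω) =ᵐ[P]
        P[tail (fun s ω => discount (fun s ω => max (l s ω) 0 * below x p.1.1 s ω) s ω *
          linFlow l x (below x p.1.1) p.1.1 s ω) t | 𝓖 t] := by
    rintro ⟨⟨y, h⟩, hy⟩
    obtain ⟨y', h', hy', h1, h2⟩ := hy.exists_step hl hκm hx hlx hU
    exact ⟨⟨⟨y', h'⟩, hy'⟩, h1, h2⟩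
  choose nxt hnxt using hstep
  let S : ℕ → {p : (ℝ≥0 → Ω → ℝ) × (ℝ≥0 → Ω → ℝ) // IsSubsolution 𝓖 P κ l x U p.1 p.2} :=
    fun j => nxt^[j] ⟨⟨y₀, h₀⟩, hy₀⟩
  have hS : ∀ j, S (j + 1) = nxt (S j) := fun j => Function.iterate_succ_apply' _ _ _
  refine ⟨fun j => (S j).1.1, fun j => (S j).2.progressive, fun j => (S j).2.bound, fun j => ?_,
    fun j => ?_⟩
  · simp only [hS]
    exact (hnxt (S j)).1
  · simp only [hS]
    exact (hnxt (S j)).2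

/-- The limit is taken in the discounted form of the linear equations, where the factors are bounded
and dominated convergence applies, first in time and then under the conditional expectation.
Undiscounting the limit equation then yields the nonlinear one. -/
theorem IsRate.exists_solvesReduced (hl : IsRate 𝓖 P κ l) (hκm : Measurable κ)
    (hx : IsStronglyProgressive 𝓖 x)
    (hlx : Integrable (Function.uncurry fun s ω => l s ω * x s ω) (lebesgue.prod P)) :
    ∃ y : ℝ≥0 → Ω → ℝ, SolvesReduced 𝓖 P l x y ∧
      ∀ t, ∀ᵐ ω ∂P, |y t ω| ≤ Real.exp (∫ s, κ s ∂lebesgue) *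
        (P[tail (fun s ω => |l s ω * x s ω|) t | 𝓖 t]) ω := by
  have hwi : Integrable (Function.uncurry fun s ω => |l s ω * x s ω|) (lebesgue.prod P) :=
    hlx.abs
  have hwp : IsStronglyProgressive 𝓖 fun s ω => |l s ω * x s ω| :=
    (hl.progressive.mul hx).norm
  -- The zero rate has discount factor `1`, so it provides a progressive version `U` of the
  -- dominating value process.
  have hzero : IsRate 𝓖 P κ fun _ _ => 0 :=
    hl.of_abs_le (isStronglyProgressive_const 𝓖 0)
      (fun s _ => neg_nonpos.2 (hl.bound_nonneg s)) (fun s ω => by simp)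
  obtain ⟨U, hUp, hU'⟩ := hzero.exists_discounted hwp hwi
  have hU : ∀ t, U t =ᵐ[P] P[tail (fun s ω => |l s ω * x s ω|) t | 𝓖 t] := by
    simpa [discount, pathDisc] using hU'
  set E := Real.exp (∫ s, κ s ∂lebesgue) with hE
  have hE0 : 0 < E := Real.exp_pos _
  obtain ⟨Y, hY, hYU, hYm, hYd⟩ := hl.exists_seq hκm hx hlx hU
  have hgood : ∀ t, ∀ᵐ ω ∂P, ∀ j, Y j t ω ≤ Y (j + 1) t ω ∧ |Y j t ω| ≤ E * U t ω := fun t =>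
    ae_all_iff.2 fun j => (hYm j t).and (hYU j t)
  have hUm := measurable_uncurry hUp
  have hgoodm : MeasurableSet {q : ℝ≥0 × Ω | ∀ j, Y j q.1 q.2 ≤ Y (j + 1) q.1 q.2 ∧
      |Y j q.1 q.2| ≤ E * U q.1 q.2} := by
    rw [ofPred_forall]
    refine MeasurableSet.iInter fun j => ?_
    have h1 := measurable_uncurry (hY j)
    have h2 := measurable_uncurry (hY (j + 1))
    exact (measurableSet_le h1 h2).inter (measurableSet_le h1.abs (hUm.const_mul E))
  set y : ℝ≥0 → Ω → ℝ := fun t ω => ⨆ j, Y j t ω with hydef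
  have hyp : IsStronglyProgressive 𝓖 y := isStronglyProgressive_iSup hY
  have hbdd : ∀ {t ω}, (∀ j, Y j t ω ≤ Y (j + 1) t ω ∧ |Y j t ω| ≤ E * U t ω) →
      BddAbove (range fun j => Y j t ω) := fun h =>
    ⟨_, by rintro _ ⟨j, rfl⟩; exact (le_abs_self _).trans (h j).2⟩
  have hmono : ∀ {t ω}, (∀ j, Y j t ω ≤ Y (j + 1) t ω ∧ |Y j t ω| ≤ E * U t ω) →
      Monotone fun j => Y j t ω := fun h => monotone_nat_of_le_succ fun j => (h j).1
  have hylim : ∀ {t ω}, (∀ j, Y j t ω ≤ Y (j + 1) t ω ∧ |Y j t ω| ≤ E * U t ω) →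
      Tendsto (fun j => Y j t ω) atTop (𝓝 (y t ω)) := fun h =>
    tendsto_atTop_ciSup (hmono h) (hbdd h)
  have hyU : ∀ t, ∀ᵐ ω ∂P, |y t ω| ≤ E * U t ω := fun t => by
    filter_upwards [hgood t] with ω h
    exact le_of_tendsto (hylim h).abs (Eventually.of_forall fun j => (h j).2)
  set θ : ℝ≥0 → Ω → ℝ := fun t ω => ⨅ j, below x (Y j) t ω with hθdef
  have hθp : IsStronglyProgressive 𝓖 θ :=
    isStronglyProgressive_iInf fun j => isStronglyProgressive_below hx (hY j)
  have hθ0 : ∀ s ω, 0 ≤ θ s ω := fun s ω => (iInf_below_mem x Y s ω).1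
  have hθ1 : ∀ s ω, θ s ω ≤ 1 := fun s ω => (iInf_below_mem x Y s ω).2
  have hkj := fun j => hl.posPart.mul_fraction (isStronglyProgressive_below hx (hY j))
    (below_nonneg x (Y j)) (below_le_one x (Y j))
  have hk := hl.posPart.mul_fraction hθp hθ0 hθ1
  have hfj := fun j => integrable_linFlow hl hκm hx hlx hU (hY j)
    (isStronglyProgressive_below hx (hY j)) (below_nonneg x (Y j)) (below_le_one x (Y j)) (hYU j)
  have hf := integrable_linFlow hl hκm hx hlx hU hyp hθp hθ0 hθ1 hyU
  have hfm := measurable_uncurry (isStronglyProgressive_linFlow hl.progressive hx hθp hyp)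
  have hEUi : Integrable (Function.uncurry fun s ω => κ s * (E * U s ω)) (lebesgue.prod P) := by
    refine integrable_bound_mul hκm hl.bound_nonneg hl.bound_integrable hwi hU
      (hUm.const_mul E) hE0.le fun t => ?_
    filter_upwards [hgood t] with ω h
    rw [abs_of_nonneg ((abs_nonneg _).trans (h 0).2)]
  -- An integrable bound for the cash flows of all iterates at once.
  set F : ℝ≥0 → Ω → ℝ := fun s ω => 2 * |l s ω * x s ω| + κ s * (E * U s ω) with hF
  have hFi : Integrable (Function.uncurry F) (lebesgue.prod P) := (hwi.const_mul 2).add hEUi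
  have hfjF : ∀ {s ω}, (∀ j, Y j s ω ≤ Y (j + 1) s ω ∧ |Y j s ω| ≤ E * U s ω) → ∀ j,
      |linFlow l x (below x (Y j)) (Y j) s ω| ≤ F s ω := fun {s ω} h j => by
    refine (abs_linFlow_le (below_nonneg x (Y j) s ω) (below_le_one x (Y j) s ω)
      (hl.neg_bound_le s ω) (hl.bound_nonneg s)).trans ?_
    simp only [hF]
    linarith [mul_le_mul_of_nonneg_left (h j).2 (hl.bound_nonneg s)]
  have hklim : ∀ {s ω}, (∀ j, Y j s ω ≤ Y (j + 1) s ω ∧ |Y j s ω| ≤ E * U s ω) →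
      Tendsto (fun j => max (l s ω) 0 * below x (Y j) s ω) atTop
        (𝓝 (max (l s ω) 0 * θ s ω)) := fun h =>
    (tendsto_below (hmono h)).const_mul _
  have hflim : ∀ {s ω}, (∀ j, Y j s ω ≤ Y (j + 1) s ω ∧ |Y j s ω| ≤ E * U s ω) →
      Tendsto (fun j => linFlow l x (below x (Y j)) (Y j) s ω) atTop
        (𝓝 (linFlow l x θ y s ω)) := fun h =>
    ((hklim h).mul_const _).sub
      (((tendsto_const_nhds.sub (hylim h)).max tendsto_const_nhds).const_mul _)
  have hgoodp := ae_path_of_forall hgoodm hgood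
  have hDlim : ∀ᵐ ω ∂P, ∀ s, Tendsto
      (fun j => discount (fun s ω => max (l s ω) 0 * below x (Y j) s ω) s ω) atTop
      (𝓝 (discount (fun s ω => max (l s ω) 0 * θ s ω) s ω)) := by
    filter_upwards [hgoodp, hl.integrable] with ω h1 h2 s
    refine (Real.continuous_exp.tendsto _).comp (Tendsto.neg ?_)
    refine tendsto_integral_of_dominated_convergence (fun u => |l u ω|) (fun j => ?_)
      h2.abs.integrableOn (fun j => ae_of_all _ fun u => ?_) (ae_restrict_of_ae ?_)
    · exact (measurable_path (measurable_uncurry (hkj j).progressive) ω).aestronglyMeasurable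
    · have a1 : max (l u ω) 0 ≤ |l u ω| := max_le (le_abs_self _) (abs_nonneg _)
      rw [Real.norm_of_nonneg (mul_nonneg (le_max_right _ _) (below_nonneg _ _ _ _))]
      exact (mul_le_of_le_one_right (le_max_right _ _) (below_le_one _ _ _ _)).trans a1
    · filter_upwards [h1] with u hu
      exact hklim hu
  have hyd : ∀ t, (fun ω => discount (fun s ω => max (l s ω) 0 * θ s ω) t ω * y t ω) =ᵐ[P]
      P[tail (fun s ω => discount (fun s ω => max (l s ω) 0 * θ s ω) s ω *
        linFlow l x θ y s ω) t | 𝓖 t] := by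
    intro t
    have hD := isStronglyProgressive_discount hk.progressive
    have hUi : Integrable (fun ω => E * (E * U t ω)) P :=
      ((integrable_condExp.congr (hU t).symm).const_mul E).const_mul E
    have hgm : ∀ {θ y : ℝ≥0 → Ω → ℝ}, IsRate 𝓖 P κ (fun s ω => max (l s ω) 0 * θ s ω) →
        IsStronglyProgressive 𝓖 y → (∀ᵐ ω ∂P, |y t ω| ≤ E * U t ω) →
        Integrable (fun ω => discount (fun s ω => max (l s ω) 0 * θ s ω) t ω * y t ω) P ∧
        ∀ᵐ ω ∂P, ‖discount (fun s ω => max (l s ω) 0 * θ s ω) t ω * y t ω‖ ≤ E * (E * U t ω) := by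
      intro θ y hk hy hyb
      have h1 : ∀ᵐ ω ∂P,
          ‖discount (fun s ω => max (l s ω) 0 * θ s ω) t ω * y t ω‖ ≤ E * (E * U t ω) := by
        filter_upwards [hyb] with ω hω
        rw [norm_mul, Real.norm_of_nonneg (discount_pos _ _ _).le]
        exact mul_le_mul (hk.discount_le _ _) hω (norm_nonneg _) hE0.le
      refine ⟨hUi.mono' ?_ h1, h1⟩
      exact ((measurable_apply hk.measurable_discount t).mul
        (measurable_apply (measurable_uncurry hy) t)).aestronglyMeasurable
    have hlim := tendsto_condExp_unique (m := 𝓖 t) (μ := P)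
      (fun j => tail (fun s ω => discount (fun s ω => max (l s ω) 0 * below x (Y j) s ω) s ω *
          linFlow l x (below x (Y j)) (Y j) s ω) t)
      (fun j ω => discount (fun s ω => max (l s ω) 0 * below x (Y j) s ω) t ω * Y (j + 1) t ω)
      (tail (fun s ω => discount (fun s ω => max (l s ω) 0 * θ s ω) s ω *
        linFlow l x θ y s ω) t)
      (fun ω => discount (fun s ω => max (l s ω) 0 * θ s ω) t ω * y t ω)
      (fun j => integrable_tail ((hkj j).integrable_discount_mul (hfj j)) t)
      (fun j => (hgm (hkj j) (hY (j + 1)) (hYU (j + 1) t)).1) ?_ ?_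
      (fun ω => E * ∫ s, |F s ω| ∂lebesgue) ((integrable_integral_abs hFi).const_mul E)
      (fun ω => E * (E * U t ω)) hUi (fun j => ?_)
      (fun j => (hgm (hkj j) (hY (j + 1)) (hYU (j + 1) t)).2) (fun j => ?_)
    · exact (Filter.EventuallyEq.of_eq (condExp_of_stronglyMeasurable (𝓖.le t)
        ((hD.stronglyAdapted t).mul (hyp.stronglyAdapted t))
        (hgm hk hyp (hyU t)).1).symm).trans hlim.symm
    · filter_upwards [hgoodp, hDlim, integrable_path hFi] with ω h1 h2 h3
      refine tendsto_integral_of_dominated_convergence (fun s => E * F s ω) (fun j => ?_)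
        (h3.const_mul E).integrableOn (fun j => ae_restrict_of_ae ?_) (ae_restrict_of_ae ?_)
      · exact ((measurable_path (hkj j).measurable_discount ω).mul (measurable_path
          (measurable_uncurry (isStronglyProgressive_linFlow hl.progressive hx
            (isStronglyProgressive_below hx (hY j)) (hY j))) ω)).aestronglyMeasurable
      · filter_upwards [h1] with s hs
        rw [norm_mul, Real.norm_of_nonneg (discount_pos _ _ _).le]
        exact mul_le_mul ((hkj j).discount_le _ _) (hfjF hs j) (norm_nonneg _) hE0.le
      · filter_upwards [h1] with s hs
        exact (h2 s).mul (hflim hs)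
    · filter_upwards [hgood t, hDlim] with ω h1 h2
      -- The discount factor is built from iterate `j` while the value is iterate `j + 1`; both have
      -- the same limit.
      exact (h2 t).mul ((tendsto_add_atTop_iff_nat 1).2 (hylim h1))
    · filter_upwards [hgoodp, integrable_path hFi,
        integrable_path ((hkj j).integrable_discount_mul (hfj j))] with ω h1 h2 h3
      refine (abs_tail_le h3 t).trans ?_
      rw [← integral_const_mul]
      refine integral_mono_ae h3.abs (h2.abs.const_mul E) ?_
      filter_upwards [h1] with s hs
      rw [abs_mul, abs_of_pos (discount_pos _ _ _)]
      exact mul_le_mul ((hkj j).discount_le _ _) ((hfjF hs j).trans (le_abs_self _))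
        (abs_nonneg _) hE0.le
    · refine (condExp_congr_ae (hYd j t)).trans ?_ |>.symm
      rw [condExp_of_stronglyMeasurable (𝓖.le t) stronglyMeasurable_condExp integrable_condExp]
  obtain ⟨hky, hyv⟩ := hk.value_of_discounted hfm (measurable_uncurry hyp) hf hyd
  -- At the fixed point the tangent touches, `θ (x - y) = (x - y)⁺`, so the two parts recombine into
  -- `l (x - y)⁺`.
  have halg : ∀ {s ω}, (∀ j, Y j s ω ≤ Y (j + 1) s ω ∧ |Y j s ω| ≤ E * U s ω) →
      linFlow l x θ y s ω - max (l s ω) 0 * θ s ω * y s ω =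
        l s ω * max (x s ω - y s ω) 0 := fun {s ω} h => by
    have a1 := iInf_below_mul_sub (x := x) (hbdd h)
    have a2 : θ s ω * (x s ω - y s ω) = max (x s ω - y s ω) 0 := a1
    have a3 : l s ω = max (l s ω) 0 - max (-l s ω) 0 := by
      rcases le_total 0 (l s ω) with h | h
      · rw [max_eq_left h, max_eq_right (by linarith)]; ring
      · rw [max_eq_right h, max_eq_left (by linarith)]; ring
    unfold linFlow
    conv_rhs => rw [a3]
    linear_combination max (l s ω) 0 * a2
  refine ⟨y, ⟨hyp, ?_, fun t => ?_⟩, fun t => ?_⟩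
  · refine (hf.sub hky).congr ?_
    filter_upwards [ae_prod_of_forall hgoodm hgood] with q hq
    exact halg hq
  · refine (hyv t).trans (condExp_congr_ae ?_)
    filter_upwards [hgoodp] with ω h1
    refine integral_congr_ae (ae_restrict_of_ae ?_)
    filter_upwards [h1] with s hs
    exact halg hs
  · filter_upwards [hyU t, hU t] with ω h1 h2
    rwa [← h2]

end XVA

/-! ### Cutting off processes at a random horizon. -/

namespace XVA

open Filter Set
open scoped Topology

variable {Ω : Type*} {m : MeasurableSpace Ω} {𝓖 : Filtration ℝ≥0 m} {P : Measure Ω}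

open Classical in
/-- The indicator of `[0, b]`. -/
def alive (b : Ω → ℝ≥0) (t : ℝ≥0) (ω : Ω) : ℝ := if t ≤ b ω then 1 else 0

lemma alive_of_le {b : Ω → ℝ≥0} {t : ℝ≥0} {ω : Ω} (h : t ≤ b ω) : alive b t ω = 1 := if_pos h

lemma alive_of_lt {b : Ω → ℝ≥0} {t : ℝ≥0} {ω : Ω} (h : b ω < t) : alive b t ω = 0 :=
  if_neg (not_le.2 h)

/-- For `s ≤ t` the condition `s ≤ b` only involves `min b t`, which is `𝓖 t`-measurable. -/
lemma isStronglyProgressive_alive {b : Ω → ℝ≥0} (hb : ∀ u, MeasurableSet[𝓖 u] {ω | b ω ≤ u}) :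
    IsStronglyProgressive 𝓖 (alive b) := by
  classical
  intro t
  have h1 : Measurable[𝓖 t] fun ω => min (b ω) t := by
    refine measurable_of_Iic fun u => ?_
    rcases le_or_gt t u with h | h
    · convert @MeasurableSet.univ _ (𝓖 t)
      ext ω
      simp [h]
    · convert 𝓖.mono h.le _ (hb u) using 1
      ext ω
      simp [h]
  let _mt : MeasurableSpace Ω := 𝓖 t
  refine Measurable.stronglyMeasurable ?_
  have h2 : MeasurableSet {p : Iic t × Ω | (p.1 : ℝ≥0) ≤ min (b p.2) t} :=
    measurableSet_le (measurable_subtype_coe.comp measurable_fst) (h1.comp measurable_snd)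
  have h3 : Measurable fun p : Iic t × Ω =>
      if (p.1 : ℝ≥0) ≤ min (b p.2) t then (1 : ℝ) else 0 :=
    Measurable.ite h2 measurable_const measurable_const
  refine measurable_of_forall_eq h3 fun p => ?_
  have h4 : (p.1 : ℝ≥0) ≤ t := p.1.2
  simp only [alive, le_min_iff, h4, and_true]

lemma alive_mul_eq_indicator (b : Ω → ℝ≥0) (h : ℝ≥0 → Ω → ℝ) (ω : Ω) :
    (fun s => alive b s ω * h s ω) = (Iic (b ω)).indicator fun s => h s ω := by
  classical
  ext s
  simp [alive, indicator]

lemma tail_alive_mul (b : Ω → ℝ≥0) (h : ℝ≥0 → Ω → ℝ) (t : ℝ≥0) (ω : Ω) :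
    tail (fun s ω => alive b s ω * h s ω) t ω = ∫ s in Ioc t (b ω), h s ω ∂lebesgue := by
  rw [tail, alive_mul_eq_indicator, setIntegral_indicator measurableSet_Iic, Ioi_inter_Iic]

lemma finiteL1_iff [IsProbabilityMeasure P] {b : Ω → ℝ≥0} {Z : ℝ≥0 → Ω → ℝ}
    (hb : Measurable (Function.uncurry (alive b))) (hZ : Measurable (Function.uncurry Z)) :
    FiniteL1 P b Z ↔
      Integrable (Function.uncurry fun s ω => alive b s ω * Z s ω) (lebesgue.prod P) := by
  have hm : Measurable (Function.uncurry fun s ω => alive b s ω * Z s ω) := hb.mul hZ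
  have h1 : ∫⁻ q, ‖Function.uncurry (fun s ω => alive b s ω * Z s ω) q‖ₑ ∂(lebesgue.prod P) =
      ∫⁻ ω, ∫⁻ s in Iic (b ω), ‖Z s ω‖ₑ ∂lebesgue ∂P := by
    rw [lintegral_prod_symm _ hm.enorm.aemeasurable]
    refine lintegral_congr fun ω => ?_
    rw [← lintegral_indicator measurableSet_Iic]
    refine lintegral_congr fun s => ?_
    have := congrFun (alive_mul_eq_indicator b Z ω) s
    simp only [Function.uncurry]
    rw [this, enorm_indicator_eq_indicator_enorm]
  rw [FiniteL1, ← h1]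
  exact ⟨fun h => ⟨hm.aestronglyMeasurable, h⟩, fun h => h.2⟩

lemma finiteL1_congr {b : Ω → ℝ≥0} {Z Z' : ℝ≥0 → Ω → ℝ}
    (h : ∀ᵐ ω ∂P, ∀ s ≤ b ω, Z s ω = Z' s ω) (hZ : FiniteL1 P b Z) : FiniteL1 P b Z' := by
  refine lt_of_le_of_lt (le_of_eq ?_) hZ
  refine lintegral_congr_ae ?_
  filter_upwards [h] with ω hω
  exact setLIntegral_congr_fun measurableSet_Iic fun s hs => by rw [hω s hs]

lemma memH2_iff [IsProbabilityMeasure P] {b : Ω → ℝ≥0} {Z : ℝ≥0 → Ω → ℝ}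
    (hb : Measurable (Function.uncurry (alive b))) (hZ : IsStronglyProgressive 𝓖 Z) :
    MemH2 𝓖 P b Z ↔
      Integrable (Function.uncurry fun s ω => alive b s ω * Z s ω ^ 2) (lebesgue.prod P) := by
  rw [← finiteL1_iff (Z := fun s ω => Z s ω ^ 2) hb ((measurable_uncurry hZ).pow_const 2),
    FiniteL1]
  simp only [enorm_pow]
  exact ⟨fun h => h.finite, fun h => ⟨hZ, h⟩⟩

open Classical in
/-- The constant `|c|` on `[0, T]`, and `0` afterwards. -/
def rateBound (c : ℝ) (T : ℝ≥0) (s : ℝ≥0) : ℝ := if s ≤ T then |c| else 0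

/-- The rate `q`, cut off at the lower bound `-|c|` and at the time `b`. -/
def stoppedRate (b : Ω → ℝ≥0) (c : ℝ) (q : ℝ≥0 → Ω → ℝ) (s : ℝ≥0) (ω : Ω) : ℝ :=
  alive b s ω * max (q s ω) (-|c|)

lemma measurable_rateBound (c : ℝ) (T : ℝ≥0) : Measurable (rateBound c T) := by
  classical
  exact Measurable.ite measurableSet_Iic measurable_const measurable_const

lemma stoppedRate_eq {b : Ω → ℝ≥0} {c : ℝ} {q : ℝ≥0 → Ω → ℝ}
    (hqc : ∀ᵐ ω ∂P, ∀ t ≤ b ω, c ≤ q t ω) :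
    ∀ᵐ ω ∂P, ∀ t ≤ b ω, stoppedRate b c q t ω = q t ω := by
  filter_upwards [hqc] with ω hω t ht
  rw [stoppedRate, alive_of_le ht, one_mul, max_eq_left ((neg_abs_le c).trans (hω t ht))]

/-- The lower bound on `q` holds almost surely and up to `b`. Truncating at `-|c|` makes it hold
everywhere and almost surely changes nothing on `[0, b]`. -/
lemma isRate_stoppedRate {b : Ω → ℝ≥0} {T : ℝ≥0} (hbT : ∀ ω, b ω ≤ T)
    (hb : IsStronglyProgressive 𝓖 (alive b)) {c : ℝ} {q : ℝ≥0 → Ω → ℝ}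
    (hq : IsStronglyProgressive 𝓖 q) (hqc : ∀ᵐ ω ∂P, ∀ t ≤ b ω, c ≤ q t ω)
    (hqi : ∀ᵐ ω ∂P, IntegrableOn (fun s => q s ω) (Iic (b ω)) lebesgue) :
    IsRate 𝓖 P (rateBound c T) (stoppedRate b c q) where
  progressive := hb.mul (hq.map (measurable_id.max measurable_const))
  bound_nonneg s := by unfold rateBound; split_ifs; exacts [abs_nonneg _, le_rfl]
  bound_integrable := by
    classical
    have : rateBound c T = (Iic T).indicator fun _ => |c| := by
      ext s; simp [rateBound, indicator]
    rw [this, integrable_indicator_iff measurableSet_Iic]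
    exact integrableOn_const (lebesgue_Iic_lt_top T).ne
  neg_bound_le s ω := by
    unfold stoppedRate rateBound
    by_cases h : s ≤ b ω
    · rw [alive_of_le h, one_mul, if_pos (h.trans (hbT ω))]
      exact le_max_right _ _
    · rw [alive_of_lt (not_le.1 h), zero_mul]
      split_ifs
      · exact neg_nonpos.2 (abs_nonneg _)
      · simp
  integrable := by
    filter_upwards [stoppedRate_eq hqc, hqi] with ω h1 h2
    have h3 : (fun s => stoppedRate b c q s ω) = (Iic (b ω)).indicator fun s => q s ω := by
      ext s
      by_cases h : s ≤ b ω
      · rw [h1 s h, indicator_of_mem (by exact h)]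
      · rw [stoppedRate, alive_of_lt (not_le.1 h), zero_mul, indicator_of_notMem (by exact h)]
    rw [h3, integrable_indicator_iff measurableSet_Iic]
    exact h2

section Square

/-- The Cauchy-Schwarz inequality on a bounded time interval. -/
lemma sq_setIntegral_abs_le {g : ℝ≥0 → ℝ} {T : ℝ≥0} (hg : IntegrableOn g (Iic T) lebesgue)
    (hg2 : IntegrableOn (fun s => g s ^ 2) (Iic T) lebesgue) :
    (∫ s in Iic T, |g s| ∂lebesgue) ^ 2 ≤
      (lebesgue.real (Iic T) + 1) * ∫ s in Iic T, g s ^ 2 ∂lebesgue := by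
  set a := ∫ s in Iic T, |g s| ∂lebesgue
  set K := lebesgue.real (Iic T) with hK
  have hK0 : 0 ≤ K := measureReal_nonneg
  -- Integrating `(|g| - c)² ≥ 0` would be optimal at `c = a / K`; the `+ 1` keeps the denominator
  -- positive when `T = 0`.
  set c := a / (K + 1) with hc
  have hci : IntegrableOn (fun _ : ℝ≥0 => c ^ 2) (Iic T) lebesgue :=
    integrableOn_const (lebesgue_Iic_lt_top T).ne
  have h1 : 0 ≤ ∫ s in Iic T, (g s ^ 2 - 2 * c * |g s| + c ^ 2) ∂lebesgue := by
    refine integral_nonneg fun s => ?_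
    have : g s ^ 2 - 2 * c * |g s| + c ^ 2 = (|g s| - c) ^ 2 := by rw [← sq_abs (g s)]; ring
    rw [Pi.zero_apply, this]
    exact sq_nonneg _
  rw [integral_add (by exact hg2.sub (hg.abs.const_mul _)) hci,
    integral_sub hg2 (hg.abs.const_mul _), integral_const_mul, setIntegral_const,
    smul_eq_mul] at h1
  have h2 : a = c * (K + 1) := by rw [hc]; field_simp
  have h3 : c ^ 2 * (K + 1) ≤ ∫ s in Iic T, g s ^ 2 ∂lebesgue := by
    change 0 ≤ _ - 2 * c * a + K * c ^ 2 at h1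
    rw [h2] at h1
    nlinarith [sq_nonneg c]
  calc a ^ 2 = (K + 1) * (c ^ 2 * (K + 1)) := by rw [h2]; ring
    _ ≤ _ := mul_le_mul_of_nonneg_left h3 (by linarith)

end Square

end XVA

/-! ### Reduction of the FVA equation and the `H²` estimate. -/

namespace XVA

open Filter Set
open scoped Topology

variable {Ω : Type*} {m : MeasurableSpace Ω} {𝓖 : Filtration ℝ≥0 m} {P : Measure Ω} {n : ℕ}
  {M : Model Ω n}

namespace Model

lemma horizon_le_iff (M : Model Ω n) (ω : Ω) (u : ℝ≥0) :
    M.horizon ω ≤ u ↔ M.bankDefault ω ≤ u ∨ M.T ≤ u := by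
  have h : ((M.horizon ω : ℝ≥0) : WithTop ℝ≥0) = min (M.bankDefault ω) (M.T : WithTop ℝ≥0) := by
    have h1 : min (M.bankDefault ω) (M.T : WithTop ℝ≥0) ≠ ⊤ :=
      ((min_le_right _ _).trans_lt (WithTop.coe_lt_top _)).ne
    obtain ⟨a, ha⟩ := WithTop.ne_top_iff_exists.1 h1
    rw [horizon, ← ha, WithTop.untopD_coe]
  rw [← WithTop.coe_le_coe, h, min_le_iff, WithTop.coe_le_coe]

lemma horizon_le (M : Model Ω n) (ω : Ω) : M.horizon ω ≤ M.T :=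
  (M.horizon_le_iff ω M.T).2 (Or.inr le_rfl)

lemma isStronglyProgressive_alive_horizon (hM : IsStoppingTime 𝓖 M.bankDefault) :
    IsStronglyProgressive 𝓖 (alive M.horizon) := by
  refine isStronglyProgressive_alive fun u => ?_
  simp only [horizon_le_iff]
  exact (hM u).union (@MeasurableSet.const _ (𝓖 u) _)

/-- Progressive rates `l` and `ρ`, bounded from below, that agree with `λ` and `r` up to the
horizon, together with the integrability of `λ X`. -/
structure IsReduction (M : Model Ω n) (𝓖 : Filtration ℝ≥0 m) (P : Measure Ω)
    (X : ℝ≥0 → Ω → ℝ) (κ κ' : ℝ≥0 → ℝ) (l ρ : ℝ≥0 → Ω → ℝ) : Prop where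
  alive : IsStronglyProgressive 𝓖 (alive M.horizon)
  lam : IsStronglyProgressive 𝓖 M.lam
  rate : IsRate 𝓖 P κ l
  measurable_bound : Measurable κ
  rate_eq_zero : ∀ s ω, M.horizon ω < s → l s ω = 0
  rate_eq : ∀ᵐ ω ∂P, ∀ s ≤ M.horizon ω, l s ω = M.lam s ω
  interest : IsRate 𝓖 P κ' ρ
  disc_eq : ∀ᵐ ω ∂P, ∀ s ≤ M.horizon ω, M.disc s ω = discount ρ s ω
  lam_mul : MemH2 𝓖 P M.horizon fun s ω => M.lam s ω * X s ω

/-- The discounted process `X`, on the set where `λ` does not vanish. -/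
def discX (M : Model Ω n) (X ρ : ℝ≥0 → Ω → ℝ) (s : ℝ≥0) (ω : Ω) : ℝ :=
  discount ρ s ω * (M.lam s ω * X s ω / M.lam s ω)

variable {X Y : ℝ≥0 → Ω → ℝ} {κ κ' : ℝ≥0 → ℝ} {l ρ : ℝ≥0 → Ω → ℝ}

namespace IsReduction

/-- Progressivity is available for `λ X`, hence for the quotient by `λ`. The values where `λ = 0` do
not matter, as `X` enters the equation only through `λ (X - Y)⁺`. -/
lemma discX_progressive (h : M.IsReduction 𝓖 P X κ κ' l ρ) :
    IsStronglyProgressive 𝓖 (M.discX X ρ) :=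
  (isStronglyProgressive_discount h.interest.progressive).mul
    (h.lam_mul.progressive.map₂ (g := fun a b => a / b) measurable_div h.lam)

/-- The positive discount factor moves inside the positive part. The exceptional null set is
independent of `Y` and `s`. -/
lemma fvaRate_eq (h : M.IsReduction 𝓖 P X κ κ' l ρ) :
    ∀ᵐ ω ∂P, ∀ (Y : ℝ≥0 → Ω → ℝ) (s : ℝ≥0) (u : ℝ),
      (s ≤ M.horizon ω → u = discount ρ s ω * Y s ω) →
      XVA.alive M.horizon s ω * M.fvaRate X Y s ω = l s ω * max (M.discX X ρ s ω - u) 0 := by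
  filter_upwards [h.rate_eq, h.disc_eq] with ω h1 h2 Y s u hu
  by_cases hs : s ≤ M.horizon ω
  · rw [alive_of_le hs, one_mul, fvaRate, h1 s hs, h2 s hs, hu hs, discX]
    by_cases hl : M.lam s ω = 0
    · simp [hl]
    · rw [mul_div_cancel_left₀ _ hl, ← mul_sub, ← mul_zero (discount ρ s ω),
        ← mul_max_of_nonneg _ _ (discount_pos ρ s ω).le, mul_zero]
      ring
  · rw [alive_of_lt (not_le.1 hs), h.rate_eq_zero s ω (not_le.1 hs), zero_mul, zero_mul]

lemma measurable_alive (h : M.IsReduction 𝓖 P X κ κ' l ρ) :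
    Measurable (Function.uncurry (XVA.alive M.horizon)) := measurable_uncurry h.alive

lemma flow_eq (h : M.IsReduction 𝓖 P X κ κ' l ρ) {y : ℝ≥0 → Ω → ℝ}
    (hy : ∀ s ω, s ≤ M.horizon ω → y s ω = discount ρ s ω * Y s ω) (t : ℝ≥0) :
    M.fvaFlow X Y t =ᵐ[P] tail (fun s ω => l s ω * max (M.discX X ρ s ω - y s ω) 0) t := by
  filter_upwards [h.fvaRate_eq] with ω hω
  rw [fvaFlow, ← tail_alive_mul]
  refine integral_congr_ae (ae_of_all _ fun s => ?_)
  exact hω Y s _ (hy s ω)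

lemma discX_measurable_flow (h : M.IsReduction 𝓖 P X κ κ' l ρ) {y : ℝ≥0 → Ω → ℝ}
    (hy : IsStronglyProgressive 𝓖 y) :
    Measurable (Function.uncurry fun s ω => l s ω * max (M.discX X ρ s ω - y s ω) 0) :=
  measurable_uncurry (h.rate.progressive.mul
    ((h.discX_progressive.sub hy).map (measurable_id.max measurable_const)))

lemma alive_mul_rate (h : M.IsReduction 𝓖 P X κ κ' l ρ) (s : ℝ≥0) (ω : Ω) :
    XVA.alive M.horizon s ω * l s ω = l s ω := by
  by_cases hs : s ≤ M.horizon ω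
  · rw [alive_of_le hs, one_mul]
  · rw [h.rate_eq_zero s ω (not_le.1 hs), mul_zero]

variable [IsProbabilityMeasure P]

lemma finiteL1_fvaRate_iff (h : M.IsReduction 𝓖 P X κ κ' l ρ) {y : ℝ≥0 → Ω → ℝ}
    (hyp : IsStronglyProgressive 𝓖 y)
    (hy : ∀ s ω, s ≤ M.horizon ω → y s ω = discount ρ s ω * Y s ω) :
    FiniteL1 P M.horizon (M.fvaRate X Y) ↔
      Integrable (Function.uncurry fun s ω => l s ω * max (M.discX X ρ s ω - y s ω) 0)
        (lebesgue.prod P) := by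
  have h1 := finiteL1_iff (P := P) h.measurable_alive (h.discX_measurable_flow hyp)
  simp only [← mul_assoc, h.alive_mul_rate] at h1
  rw [← h1]
  have h2 : ∀ᵐ ω ∂P, ∀ s ≤ M.horizon ω, M.fvaRate X Y s ω =
      l s ω * max (M.discX X ρ s ω - y s ω) 0 := by
    filter_upwards [h.fvaRate_eq] with ω hω s hs
    rw [← hω Y s _ (hy s ω), alive_of_le hs, one_mul]
  refine ⟨finiteL1_congr h2, finiteL1_congr ?_⟩
  filter_upwards [h2] with ω hω s hs
  exact (hω s hs).symm

/-- On `{b < t}` both sides vanish: `y` by definition, and the remaining flow because `l` is zero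
after the horizon. The `𝓖 t`-measurable indicator of `{t ≤ b}` therefore passes through the
conditional expectation. -/
lemma solvesReduced (h : M.IsReduction 𝓖 P X κ κ' l ρ) (hY : IsStronglyProgressive 𝓖 Y)
    (hYi : FiniteL1 P M.horizon (M.fvaRate X Y))
    (hYe : ∀ t : ℝ≥0, ∀ᵐ ω ∂P, t ≤ M.horizon ω →
      M.disc t ω * Y t ω = (P[M.fvaFlow X Y t | 𝓖 t]) ω) :
    SolvesReduced 𝓖 P l (M.discX X ρ)
      fun s ω => XVA.alive M.horizon s ω * (discount ρ s ω * Y s ω) := by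
  set y : ℝ≥0 → Ω → ℝ := fun s ω => XVA.alive M.horizon s ω * (discount ρ s ω * Y s ω) with hydef
  have hy : ∀ s ω, s ≤ M.horizon ω → y s ω = discount ρ s ω * Y s ω := fun s ω hs => by
    simp only [hydef, alive_of_le hs, one_mul]
  have hyp : IsStronglyProgressive 𝓖 y :=
    h.alive.mul ((isStronglyProgressive_discount h.interest.progressive).mul hY)
  have hi := (h.finiteL1_fvaRate_iff hyp hy).1 hYi
  refine ⟨hyp, hi, fun t => ?_⟩
  have e1 : (fun ω => XVA.alive M.horizon t ω *
      tail (fun s ω => l s ω * max (M.discX X ρ s ω - y s ω) 0) t ω) =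
      tail (fun s ω => l s ω * max (M.discX X ρ s ω - y s ω) 0) t := by
    ext ω
    by_cases ht : t ≤ M.horizon ω
    · rw [alive_of_le ht, one_mul]
    · rw [alive_of_lt (not_le.1 ht), zero_mul, tail]
      refine (setIntegral_eq_zero_of_forall_eq_zero fun s hs => ?_).symm
      rw [h.rate_eq_zero s ω ((not_le.1 ht).trans hs), zero_mul]
  have hti := integrable_tail hi t
  have e2 : P[tail (fun s ω => l s ω * max (M.discX X ρ s ω - y s ω) 0) t | 𝓖 t] =ᵐ[P]
      fun ω => XVA.alive M.horizon t ω *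
        (P[tail (fun s ω => l s ω * max (M.discX X ρ s ω - y s ω) 0) t | 𝓖 t]) ω := by
    have := condExp_mul_of_stronglyMeasurable_left (μ := P) (m := 𝓖 t)
      (h.alive.stronglyAdapted t) (g := tail (fun s ω => l s ω *
        max (M.discX X ρ s ω - y s ω) 0) t) (by rw [Pi.mul_def, e1]; exact hti) hti
    rw [Pi.mul_def, e1] at this
    exact this
  filter_upwards [e2, hYe t, h.disc_eq, condExp_congr_ae (m := 𝓖 t) (h.flow_eq hy t)]
    with ω a1 a2 a3 a4
  rw [a1]
  by_cases ht : t ≤ M.horizon ω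
  · rw [← a4, ← a2 ht, a3 t ht]
  · simp only [hydef, alive_of_lt (not_le.1 ht), zero_mul]

lemma eq_of_solvesReduced (h : M.IsReduction 𝓖 P X κ κ' l ρ) {y : ℝ≥0 → Ω → ℝ}
    (hy : SolvesReduced 𝓖 P l (M.discX X ρ) y)
    (hyY : ∀ s ω, s ≤ M.horizon ω → y s ω = discount ρ s ω * Y s ω) :
    FiniteL1 P M.horizon (M.fvaRate X Y) ∧ ∀ t : ℝ≥0, ∀ᵐ ω ∂P, t ≤ M.horizon ω →
      M.disc t ω * Y t ω = (P[M.fvaFlow X Y t | 𝓖 t]) ω := by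
  refine ⟨(h.finiteL1_fvaRate_iff hy.progressive hyY).2 hy.integrable, fun t => ?_⟩
  filter_upwards [hy.eq t, h.disc_eq, condExp_congr_ae (m := 𝓖 t) (h.flow_eq hyY t)]
    with ω a1 a2 a3 ht
  rw [a2 t ht, ← hyY t ω ht, a1, a3]

lemma integrable_sq_lam_mul (h : M.IsReduction 𝓖 P X κ κ' l ρ) :
    Integrable (Function.uncurry fun s ω =>
      (XVA.alive M.horizon s ω * (M.lam s ω * X s ω)) ^ 2) (lebesgue.prod P) := by
  refine ((memH2_iff h.measurable_alive h.lam_mul.progressive).1 h.lam_mul).congr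
    (ae_of_all _ fun q => ?_)
  simp only [Function.uncurry, XVA.alive]
  split_ifs <;> ring

lemma integrable_lam_mul (h : M.IsReduction 𝓖 P X κ κ' l ρ) :
    Integrable (Function.uncurry fun s ω =>
      XVA.alive M.horizon s ω * (M.lam s ω * X s ω)) (lebesgue.prod P) := by
  have hm : Measurable (Function.uncurry fun s ω =>
      XVA.alive M.horizon s ω * (M.lam s ω * X s ω)) :=
    h.measurable_alive.mul (measurable_uncurry h.lam_mul.progressive)
  -- On `[0, T] × Ω`, of finite measure, square integrability gives integrability through `|a| ≤ 1 +
  -- a²`.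
  have h1 : Integrable ((Iic M.T ×ˢ (univ : Set Ω)).indicator fun _ => (1 : ℝ))
      (lebesgue.prod P) := by
    rw [integrable_indicator_iff (measurableSet_Iic.prod MeasurableSet.univ)]
    refine integrableOn_const ?_
    rw [Measure.prod_prod, measure_univ, mul_one]
    exact (lebesgue_Iic_lt_top _).ne
  refine (h1.add h.integrable_sq_lam_mul).mono' hm.aestronglyMeasurable (ae_of_all _ fun q => ?_)
  obtain ⟨s, ω⟩ := q
  simp only [Function.uncurry, Pi.add_apply, Real.norm_eq_abs]
  by_cases hs : s ≤ M.horizon ω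
  · have : (s, ω) ∈ Iic M.T ×ˢ (univ : Set Ω) := ⟨hs.trans (M.horizon_le ω), trivial⟩
    rw [indicator_of_mem this, alive_of_le hs, one_mul, ← sq_abs]
    nlinarith [sq_nonneg (|M.lam s ω * X s ω| - 1), abs_nonneg (M.lam s ω * X s ω)]
  · rw [alive_of_lt (not_le.1 hs), zero_mul, abs_zero]
    refine add_nonneg (indicator_nonneg (fun _ _ => zero_le_one) _) (sq_nonneg _)

omit [IsProbabilityMeasure P] in
lemma rate_mul_discX (h : M.IsReduction 𝓖 P X κ κ' l ρ) :
    ∀ᵐ ω ∂P, ∀ s, l s ω * M.discX X ρ s ω =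
      discount ρ s ω * (XVA.alive M.horizon s ω * (M.lam s ω * X s ω)) := by
  filter_upwards [h.rate_eq] with ω hω s
  by_cases hs : s ≤ M.horizon ω
  · rw [alive_of_le hs, one_mul, hω s hs, discX]
    by_cases hl : M.lam s ω = 0
    · simp [hl]
    · rw [mul_div_cancel_left₀ _ hl]; ring
  · rw [alive_of_lt (not_le.1 hs), h.rate_eq_zero s ω (not_le.1 hs), zero_mul, zero_mul, mul_zero]

lemma integrable_rate_mul_discX (h : M.IsReduction 𝓖 P X κ κ' l ρ) :
    Integrable (Function.uncurry fun s ω => l s ω * M.discX X ρ s ω) (lebesgue.prod P) := by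
  have hi := h.interest.integrable_discount_mul h.integrable_lam_mul
  have hm := measurable_uncurry (h.rate.progressive.mul h.discX_progressive)
  refine integrable_prod_of_forall_le hm (integrable_integral_abs hi) ?_ ?_
  · filter_upwards [h.rate_mul_discX, integrable_path hi] with ω h1 h2
    simpa only [h1] using h2
  · filter_upwards [h.rate_mul_discX] with ω h1
    simp only [h1]
    exact le_rfl

lemma memLp_integral_lam_mul (h : M.IsReduction 𝓖 P X κ κ' l ρ) :
    MemLp (fun ω => ∫ s, |XVA.alive M.horizon s ω * (M.lam s ω * X s ω)| ∂lebesgue) 2 P := by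
  have hi := h.integrable_lam_mul
  have hi2 := h.integrable_sq_lam_mul
  rw [memLp_two_iff_integrable_sq (integrable_integral_abs hi).1]
  refine (hi2.integral_prod_right.const_mul (lebesgue.real (Iic M.T) + 1)).mono'
    ((integrable_integral_abs hi).1.pow 2) ?_
  filter_upwards [integrable_path hi, integrable_path hi2] with ω h1 h2
  have h3 := sq_setIntegral_abs_le (T := M.T) h1.integrableOn h2.integrableOn
  have h4 : ∀ s ∉ Iic M.T, |XVA.alive M.horizon s ω * (M.lam s ω * X s ω)| = 0 := fun s hs => by
    rw [alive_of_lt ((M.horizon_le ω).trans_lt (not_le.1 hs)), zero_mul, abs_zero]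
  rw [setIntegral_eq_integral_of_forall_compl_eq_zero h4] at h3
  rw [Real.norm_of_nonneg (sq_nonneg _)]
  refine h3.trans (mul_le_mul_of_nonneg_left ?_ (by positivity))
  exact setIntegral_le_integral h2 (ae_of_all _ fun s => sq_nonneg _)

/-- With `ξ = ∫_0^b |λ X| ds`, the bound `D_s ≤ R D_t` for `s ≥ t` absorbs the division by `D_t` and
gives `|Y_t| ≤ E R E_t ξ`. Since `ξ ∈ L²` by Cauchy-Schwarz, the second moment of `1_{[0,b]} Y` is
bounded uniformly in time, and the horizon is at most `T`. -/
lemma memH2_div (h : M.IsReduction 𝓖 P X κ κ' l ρ) {y : ℝ≥0 → Ω → ℝ}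
    (hy : IsStronglyProgressive 𝓖 y) {E : ℝ} (hE : 0 ≤ E)
    (hyE : ∀ t, ∀ᵐ ω ∂P, |y t ω| ≤
      E * (P[tail (fun s ω => |l s ω * M.discX X ρ s ω|) t | 𝓖 t]) ω) :
    MemH2 𝓖 P M.horizon fun t ω => (discount ρ t ω)⁻¹ * y t ω := by
  set ξ : Ω → ℝ := fun ω =>
    ∫ s, |XVA.alive M.horizon s ω * (M.lam s ω * X s ω)| ∂lebesgue with hξ
  have hξ2 : MemLp ξ 2 P := h.memLp_integral_lam_mul
  have hξi : Integrable ξ P := hξ2.integrable (by norm_num)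
  have hD := isStronglyProgressive_discount h.interest.progressive
  have hDm := h.interest.measurable_discount
  set R := Real.exp (∫ s, κ' s ∂lebesgue) with hR
  have hR0 : 0 < R := Real.exp_pos _
  set Y : ℝ≥0 → Ω → ℝ := fun t ω => (discount ρ t ω)⁻¹ * y t ω with hYdef
  have hYp : IsStronglyProgressive 𝓖 Y := (hD.map measurable_inv).mul hy
  have hbound : ∀ t, ∀ᵐ ω ∂P, |Y t ω| ≤ E * R * (P[ξ | 𝓖 t]) ω := fun t => by
    have hi : Integrable (fun ω => (R * discount ρ t ω) * ξ ω) P := by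
      refine Integrable.bdd_mul (c := R * R) hξi
        ((measurable_apply hDm t).const_mul _).aestronglyMeasurable (ae_of_all _ fun ω => ?_)
      rw [Real.norm_of_nonneg (mul_nonneg hR0.le (discount_pos _ _ _).le)]
      exact mul_le_mul_of_nonneg_left (h.interest.discount_le _ _) hR0.le
    have hwi : Integrable (Function.uncurry fun s ω => |l s ω * M.discX X ρ s ω|)
      (lebesgue.prod P) := h.integrable_rate_mul_discX.abs
    have h1 : P[tail (fun s ω => |l s ω * M.discX X ρ s ω|) t | 𝓖 t] ≤ᵐ[P]
        P[fun ω => (R * discount ρ t ω) * ξ ω | 𝓖 t] := by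
      refine condExp_mono (integrable_tail hwi t) hi ?_
      filter_upwards [h.rate_mul_discX, integrable_path hwi, integrable_path h.integrable_lam_mul,
        h.interest.integrable] with ω a1 a2 a3 a4
      rw [hξ, ← integral_const_mul]
      refine (setIntegral_mono_on a2.integrableOn (a3.abs.const_mul _).integrableOn
        measurableSet_Ioi fun s hs => ?_).trans
        (setIntegral_le_integral (a3.abs.const_mul _) (ae_of_all _ fun s =>
          mul_nonneg (mul_nonneg hR0.le (discount_pos _ _ _).le) (abs_nonneg _)))
      rw [a1, abs_mul, abs_of_pos (discount_pos _ _ _)]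
      exact mul_le_mul_of_nonneg_right (h.interest.discount_le_mul a4 (le_of_lt hs))
        (abs_nonneg _)
    have h2 : P[fun ω => (R * discount ρ t ω) * ξ ω | 𝓖 t] =ᵐ[P]
        fun ω => (R * discount ρ t ω) * (P[ξ | 𝓖 t]) ω :=
      condExp_mul_of_stronglyMeasurable_left ((hD.stronglyAdapted t).const_mul R) hi hξi
    filter_upwards [h1, h2, hyE t] with ω a1 a2 a3
    rw [a2] at a1
    have hp := discount_pos ρ t ω
    rw [hYdef, abs_mul, abs_of_pos (inv_pos.2 hp), inv_mul_le_iff₀ hp]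
    refine a3.trans ((mul_le_mul_of_nonneg_left a1 hE).trans_eq ?_)
    ring
  rw [memH2_iff h.measurable_alive hYp]
  have hm : Measurable (Function.uncurry fun s ω => XVA.alive M.horizon s ω * Y s ω ^ 2) :=
    h.measurable_alive.mul ((measurable_uncurry hYp).pow_const 2)
  have hN2 : ∀ t, MemLp (P[ξ | 𝓖 t]) 2 P := fun t =>
    ⟨integrable_condExp.1, (eLpNorm_condExp_le_eLpNorm ξ one_le_two).trans_lt hξ2.2⟩
  have hN2i : ∀ t, Integrable (fun ω => (P[ξ | 𝓖 t]) ω ^ 2) P := fun t => (hN2 t).integrable_sq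
  have hN2le : ∀ t, ∫ ω, (P[ξ | 𝓖 t]) ω ^ 2 ∂P ≤ (eLpNorm ξ 2 P).toReal ^ 2 := fun t => by
    have h1 := (hN2 t).eLpNorm_eq_integral_rpow_norm two_ne_zero ENNReal.ofNat_ne_top
    have h2 : (eLpNorm (P[ξ | 𝓖 t]) 2 P).toReal ≤ (eLpNorm ξ 2 P).toReal :=
      ENNReal.toReal_mono hξ2.2.ne (eLpNorm_condExp_le_eLpNorm ξ one_le_two)
    have h3 : ∫ ω, (P[ξ | 𝓖 t]) ω ^ 2 ∂P = (eLpNorm (P[ξ | 𝓖 t]) 2 P).toReal ^ 2 := by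
      rw [h1, ENNReal.toReal_ofReal (by positivity)]
      simp only [ENNReal.toReal_ofNat, Real.rpow_two, Real.norm_eq_abs, sq_abs]
      rw [← Real.rpow_natCast, ← Real.rpow_mul (integral_nonneg fun ω => sq_nonneg _)]
      norm_num
    rw [h3]
    exact pow_le_pow_left₀ ENNReal.toReal_nonneg h2 2
  have hb2 : ∀ t, ∀ᵐ ω ∂P, ‖XVA.alive M.horizon t ω * Y t ω ^ 2‖ ≤
      (E * R) ^ 2 * (P[ξ | 𝓖 t]) ω ^ 2 := fun t => by
    filter_upwards [hbound t] with ω hω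
    have h1 : Y t ω ^ 2 ≤ (E * R) ^ 2 * (P[ξ | 𝓖 t]) ω ^ 2 := by
      rw [← sq_abs, ← mul_pow]
      exact pow_le_pow_left₀ (abs_nonneg _) hω 2
    have h2 : 0 ≤ (E * R) ^ 2 * (P[ξ | 𝓖 t]) ω ^ 2 := by positivity
    by_cases ht : t ≤ M.horizon ω
    · rwa [alive_of_le ht, one_mul, Real.norm_of_nonneg (sq_nonneg _)]
    · rwa [alive_of_lt (not_le.1 ht), zero_mul, norm_zero]
  have hti : ∀ t, Integrable (fun ω => XVA.alive M.horizon t ω * Y t ω ^ 2) P := fun t =>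
    ((hN2i t).const_mul _).mono' (measurable_apply hm t).aestronglyMeasurable (hb2 t)
  rw [integrable_prod_iff hm.aestronglyMeasurable]
  refine ⟨ae_of_all _ hti, ?_⟩
  have hc : Integrable ((Iic M.T).indicator fun _ => (E * R) ^ 2 * (eLpNorm ξ 2 P).toReal ^ 2)
      lebesgue := by
    rw [integrable_indicator_iff measurableSet_Iic]
    exact integrableOn_const (lebesgue_Iic_lt_top _).ne
  refine hc.mono' hm.norm.aestronglyMeasurable.integral_prod_right' (ae_of_all _ fun t => ?_)
  rw [Real.norm_of_nonneg (integral_nonneg fun s => norm_nonneg _)]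
  by_cases ht : t ≤ M.T
  · rw [indicator_of_mem (by exact ht)]
    refine (integral_mono_ae (hti t).norm ((hN2i t).const_mul _) (hb2 t)).trans ?_
    rw [integral_const_mul]
    exact mul_le_mul_of_nonneg_left (hN2le t) (by positivity)
  · rw [indicator_of_notMem (by exact ht)]
    refine le_of_eq (integral_eq_zero_of_ae (ae_of_all _ fun ω => ?_))
    simp [Function.uncurry, alive_of_lt ((M.horizon_le ω).trans_lt (not_le.1 ht))]

end IsReduction

end Model

end XVA

/-! ### Well-posedness of the FVA equation and transfer to the replication BSDE. -/

namespace XVA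

open Filter Set
open scoped Topology

variable {Ω : Type*} {m : MeasurableSpace Ω} {𝓖 : Filtration ℝ≥0 m} {P : Measure Ω} {n : ℕ}
  {M : Model Ω n} {X UCVA MVA : ℝ≥0 → Ω → ℝ}

lemma MemH2.add [IsProbabilityMeasure P] {b : Ω → ℝ≥0}
    (hb : Measurable (Function.uncurry (alive b))) {Y Z : ℝ≥0 → Ω → ℝ}
    (hY : MemH2 𝓖 P b Y) (hZ : MemH2 𝓖 P b Z) : MemH2 𝓖 P b fun t ω => Y t ω + Z t ω := by
  have hp : IsStronglyProgressive 𝓖 fun t ω => Y t ω + Z t ω := hY.progressive.add hZ.progressive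
  rw [memH2_iff hb hp]
  have h1 := ((memH2_iff hb hY.progressive).1 hY).const_mul 2
  have h2 := ((memH2_iff hb hZ.progressive).1 hZ).const_mul 2
  refine (h1.add h2).mono' (hb.mul ((measurable_uncurry hp).pow_const 2)).aestronglyMeasurable
    (ae_of_all _ fun q => ?_)
  obtain ⟨s, ω⟩ := q
  simp only [Function.uncurry, Pi.add_apply]
  by_cases hs : s ≤ b ω
  · rw [alive_of_le hs, one_mul, one_mul, one_mul, Real.norm_of_nonneg (sq_nonneg _)]
    nlinarith [sq_nonneg (Y s ω - Z s ω)]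
  · simp [alive_of_lt (not_le.1 hs)]

lemma MemH2.neg {b : Ω → ℝ≥0} {Y : ℝ≥0 → Ω → ℝ} (hY : MemH2 𝓖 P b Y) :
    MemH2 𝓖 P b fun t ω => -Y t ω :=
  ⟨hY.progressive.neg, by simpa only [enorm_neg] using hY.finite⟩

namespace Model

lemma isReduction (hM : M.Standing 𝓖 P) {c c' : ℝ}
    (hr_below : ∀ᵐ ω ∂P, ∀ t ≤ M.horizon ω, c' ≤ M.r t ω)
    (hlam_below : ∀ᵐ ω ∂P, ∀ t ≤ M.horizon ω, c ≤ M.lam t ω)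
    (hlam_int : ∀ᵐ ω ∂P, IntegrableOn (fun s => M.lam s ω) (Iic (M.horizon ω)) lebesgue)
    (hX : MemH2 𝓖 P M.horizon fun t ω => M.lam t ω * X t ω) :
    M.IsReduction 𝓖 P X (rateBound c M.T) (rateBound c' M.T)
      (stoppedRate M.horizon c M.lam) (stoppedRate M.horizon c' M.r) where
  alive := isStronglyProgressive_alive_horizon hM.bankDefault
  lam := hM.lam
  rate := isRate_stoppedRate M.horizon_le (isStronglyProgressive_alive_horizon hM.bankDefault)
    hM.lam hlam_below hlam_int
  measurable_bound := measurable_rateBound c M.T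
  rate_eq_zero s ω h := by rw [stoppedRate, alive_of_lt h, zero_mul]
  rate_eq := stoppedRate_eq hlam_below
  interest := isRate_stoppedRate M.horizon_le
    (isStronglyProgressive_alive_horizon hM.bankDefault) hM.r hr_below
    (hM.r_integrable.mono fun ω h => h _)
  disc_eq := by
    filter_upwards [stoppedRate_eq hr_below] with ω hω s hs
    rw [disc, discount, pathDisc]
    congr 2
    exact setIntegral_congr_fun measurableSet_Iic fun u hu => (hω u (le_trans hu hs)).symm
  lam_mul := hX

lemma IsReduction.hasUniqueH2Solution [IsProbabilityMeasure P] {κ κ' : ℝ≥0 → ℝ}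
    {l ρ : ℝ≥0 → Ω → ℝ}
    (h : M.IsReduction 𝓖 P (fun s ω => M.exposure s ω - UCVA s ω - MVA s ω) κ κ' l ρ) :
    HasUniqueH2Solution 𝓖 P M.horizon (M.SolvesFVA 𝓖 P UCVA MVA) := by
  obtain ⟨y, hy, hyE⟩ := h.rate.exists_solvesReduced h.measurable_bound h.discX_progressive
    h.integrable_rate_mul_discX
  have hY2 := h.memH2_div hy.progressive (Real.exp_pos _).le hyE
  have hS := h.eq_of_solvesReduced (Y := fun t ω => (discount ρ t ω)⁻¹ * y t ω) hy
    fun s ω _ => (mul_inv_cancel_left₀ (discount_pos ρ s ω).ne' _).symm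
  refine ⟨_, hY2, ⟨hY2.progressive, hS.1, hS.2⟩, fun Y' _ hY' t => ?_⟩
  filter_upwards [SolvesReduced.unique h.rate h.discX_progressive
    (h.solvesReduced hY'.progressive hY'.integrable hY'.eq) hy t] with ω hω ht
  rw [alive_of_le ht, one_mul] at hω
  rw [← hω, inv_mul_cancel_left₀ (discount_pos ρ t ω).ne']

lemma fvaRate_sub (M : Model Ω n) (UCVA MVA Y : ℝ≥0 → Ω → ℝ) :
    M.fvaRate (fun s ω => M.exposure s ω - UCVA s ω - MVA s ω)
      (fun s ω => Y s ω - UCVA s ω - MVA s ω) = M.fvaRate M.exposure Y := by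
  ext s ω
  rw [fvaRate, fvaRate]
  congr 3
  ring

/-- Subtracting `UCVA + MVA` from both arguments leaves the difference under the positive part
unchanged, and the defining equations of `UCVA` and `MVA` remove the first two terms of (1). -/
lemma solvesTRC_iff (hUCVA : M.IsValueOf 𝓖 P M.ucvaFlow UCVA)
    (hMVA : M.IsValueOf 𝓖 P M.mvaFlow MVA) (Y : ℝ≥0 → Ω → ℝ) :
    M.SolvesTRC 𝓖 P Y ↔ M.SolvesFVA 𝓖 P UCVA MVA fun t ω => Y t ω - UCVA t ω - MVA t ω := by
  have hflow : ∀ t, M.fvaFlow (fun s ω => M.exposure s ω - UCVA s ω - MVA s ω)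
      (fun s ω => Y s ω - UCVA s ω - MVA s ω) t = M.fvaFlow M.exposure Y t := fun t => by
    ext ω
    rw [fvaFlow, fvaFlow, fvaRate_sub]
  constructor
  · intro h
    refine ⟨(h.progressive.sub hUCVA.progressive).sub hMVA.progressive,
      by rw [fvaRate_sub]; exact h.integrable, fun t => ?_⟩
    rw [hflow]
    filter_upwards [h.eq t, hUCVA.eq t, hMVA.eq t] with ω h1 h2 h3 ht
    rw [mul_sub, mul_sub, h1 ht, h2 ht, h3 ht]
    ring
  · intro h
    have hp : IsStronglyProgressive 𝓖 Y := by
      convert (h.progressive.add hUCVA.progressive).add hMVA.progressive using 3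
      ring
    refine ⟨hp, by rw [← fvaRate_sub M UCVA MVA]; exact h.integrable, fun t => ?_⟩
    filter_upwards [h.eq t, hUCVA.eq t, hMVA.eq t] with ω h1 h2 h3 ht
    rw [← h2 ht, ← h3 ht, ← hflow, ← h1 ht]
    ring

/-- Translation by `UCVA + MVA ∈ H²` is a bijection of `H²` that exchanges the solutions of the two
equations. -/
lemma hasUniqueH2Solution_solvesTRC [IsProbabilityMeasure P]
    (hb : Measurable (Function.uncurry (alive M.horizon)))
    (hUCVA : M.IsValueOf 𝓖 P M.ucvaFlow UCVA) (hMVA : M.IsValueOf 𝓖 P M.mvaFlow MVA)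
    (hF : HasUniqueH2Solution 𝓖 P M.horizon (M.SolvesFVA 𝓖 P UCVA MVA))
    (hV : MemH2 𝓖 P M.horizon fun t ω => UCVA t ω + MVA t ω) :
    HasUniqueH2Solution 𝓖 P M.horizon (M.SolvesTRC 𝓖 P) := by
  obtain ⟨F, hF2, hFS, hFu⟩ := hF
  refine ⟨fun t ω => F t ω + (UCVA t ω + MVA t ω), hF2.add hb hV, ?_, fun Y hY hYS t => ?_⟩
  · rw [solvesTRC_iff hUCVA hMVA]
    convert hFS using 3
    ring
  · have h2 : MemH2 𝓖 P M.horizon fun t ω => Y t ω - UCVA t ω - MVA t ω := by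
      convert hY.add hb hV.neg using 3
      ring
    filter_upwards [hFu _ h2 ((solvesTRC_iff hUCVA hMVA Y).1 hYS) t] with ω hω ht
    rw [← hω ht]
    ring

end Model

end XVA

end

theorem mainTheorem3 {Ω : Type*} {m : MeasurableSpace Ω} (P : Measure Ω) [IsProbabilityMeasure P]
    (𝓖 : Filtration ℝ≥0 m) (h𝓖 : XVA.UsualConditions 𝓖 P)
    {n : ℕ} (M : XVA.Model Ω n) (hM : M.Standing 𝓖 P)
    (UCVA MVA : ℝ≥0 → Ω → ℝ)
    (hUCVA : M.IsValueOf 𝓖 P M.ucvaFlow UCVA)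
    (hMVA : M.IsValueOf 𝓖 P M.mvaFlow MVA)
    (hr_below : ∃ c : ℝ, ∀ᵐ ω ∂P, ∀ t ≤ M.horizon ω, c ≤ M.r t ω)
    (hlam_below : ∃ c : ℝ, ∀ᵐ ω ∂P, ∀ t ≤ M.horizon ω, c ≤ M.lam t ω)
    (hlam_int : ∀ᵐ ω ∂P, IntegrableOn (fun s => M.lam s ω) (Set.Iic (M.horizon ω)) XVA.lebesgue)
    (hr : XVA.MemH2 𝓖 P M.horizon M.r)
    (hX : XVA.MemH2 𝓖 P M.horizon
      (fun t ω => M.lam t ω * (M.exposure t ω - UCVA t ω - MVA t ω))) :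
    XVA.HasUniqueH2Solution 𝓖 P M.horizon (M.SolvesFVA 𝓖 P UCVA MVA) ∧
    (∀ Y : ℝ≥0 → Ω → ℝ, M.SolvesTRC 𝓖 P Y ↔
      M.SolvesFVA 𝓖 P UCVA MVA (fun t ω => Y t ω - UCVA t ω - MVA t ω)) ∧
    (XVA.MemH2 𝓖 P M.horizon (fun t ω => UCVA t ω + MVA t ω) →
      XVA.HasUniqueH2Solution 𝓖 P M.horizon (M.SolvesTRC 𝓖 P)) := by
  obtain ⟨c', hr_below⟩ := hr_below
  obtain ⟨c, hlam_below⟩ := hlam_below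
  have h := M.isReduction hM hr_below hlam_below hlam_int
    (X := fun s ω => M.exposure s ω - UCVA s ω - MVA s ω) hX
  exact ⟨h.hasUniqueH2Solution, M.solvesTRC_iff hUCVA hMVA,
    M.hasUniqueH2Solution_solvesTRC h.measurable_alive hUCVA hMVA h.hasUniqueH2Solution⟩
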